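/- Let $G=(V,E)$ be a finite graph and $\mathcal P$ a partition of $V$; write $\mathcal P[u]$ for the cluster containing $u$. The correlation clustering cost of $\mathcal P$ is $$\mathrm{cost}(\mathcal P)=\bigl|\{\{u,v\}\in\tbinom V2\setminus E:\mathcal P[u]=\mathcal P[v]\}\bigr|+\bigl|\{\{u,v\}\in E:\mathcal P[u]\neq\mathcal P[v]\}\bigr|.$$ Let the vertices be colored with two colors and let $V_i$ be the set of vertices of color $i$. For $0<\alpha<1$, a partition of $V$ is $\alpha$-relaxed fair if every cluster $S$ and every color $i$ satisfy $$\frac{\alpha|V_i|}{|V|}\le\frac{|S\cap V_i|}{|S|}\le\frac{|V_i|}{\alpha|V|}.$$ The problem $\alpha$-relaxed Fair Correlation Clustering asks, given $G$, the coloring and a rational $\alpha$ with $0<\alpha<1$, for an $\alpha$-relaxed fair partition of minimum cost among all $\alpha$-relaxed fair partitions. For rational $\alpha\in(0,1)$ let $\hat\alpha\in\mathbb N$ be minimal such that $\frac{2\hat\alpha}{\alpha}\in\mathbb N$ and $\frac{2\hat\alpha}{\alpha}>4$, and let $d=d(\alpha)=\frac{4\hat\alpha}{\alpha^2}$ (a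 rational number, not necessarily an integer). Theorem. (1) There is a single algorithm (a program for a unit-cost random access machine with addition, truncated subtraction, halving, indirect addressing and zero tests, given the vertex colors, the adjacency matrix, and the numerator and denominator of $\alpha$ in lowest terms) and an absolute constant $C$ such that, for every $n\ge 1$, every $n$-vertex forest $F$ whose vertices are colored with two colors in a ratio of $1:1$ (that is, with equally many vertices of either color), and every rational $0<\alpha<1$, the algorithm solves $\alpha$-relaxed Fair Correlation Clustering on $F$, returning an optimal partition, in at most $C\cdot n^{2d^2+6d+4}\cdot(d+1)^{4d}$ steps. (2) For every such forest and every such $\alpha$, every cluster of every minimum-cost $\alpha$-relaxed fair partition has fewer than $d$ vertices. -/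

import Mathlib

open Finset

/-! ### Correlation clustering with relaxed fairness -/

section Clustering

variable {V : Type*} [Fintype V] [DecidableEq V] {k : ℕ}

/-- All members of the unordered pair `e` lie in the same cluster of `P`. -/
def SameCluster (P : Finpartition (univ : Finset V)) (e : Sym2 V) : Prop :=
  ∀ u ∈ e, ∀ v ∈ e, P.part u = P.part v

open Classical in
/-- Number of non-adjacent pairs of distinct vertices that lie in a common cluster. -/
noncomputable def intraCost (G : SimpleGraph V) (P : Finpartition (univ : Finset V)) : ℕ :=
  #{e : Sym2 V | ¬ e.IsDiag ∧ e ∉ G.edgeSet ∧ SameCluster P e}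

open Classical in
/-- Number of edges whose endpoints lie in different clusters. -/
noncomputable def interCost (G : SimpleGraph V) (P : Finpartition (univ : Finset V)) : ℕ :=
  #{e : Sym2 V | e ∈ G.edgeSet ∧ ¬ SameCluster P e}

/-- The correlation clustering cost of the partition `P` of the vertices of `G`. -/
noncomputable def ccCost (G : SimpleGraph V) (P : Finpartition (univ : Finset V)) : ℕ :=
  intraCost G P + interCost G P

/-- The set `S` is relaxed fair with regard to lower bounds `p i` and upper bounds `q i`: for every
color `i`, the fraction of the vertices of `S` of color `i` lies between `p i` and `q i`. -/
def RelaxedFairSet (c : V → Fin k) (p q : Fin k → ℚ) (S : Finset V) : Prop :=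
  ∀ i, p i ≤ (#{v ∈ S | c v = i} : ℚ) / (#S : ℚ) ∧ (#{v ∈ S | c v = i} : ℚ) / (#S : ℚ) ≤ q i

/-- `α`-relaxed fairness of a set: the bounds are `α |Uᵢ| / |U|` and `|Uᵢ| / (α |U|)`, with `U` the
set of all vertices and `Uᵢ` the set of all vertices of color `i`. -/
def AlphaRelaxedFairSet (c : V → Fin k) (α : ℚ) (S : Finset V) : Prop :=
  RelaxedFairSet c (fun i => α * (#{v | c v = i} : ℚ) / (Fintype.card V : ℚ))
    (fun i => (#{v | c v = i} : ℚ) / (α * (Fintype.card V : ℚ))) S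

/-- A partition of the vertices is `α`-relaxed fair if all its clusters are. -/
def AlphaRelaxedFair (c : V → Fin k) (α : ℚ) (P : Finpartition (univ : Finset V)) : Prop :=
  ∀ S ∈ P.parts, AlphaRelaxedFairSet c α S

/-- `P` is a solution of `α`-relaxed Fair Correlation Clustering on `(G, c)`: an `α`-relaxed fair
partition whose cost is minimum among all `α`-relaxed fair partitions. -/
def IsMinCostAlphaRelaxedFair (G : SimpleGraph V) (c : V → Fin k) (α : ℚ)
    (P : Finpartition (univ : Finset V)) : Prop :=
  AlphaRelaxedFair c α P ∧
    ∀ Q : Finpartition (univ : Finset V), AlphaRelaxedFair c α Q → ccCost G P ≤ ccCost G Q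

/-- Two colors in a ratio of `1 : 1`: both occur equally often. -/
def ColorsOneToOne (c : V → Fin 2) : Prop :=
  #{v | c v = 0} = #{v | c v = 1}

end Clustering

/-- The least natural number `a` such that `2 a / α` is a natural number greater than `4`. -/
noncomputable def alphaHat (α : ℚ) : ℕ :=
  sInf {a : ℕ | (∃ m : ℕ, 2 * (a : ℚ) / α = m) ∧ 4 < 2 * (a : ℚ) / α}

/-- For every positive rational `α` the minimum in the definition of `alphaHat` is attained. -/
theorem alphaHat_isLeast {α : ℚ} (hα : 0 < α) :
    IsLeast {a : ℕ | (∃ m : ℕ, 2 * (a : ℚ) / α = m) ∧ 4 < 2 * (a : ℚ) / α} (alphaHat α) := by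
  have hne : {a : ℕ | (∃ m : ℕ, 2 * (a : ℚ) / α = m) ∧ 4 < 2 * (a : ℚ) / α}.Nonempty := by
    have hnum : 0 < α.num := Rat.num_pos.mpr hα
    have hcast : ((α.num.toNat : ℕ) : ℚ) = (α.num : ℚ) := by
      have := Int.toNat_of_nonneg hnum.le
      exact_mod_cast this
    have hval : 2 * ((5 * α.num.toNat : ℕ) : ℚ) / α = ((10 * α.den : ℕ) : ℚ) := by
      have hmul : α * (α.den : ℚ) = (α.num : ℚ) := Rat.mul_den_eq_num α
      rw [div_eq_iff hα.ne']
      push_cast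
      rw [hcast, ← hmul]
      ring
    refine ⟨5 * α.num.toNat, ⟨10 * α.den, hval⟩, ?_⟩
    rw [hval]
    have := α.den_pos
    exact_mod_cast (by omega : 4 < 10 * α.den)
  exact ⟨Nat.sInf_mem hne, fun _ ha => Nat.sInf_le ha⟩

/-- The number `d = 4 α̂ / α²`, which need not be an integer. -/
noncomputable def clusterBound (α : ℚ) : ℚ :=
  4 * (alphaHat α : ℚ) / α ^ 2

/-! ### Random access machine programs with unit-cost step counting

The machine has registers and a memory, both holding natural numbers and indexed by natural
numbers. The operations available at unit cost are addition, truncated subtraction, halving,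
reading a register, reading or writing a memory cell at a computed address, and a test for zero.
There is no multiplication, so numbers grow by at most one bit per step. -/

namespace RAM

/-- A configuration of registers and memory. -/
structure State where
  /-- the contents of the registers -/
  reg : ℕ → ℕ
  /-- the contents of the memory cells -/
  mem : ℕ → ℕ

/-- Expressions. -/
inductive Expr where
  | lit (m : ℕ)
  | reg (r : ℕ)
  | read (addr : Expr)
  | add (e₁ e₂ : Expr)
  | sub (e₁ e₂ : Expr)
  | half (e : Expr)

/-- The value of an expression. -/
def Expr.eval (s : State) : Expr → ℕ
  | .lit m => m
  | .reg r => s.reg r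
  | .read a => s.mem (a.eval s)
  | .add e₁ e₂ => e₁.eval s + e₂.eval s
  | .sub e₁ e₂ => e₁.eval s - e₂.eval s
  | .half e => e.eval s / 2

/-- The cost of evaluating an expression: one step for each constant, register access, memory
access and operation in it. -/
def Expr.cost : Expr → ℕ
  | .lit _ => 1
  | .reg _ => 1
  | .read a => a.cost + 1
  | .add e₁ e₂ => e₁.cost + e₂.cost + 1
  | .sub e₁ e₂ => e₁.cost + e₂.cost + 1
  | .half e => e.cost + 1

/-- Programs. A test counts as passed if the value of its expression is not zero. -/
inductive Program where
  | skip
  | assign (r : ℕ) (e : Expr)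
  | write (addr e : Expr)
  | seq (p₁ p₂ : Program)
  | cond (e : Expr) (p₁ p₂ : Program)
  | loop (e : Expr) (p : Program)

/-- `Exec p s s' t`: started in the configuration `s`, the program `p` halts in the configuration
`s'` after exactly `t` steps. -/
inductive Exec : Program → State → State → ℕ → Prop where
  | skip (s : State) : Exec .skip s s 1
  | assign (s : State) (r : ℕ) (e : Expr) :
      Exec (.assign r e) s { s with reg := Function.update s.reg r (e.eval s) } (e.cost + 1)
  | write (s : State) (a e : Expr) :
      Exec (.write a e) s { s with mem := Function.update s.mem (a.eval s) (e.eval s) }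
        (a.cost + e.cost + 1)
  | seq {p₁ p₂ : Program} {s s₁ s₂ : State} {t₁ t₂ : ℕ} :
      Exec p₁ s s₁ t₁ → Exec p₂ s₁ s₂ t₂ → Exec (.seq p₁ p₂) s s₂ (t₁ + t₂)
  | cond_true {e : Expr} {p₁ p₂ : Program} {s s' : State} {t : ℕ} :
      e.eval s ≠ 0 → Exec p₁ s s' t → Exec (.cond e p₁ p₂) s s' (e.cost + 1 + t)
  | cond_false {e : Expr} {p₁ p₂ : Program} {s s' : State} {t : ℕ} :
      e.eval s = 0 → Exec p₂ s s' t → Exec (.cond e p₁ p₂) s s' (e.cost + 1 + t)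
  | loop_done {e : Expr} {p : Program} {s : State} :
      e.eval s = 0 → Exec (.loop e p) s s (e.cost + 1)
  | loop_step {e : Expr} {p : Program} {s s₁ s₂ : State} {t₁ t₂ : ℕ} :
      e.eval s ≠ 0 → Exec p s s₁ t₁ → Exec (.loop e p) s₁ s₂ t₂ →
        Exec (.loop e p) s s₂ (e.cost + 1 + t₁ + t₂)

open Classical in
/-- The initial configuration for the instance `(G, c, α)` on the vertices `0, …, n - 1`. Registers
`0`, `1`, `2` hold `n` and the numerator and denominator of the positive rational `α` in lowest
terms. Memory cell `v` holds the color of vertex `v`, and cell `n + u * n + v` holds the entry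
`(u, v)` of the adjacency matrix. Everything else is zero. -/
noncomputable def input {n k : ℕ} (G : SimpleGraph (Fin n)) (c : Fin n → Fin k) (α : ℚ) :
    State where
  reg r := if r = 0 then n else if r = 1 then α.num.toNat else if r = 2 then α.den else 0
  mem a :=
    if h : a < n then (c ⟨a, h⟩ : ℕ)
    else if ∃ u v : Fin n, a = n + u * n + v ∧ G.Adj u v then 1 else 0

/-- The configuration `s` holds the partition `P` as its output: cell `v` contains a label of the
cluster of vertex `v`, where equal labels mean equal clusters. -/
def Outputs {n : ℕ} (s : State) (P : Finpartition (univ : Finset (Fin n))) : Prop :=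
  ∀ u v : Fin n, s.mem u = s.mem v ↔ P.part u = P.part v

end RAM

/-! Cluster sizes. Put M = 2α̂/α, so that d = 2M/α. Suppose that a cluster S of a fair partition has
at least 2M vertices. Choose M of them, α̂ of the rarer color and M - α̂ of the other. This set T is
fair because αM = 2α̂, and the rest stays fair because |S| ≥ 2M (`exists_fair_split`). A forest has
fewer than |S| edges inside S, whereas at least 2|S| pairs run between T and S \ T, as both have at
least five vertices; so the split lowers the cost (`ccCost_lt_of_split`). Hence clusters of optimal
partitions have fewer than 2M < d vertices.

Algorithm. Let all clusters have fewer than E vertices. Giving weight E to one color and 1 to the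
other, the weight of a cluster encodes its composition by a number below E². The key of a clustering
is a number below (n + 1)^(E²) whose digits in base n + 1 count the clusters of each composition.
Fairness and the number of pairs inside clusters depend on the key only, so among clusterings with
equal keys the best is the one that keeps most edges inside clusters. One stored clustering per key
therefore suffices: a stored one can replace the target with the same key in every later combination
(`sim_union`, `sim_join`, `exists_sim_merge`).

Clusters may be disconnected, so there are two phases. The connected components of the optimal
clusters are built by repeatedly removing a vertex with at most one remaining neighbor and folding
its table into that of the neighbor. Whether the clusters of the two vertices are fused is tried
both ways, which is why these tables are also indexed by the composition of the root's cluster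
(`Elim.round`). Then n rounds of merging arbitrary pairs of clusters assemble the optimal clusters
from their components (`run_closure`). Finally the best fair entry is selected (`run_best`,
`run_main`).

Running time. The algorithm is written in a structured language whose compilation and cost are
verified once (`Cmd.runs_compile`, `Cmd.cost_le`). Its loop nests have at most two loops over tables
of (n + 1)^(E²) E² entries and at most six over small ranges. Here E is the minimum of n + 1 and
twice `splitSize`, the latter being at most M. With (n + 1)^n ≤ n^(n + 2) and 2M + 2 ≤ d this gives
the stated bound (`time_le`). -/

/-! ### A structured language and its compilation to the random access machine -/

namespace RAM

/-- Configurations of the structured language: constants, variables, read-only input cells, and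
eight arrays. -/
structure Env where
  con : ℕ → ℕ
  var : ℕ → ℕ
  inp : ℕ → ℕ
  arr : Fin 8 → ℕ → ℕ

/-- Assignment to a variable. -/
def Env.setVar (s : Env) (r x : ℕ) : Env := { s with var := Function.update s.var r x }

/-- Assignment to an array cell. -/
def Env.setArr (s : Env) (k : Fin 8) (a x : ℕ) : Env :=
  { s with arr := Function.update s.arr k (Function.update (s.arr k) a x) }

/-- Expressions with conditionals and with sums over ranges bounded by constants. -/
inductive Ex where
  | lit (m : ℕ)
  | con (c : ℕ)
  | var (r : ℕ)
  | inp (e : Ex)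
  | arr (k : Fin 8) (e : Ex)
  | add (e₁ e₂ : Ex)
  | sub (e₁ e₂ : Ex)
  | half (e : Ex)
  | ite (e e₁ e₂ : Ex)
  | sum (i c : ℕ) (e : Ex)

/-- The value of an expression. -/
def Ex.eval : Ex → Env → ℕ
  | .lit m, _ => m
  | .con c, s => s.con c
  | .var r, s => s.var r
  | .inp e, s => s.inp (e.eval s)
  | .arr k e, s => s.arr k (e.eval s)
  | .add e₁ e₂, s => e₁.eval s + e₂.eval s
  | .sub e₁ e₂, s => e₁.eval s - e₂.eval s
  | .half e, s => e.eval s / 2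
  | .ite e e₁ e₂, s => if e.eval s ≠ 0 then e₁.eval s else e₂.eval s
  | .sum i c e, s => ∑ k ∈ range (s.con c), e.eval (s.setVar i k)

/-- A bound for the number of steps of the compiled expression. -/
def Ex.cost (κ : ℕ → ℕ) : Ex → ℕ
  | .lit _ => 2
  | .con _ => 2
  | .var _ => 2
  | .inp e => e.cost κ + 10
  | .arr _ e => e.cost κ + 30
  | .add e₁ e₂ => e₁.cost κ + e₂.cost κ + 10
  | .sub e₁ e₂ => e₁.cost κ + e₂.cost κ + 10
  | .half e => e.cost κ + 10
  | .ite e e₁ e₂ => e.cost κ + e₁.cost κ + e₂.cost κ + 10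
  | .sum _ c e => κ c * (e.cost κ + 30) + 30

/-- Structured programs. Loops run a number of times that is given by a constant. -/
inductive Cmd where
  | skip
  | assign (r : ℕ) (e : Ex)
  | write (k : Fin 8) (a e : Ex)
  | seq (p₁ p₂ : Cmd)
  | cond (e : Ex) (p₁ p₂ : Cmd)
  | iter (i c : ℕ) (p : Cmd)

/-- `f` applied for `0, …, N - 1` in turn. -/
def iterFor {α : Type*} (f : ℕ → α → α) : ℕ → α → α
  | 0, s => s
  | N + 1, s => f N (iterFor f N s)

/-- The effect of a program. -/
def Cmd.run : Cmd → Env → Env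
  | .skip, s => s
  | .assign r e, s => s.setVar r (e.eval s)
  | .write k a e, s => s.setArr k (a.eval s) (e.eval s)
  | .seq p₁ p₂, s => p₂.run (p₁.run s)
  | .cond e p₁ p₂, s => if e.eval s ≠ 0 then p₁.run s else p₂.run s
  | .iter i c p, s => iterFor (fun k s => p.run (s.setVar i k)) (s.con c) s

/-- A bound for the number of steps of the compiled program. -/
def Cmd.cost (κ : ℕ → ℕ) : Cmd → ℕ
  | .skip => 1
  | .assign _ e => e.cost κ + 10
  | .write _ a e => a.cost κ + e.cost κ + 30
  | .seq p₁ p₂ => p₁.cost κ + p₂.cost κ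
  | .cond e p₁ p₂ => e.cost κ + p₁.cost κ + p₂.cost κ + 10
  | .iter _ c p => κ c * (p.cost κ + 30) + 30

/-- The register of a constant. -/
def cReg (c : ℕ) : ℕ := 3 * c
/-- The register of a variable. -/
def vReg (r : ℕ) : ℕ := 3 * r + 1
/-- Scratch registers. -/
def sReg (j : ℕ) : ℕ := 3 * j + 2

/-- The configuration of the structured language that is represented by a configuration of the
machine. The third constant is the length of the input. -/
def State.abs (s : State) : Env where
  con c := s.reg (cReg c)
  var r := s.reg (vReg r)
  inp a := if a < s.reg (cReg 3) then s.mem a else 0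
  arr k i := s.mem (s.reg (cReg 3) + (8 * i + k))

/-- The address of an array cell. -/
def addrOf (k : Fin 8) (e : Expr) : Expr :=
  .add (.reg (cReg 3)) (.add (.add (.add (.add e e) (.add e e)) (.add (.add e e) (.add e e)))
    (.lit k))

/-- Compilation of expressions; the value is left in the scratch register `j`. -/
def Ex.compile : Ex → ℕ → Program
  | .lit m, j => .assign (sReg j) (.lit m)
  | .con c, j => .assign (sReg j) (.reg (cReg c))
  | .var r, j => .assign (sReg j) (.reg (vReg r))
  | .inp e, j => .seq (e.compile j)
      (.cond (.sub (.reg (cReg 3)) (.reg (sReg j)))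
        (.assign (sReg j) (.read (.reg (sReg j)))) (.assign (sReg j) (.lit 0)))
  | .arr k e, j => .seq (e.compile j)
      (.assign (sReg j) (.read (addrOf k (.reg (sReg j)))))
  | .add e₁ e₂, j => .seq (e₁.compile j) (.seq (e₂.compile (j + 1))
      (.assign (sReg j) (.add (.reg (sReg j)) (.reg (sReg (j + 1))))))
  | .sub e₁ e₂, j => .seq (e₁.compile j) (.seq (e₂.compile (j + 1))
      (.assign (sReg j) (.sub (.reg (sReg j)) (.reg (sReg (j + 1))))))
  | .half e, j => .seq (e.compile j) (.assign (sReg j) (.half (.reg (sReg j))))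
  | .ite e e₁ e₂, j => .seq (e.compile j)
      (.cond (.reg (sReg j)) (e₁.compile j) (e₂.compile j))
  | .sum i c e, j =>
      .seq (.assign (sReg j) (.lit 0)) <|
      .seq (.assign (sReg (j + 1)) (.reg (vReg i))) <|
      .seq (.assign (sReg (j + 2)) (.lit 0)) <|
      .seq (.loop (.sub (.reg (cReg c)) (.reg (sReg (j + 2)))) <|
        .seq (.assign (vReg i) (.reg (sReg (j + 2)))) <|
        .seq (e.compile (j + 3)) <|
        .seq (.assign (sReg j) (.add (.reg (sReg j)) (.reg (sReg (j + 3)))))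
        (.assign (sReg (j + 2)) (.add (.reg (sReg (j + 2))) (.lit 1))))
      (.assign (vReg i) (.reg (sReg (j + 1))))

/-- Compilation of programs; only scratch registers from `j` on are used. -/
def Cmd.compile : Cmd → ℕ → Program
  | .skip, _ => .skip
  | .assign r e, j => .seq (e.compile j) (.assign (vReg r) (.reg (sReg j)))
  | .write k a e, j => .seq (a.compile j) (.seq (e.compile (j + 1))
      (.write (addrOf k (.reg (sReg j))) (.reg (sReg (j + 1)))))
  | .seq p₁ p₂, j => .seq (p₁.compile j) (p₂.compile j)
  | .cond e p₁ p₂, j => .seq (e.compile j)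
      (.cond (.reg (sReg j)) (p₁.compile j) (p₂.compile j))
  | .iter i c p, j =>
      .seq (.assign (sReg j) (.lit 0))
      (.loop (.sub (.reg (cReg c)) (.reg (sReg j))) <|
        .seq (.assign (vReg i) (.reg (sReg j))) <|
        .seq (p.compile (j + 1))
        (.assign (sReg j) (.add (.reg (sReg j)) (.lit 1))))

/-! ### Correctness and cost of the compilation -/

/-- Started in `s`, the program `p` halts after at most `T` steps in a configuration with `Q`. -/
def Runs (p : Program) (s : State) (Q : State → Prop) (T : ℕ) : Prop :=
  ∃ s' t, Exec p s s' t ∧ t ≤ T ∧ Q s'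

theorem Runs.mono {p : Program} {s : State} {Q Q' : State → Prop} {T T' : ℕ}
    (h : Runs p s Q T) (hT : T ≤ T') (hQ : ∀ s', Q s' → Q' s') : Runs p s Q' T' := by
  obtain ⟨s', t, h1, h2, h3⟩ := h
  exact ⟨s', t, h1, h2.trans hT, hQ _ h3⟩

theorem Runs.seq {p₁ p₂ : Program} {s : State} {Q R : State → Prop} {T₁ T₂ : ℕ}
    (h₁ : Runs p₁ s R T₁) (h₂ : ∀ s', R s' → Runs p₂ s' Q T₂) :
    Runs (.seq p₁ p₂) s Q (T₁ + T₂) := by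
  obtain ⟨s₁, t₁, a1, a2, a3⟩ := h₁
  obtain ⟨s₂, t₂, b1, b2, b3⟩ := h₂ s₁ a3
  exact ⟨s₂, _, .seq a1 b1, by omega, b3⟩

/-- Assignment to a register. -/
def State.setReg (s : State) (r x : ℕ) : State := { s with reg := Function.update s.reg r x }

theorem Runs.assign {s : State} {r : ℕ} {e : Expr} {Q : State → Prop}
    (h : Q (s.setReg r (e.eval s))) : Runs (.assign r e) s Q (e.cost + 1) :=
  ⟨_, _, .assign s r e, le_rfl, h⟩

theorem Runs.assign_seq {s : State} {r : ℕ} {e : Expr} {p : Program} {Q : State → Prop} {T : ℕ}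
    (h : Runs p (s.setReg r (e.eval s)) Q T) :
    Runs (.seq (.assign r e) p) s Q (e.cost + 1 + T) :=
  Runs.seq (Runs.assign (Q := fun s' => s' = _) rfl) (by rintro _ rfl; exact h)

theorem Runs.cond {s : State} {e : Expr} {p₁ p₂ : Program} {Q : State → Prop} {T₁ T₂ : ℕ}
    (h₁ : e.eval s ≠ 0 → Runs p₁ s Q T₁) (h₂ : e.eval s = 0 → Runs p₂ s Q T₂) :
    Runs (.cond e p₁ p₂) s Q (e.cost + 1 + T₁ + T₂) := by
  by_cases h : e.eval s = 0
  · obtain ⟨s', t, a, b, c⟩ := h₂ h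
    exact ⟨s', _, .cond_false h a, by omega, c⟩
  · obtain ⟨s', t, a, b, c⟩ := h₁ h
    exact ⟨s', _, .cond_true h a, by omega, c⟩

/-- A loop whose control expression has the value `N - k` after `k` rounds. -/
theorem Runs.loop {e : Expr} {p : Program} {N T : ℕ} (I : ℕ → State → Prop)
    (he : ∀ k s, I k s → e.eval s = N - k)
    (hp : ∀ k s, k < N → I k s → Runs p s (I (k + 1)) T) {s : State} (h0 : I 0 s) :
    Runs (.loop e p) s (I N) (N * (e.cost + 1 + T) + (e.cost + 1)) := by
  -- Induction on the number `m` of rounds that remain.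
  suffices H : ∀ m k s, k + m = N → I k s →
      Runs (.loop e p) s (I N) (m * (e.cost + 1 + T) + (e.cost + 1)) from
    H N 0 s (by omega) h0
  intro m
  induction m with
  | zero =>
    intro k s hk hI
    obtain rfl : k = N := by omega
    exact ⟨s, _, .loop_done (by rw [he _ _ hI]; omega), by omega, hI⟩
  | succ m ih =>
    intro k s hk hI
    obtain ⟨s₁, t₁, a1, a2, a3⟩ := hp k s (by omega) hI
    obtain ⟨s₂, t₂, b1, b2, b3⟩ := ih (k + 1) s₁ (by omega) a3
    refine ⟨s₂, _, .loop_step (by rw [he _ _ hI]; omega) a1 b1, ?_, b3⟩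
    rw [add_mul]; omega

/-- `s'` differs from `s` only in scratch registers from `j` on. -/
def Keeps (j : ℕ) (s s' : State) : Prop :=
  s'.mem = s.mem ∧ ∀ r, (r % 3 ≠ 2 ∨ r < sReg j) → s'.reg r = s.reg r

theorem Keeps.refl (j : ℕ) (s : State) : Keeps j s s := ⟨rfl, fun _ _ => rfl⟩

theorem Keeps.trans {j k : ℕ} {s s' s'' : State} (h : Keeps j s s') (h' : Keeps k s' s'')
    (hjk : j ≤ k) : Keeps j s s'' :=
  ⟨h'.1.trans h.1, fun r hr => (h'.2 r (by unfold sReg at *; omega)).trans (h.2 r hr)⟩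

theorem Keeps.setReg {j k : ℕ} {s s' : State} (h : Keeps j s s') (x : ℕ) (hjk : j ≤ k) :
    Keeps j s (s'.setReg (sReg k) x) := by
  refine ⟨h.1, fun r hr => ?_⟩
  have : r ≠ sReg k := by unfold sReg at *; omega
  simp [State.setReg, this, h.2 r hr]

theorem Keeps.scratch {j i : ℕ} {s s' : State} (h : Keeps j s s') (hi : i < j) :
    s'.reg (sReg i) = s.reg (sReg i) :=
  h.2 _ (Or.inr (by unfold sReg; omega))

theorem Keeps.abs {j : ℕ} {s s' : State} (h : Keeps j s s') : s'.abs = s.abs := by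
  have hc : ∀ c, s'.reg (cReg c) = s.reg (cReg c) := fun c => h.2 _ (Or.inl (by unfold cReg; omega))
  have hv : ∀ c, s'.reg (vReg c) = s.reg (vReg c) := fun c => h.2 _ (Or.inl (by unfold vReg; omega))
  simp only [State.abs, hc, hv, h.1]

@[simp] theorem setReg_reg_self (s : State) (r x : ℕ) : (s.setReg r x).reg r = x := by
  simp [State.setReg]
theorem setReg_reg_of_ne (s : State) {r r' : ℕ} (x : ℕ) (h : r' ≠ r) :
    (s.setReg r x).reg r' = s.reg r' := by
  simp [State.setReg, h]

@[simp] theorem sReg_inj {i j : ℕ} : sReg i = sReg j ↔ i = j := by unfold sReg; omega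
@[simp] theorem vReg_inj {i j : ℕ} : vReg i = vReg j ↔ i = j := by unfold vReg; omega
@[simp] theorem cReg_inj {i j : ℕ} : cReg i = cReg j ↔ i = j := by unfold cReg; omega
@[simp] theorem sReg_ne_vReg {i j : ℕ} : sReg i ≠ vReg j := by unfold sReg vReg; omega
@[simp] theorem vReg_ne_sReg {i j : ℕ} : vReg i ≠ sReg j := by unfold sReg vReg; omega
@[simp] theorem cReg_ne_sReg {i j : ℕ} : cReg i ≠ sReg j := by unfold sReg cReg; omega
@[simp] theorem cReg_ne_vReg {i j : ℕ} : cReg i ≠ vReg j := by unfold vReg cReg; omega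

@[simp] theorem abs_setReg_sReg (s : State) (j x : ℕ) : (s.setReg (sReg j) x).abs = s.abs :=
  ((Keeps.refl j s).setReg x le_rfl).abs

@[simp] theorem abs_setReg_vReg (s : State) (r x : ℕ) :
    (s.setReg (vReg r) x).abs = s.abs.setVar r x := by
  simp only [State.abs, Env.setVar, State.setReg]
  congr 1
  · funext c; simp
  · funext c
    by_cases h : c = r <;> simp [h]
  · funext a; simp
  · funext k i; simp

@[simp] theorem abs_con (s : State) (c : ℕ) : s.abs.con c = s.reg (cReg c) := rfl
@[simp] theorem abs_var (s : State) (c : ℕ) : s.abs.var c = s.reg (vReg c) := rfl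

@[simp] theorem setVar_con (s : Env) (r x : ℕ) : (s.setVar r x).con = s.con := rfl
@[simp] theorem setVar_inp (s : Env) (r x : ℕ) : (s.setVar r x).inp = s.inp := rfl
@[simp] theorem setVar_arr (s : Env) (r x : ℕ) : (s.setVar r x).arr = s.arr := rfl
@[simp] theorem setArr_con (s : Env) (k : Fin 8) (a x : ℕ) : (s.setArr k a x).con = s.con := rfl
@[simp] theorem setArr_inp (s : Env) (k : Fin 8) (a x : ℕ) : (s.setArr k a x).inp = s.inp := rfl
@[simp] theorem setArr_var (s : Env) (k : Fin 8) (a x : ℕ) : (s.setArr k a x).var = s.var := rfl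

theorem addrOf_eval (k : Fin 8) (e : Expr) (s : State) :
    (addrOf k e).eval s = s.reg (cReg 3) + (8 * e.eval s + k) := by
  simp only [addrOf, Expr.eval]; omega

/-- The scratch registers form an evaluation stack: later subexpressions use larger indices, so
values computed earlier survive. Constants never change, which allows the cost to be stated in those
of the initial configuration. -/
theorem Ex.runs_compile (e : Ex) : ∀ (j : ℕ) (s : State),
    Runs (e.compile j) s (fun s' => Keeps j s s' ∧ s'.reg (sReg j) = e.eval s.abs)
      (e.cost s.abs.con) := by
  induction e with
  | lit m => intro j s; exact .assign ⟨(Keeps.refl j s).setReg _ le_rfl, by simp [Expr.eval, eval]⟩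
  | con c => intro j s; exact .assign ⟨(Keeps.refl j s).setReg _ le_rfl, by simp [Expr.eval, eval]⟩
  | var r => intro j s; exact .assign ⟨(Keeps.refl j s).setReg _ le_rfl, by simp [Expr.eval, eval]⟩
  | inp e ih =>
    intro j s
    refine (Runs.seq (ih j s) (T₂ := 10) fun s' ⟨hk, hv⟩ => ?_)
    have h3 := hk.2 (cReg 3) (Or.inl (by unfold cReg; omega))
    refine (Runs.cond (T₁ := 3) (T₂ := 2) (fun h => ?_) (fun h => ?_)).mono (by simp [Expr.cost])
      fun _ h => h
    · simp only [Expr.eval, hv, h3] at h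
      have h4 : e.eval s.abs < s.reg (cReg 3) := by omega
      refine .assign ⟨hk.setReg _ le_rfl, ?_⟩
      rw [setReg_reg_self]
      simp only [Expr.eval, hv, hk.1, eval]
      generalize e.eval s.abs = x at *
      simp [State.abs, h4]
    · simp only [Expr.eval, hv, h3] at h
      have h4 : ¬ e.eval s.abs < s.reg (cReg 3) := by omega
      refine .assign ⟨hk.setReg _ le_rfl, ?_⟩
      rw [setReg_reg_self]
      simp only [Expr.eval, eval]
      generalize e.eval s.abs = x at *
      simp [State.abs, h4]
  | arr k e ih =>
    intro j s
    refine (Runs.seq (ih j s) (T₂ := 30) fun s' ⟨hk, hv⟩ => ?_)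
    have h3 := hk.2 (cReg 3) (Or.inl (by unfold cReg; omega))
    refine (Runs.assign ⟨hk.setReg _ le_rfl, ?_⟩).mono (by simp [Expr.cost, addrOf]) fun _ h => h
    rw [setReg_reg_self]
    simp only [Expr.eval, addrOf_eval, eval, hv, hk.1, State.abs, h3]
  | add e₁ e₂ ih₁ ih₂ =>
    intro j s
    refine (Runs.seq (ih₁ j s) (T₂ := e₂.cost s.abs.con + 4) fun s₁ ⟨hk, hv⟩ => ?_).mono
      (by simp only [cost]; omega) fun _ h => h
    have h2 := ih₂ (j + 1) s₁
    rw [hk.abs] at h2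
    refine Runs.seq h2 fun s₂ ⟨hk', hv'⟩ =>
      .assign ⟨(hk.trans hk' (by omega)).setReg _ le_rfl, ?_⟩
    simp [Expr.eval, eval, hv', hk'.scratch (Nat.lt_succ_self j), hv]
  | sub e₁ e₂ ih₁ ih₂ =>
    intro j s
    refine (Runs.seq (ih₁ j s) (T₂ := e₂.cost s.abs.con + 4) fun s₁ ⟨hk, hv⟩ => ?_).mono
      (by simp only [cost]; omega) fun _ h => h
    have h2 := ih₂ (j + 1) s₁
    rw [hk.abs] at h2
    refine Runs.seq h2 fun s₂ ⟨hk', hv'⟩ =>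
      .assign ⟨(hk.trans hk' (by omega)).setReg _ le_rfl, ?_⟩
    simp [Expr.eval, eval, hv', hk'.scratch (Nat.lt_succ_self j), hv]
  | half e ih =>
    intro j s
    refine (Runs.seq (ih j s) (T₂ := 3) (fun s' ⟨hk, hv⟩ =>
      (Runs.assign ⟨hk.setReg _ le_rfl, ?_⟩))).mono (by simp only [cost]; omega) fun _ h => h
    simp [Expr.eval, eval, hv]
  | ite e e₁ e₂ ih ih₁ ih₂ =>
    intro j s
    refine (Runs.seq (ih j s) (T₂ := 1 + 1 + e₁.cost s.abs.con + e₂.cost s.abs.con)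
      (fun s₁ ⟨hk, hv⟩ => ?_)).mono (by simp only [cost]; omega) fun _ h => h
    have h1 := ih₁ j s₁
    have h2 := ih₂ j s₁
    rw [hk.abs] at h1 h2
    refine Runs.cond (fun h => h1.mono le_rfl ?_) (fun h => h2.mono le_rfl ?_)
    · rintro s' ⟨a, b⟩
      simp only [Expr.eval, hv] at h
      exact ⟨hk.trans a le_rfl, by simp [b, eval, h]⟩
    · rintro s' ⟨a, b⟩
      simp only [Expr.eval, hv] at h
      exact ⟨hk.trans a le_rfl, by simp [b, eval, h]⟩
  | sum i c e ih =>
    intro j s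
    -- The index variable is overwritten in each round, so the invariant excludes it. Its old value
    -- waits in scratch register `j + 1` and is put back after the loop; thus a sum has no side
    -- effects.
    let I : ℕ → State → Prop := fun k s' => s'.mem = s.mem ∧
      (∀ r, (r % 3 ≠ 2 ∨ r < sReg j) → r ≠ vReg i → s'.reg r = s.reg r) ∧
      s'.reg (sReg (j + 1)) = s.reg (vReg i) ∧ s'.reg (sReg (j + 2)) = k ∧
      s'.reg (sReg j) = ∑ k ∈ range k, e.eval (s.abs.setVar i k)
    have hI : ∀ k s', I k s' → ∀ x, s'.abs.setVar i x = s.abs.setVar i x := by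
      rintro k s' ⟨h1, h2, -⟩ x
      have hc : ∀ c, s'.reg (cReg c) = s.reg (cReg c) :=
        fun c => h2 _ (Or.inl (by unfold cReg; omega)) (by simp)
      simp only [State.abs, Env.setVar, h1, hc]
      congr 1
      funext r
      by_cases hr : r = i
      · simp [hr]
      · simp [hr, h2 (vReg r) (Or.inl (by unfold vReg; omega)) (by simp [hr])]
    refine Runs.mono (T := 2 + (2 + (2 +
      ((s.abs.con c * (4 + (2 + (e.cost s.abs.con + (4 + 4)))) + 4)
      + 2)))) (.assign_seq <| .assign_seq <| .assign_seq <|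
      Runs.seq (Runs.loop (N := s.abs.con c) I ?_ ?_ ?_) ?_) ?_ fun _ h => h
    · rintro k s' ⟨-, h2, -, h3, -⟩
      simp [Expr.eval, h3, h2 (cReg c) (Or.inl (by unfold cReg; omega)) (by simp)]
    · intro k s' hk hI'
      obtain ⟨h1, h2, h3, h4, h5⟩ := id hI'
      apply Runs.assign_seq
      have h := ih (j + 3) (s'.setReg (vReg i) k)
      simp only [abs_setReg_vReg, hI k s' hI', setVar_con] at h
      simp only [Expr.eval, h4]
      refine Runs.seq h ?_
      rintro s'' ⟨hk, hv⟩
      apply Runs.assign_seq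
      apply Runs.assign
      refine ⟨hk.1.trans h1, fun r hr hri => ?_, ?_, ?_, ?_⟩
      · rw [setReg_reg_of_ne, setReg_reg_of_ne, hk.2 r (by unfold sReg at *; omega),
          setReg_reg_of_ne _ _ hri, h2 r hr hri] <;> unfold sReg at * <;> omega
      · rw [setReg_reg_of_ne _ _ (by simp), setReg_reg_of_ne _ _ (by simp),
          hk.scratch (by omega), setReg_reg_of_ne _ _ (by simp), h3]
      · simp only [setReg_reg_self, Expr.eval]
        rw [setReg_reg_of_ne _ _ (by simp), hk.scratch (by omega),
          setReg_reg_of_ne _ _ (by simp), h4]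
      · rw [setReg_reg_of_ne _ _ (by simp), setReg_reg_self]
        simp only [Expr.eval]
        rw [hk.scratch (by omega), setReg_reg_of_ne _ _ (by simp), h5, hv, sum_range_succ]
    · refine ⟨rfl, fun r hr _ => ?_, ?_, ?_, ?_⟩
      · rw [setReg_reg_of_ne, setReg_reg_of_ne, setReg_reg_of_ne] <;> unfold sReg at * <;> omega
      · rw [setReg_reg_of_ne _ _ (by simp), setReg_reg_self]
        simp only [Expr.eval]
        rw [setReg_reg_of_ne _ _ (by simp)]
      · simp [Expr.eval]
      · rw [setReg_reg_of_ne _ _ (by simp), setReg_reg_of_ne _ _ (by simp)]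
        simp [Expr.eval]
    · rintro s' ⟨h1, h2, h3, h4, h5⟩
      apply Runs.assign
      refine ⟨⟨h1, fun r hr => ?_⟩, ?_⟩
      · by_cases hri : r = vReg i
        · subst hri; simp [Expr.eval, h3]
        · rw [setReg_reg_of_ne _ _ hri, h2 r hr hri]
      · rw [setReg_reg_of_ne _ _ (by simp), h5]; simp [eval]
    · simp only [cost, abs_con]
      generalize s.reg (cReg c) = x
      have : x * (4 + (2 + (e.cost s.abs.con + (4 + 4)))) ≤ x * (e.cost s.abs.con + 30) :=
        Nat.mul_le_mul_left _ (by omega)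
      omega

theorem iterFor_inv {α : Type*} (I : ℕ → α → Prop) {f : ℕ → α → α} {N : ℕ} {s : α} (h0 : I 0 s)
    (h : ∀ k s, k < N → I k s → I (k + 1) (f k s)) : I N (iterFor f N s) := by
  suffices ∀ m ≤ N, I m (iterFor f m s) from this N le_rfl
  intro m
  induction m with
  | zero => intro _; exact h0
  | succ m ih => intro hm; exact h m _ (by omega) (ih (by omega))

theorem run_con (p : Cmd) : ∀ s, (p.run s).con = s.con ∧ (p.run s).inp = s.inp := by
  induction p with
  | skip => simp [Cmd.run]
  | assign r e => simp [Cmd.run]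
  | write k a e => simp [Cmd.run]
  | seq p₁ p₂ ih₁ ih₂ => intro s; simp [Cmd.run, ih₁, ih₂]
  | cond e p₁ p₂ ih₁ ih₂ => intro s; simp only [Cmd.run]; split_ifs <;> simp [ih₁, ih₂]
  | iter i c p ih =>
    intro s
    exact iterFor_inv (fun _ (s' : Env) => s'.con = s.con ∧ s'.inp = s.inp) ⟨rfl, rfl⟩
      fun k s' _ h => by simp [ih, h]

/-- The arrays are interleaved behind the input: the offset modulo 8 tells the array and the
quotient tells the index. Hence a write affects one cell of one array and no input cell. -/
theorem abs_write (s : State) (k : Fin 8) (a x : ℕ) :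
    State.abs { s with mem := Function.update s.mem (s.reg (cReg 3) + (8 * a + k)) x } =
      s.abs.setArr k a x := by
  simp only [State.abs, Env.setArr]
  congr 1
  · funext b
    split_ifs with h
    · rw [Function.update_of_ne (by omega)]
    · rfl
  · funext k' i
    by_cases hk : k' = k
    · subst hk
      by_cases hi : i = a
      · simp [hi]
      · simp [hi]
    · have : (k' : ℕ) ≠ k := fun h => hk (Fin.ext h)
      rw [Function.update_of_ne (by omega), Function.update_of_ne hk]

/-- A loop counter sits in scratch register `j` and its body is compiled at `j + 1`, so the body
cannot disturb it. Since no command changes a constant, the number of rounds is fixed on entry. -/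
theorem Cmd.runs_compile (p : Cmd) : ∀ (j : ℕ) (s : State),
    Runs (p.compile j) s (fun s' => s'.abs = p.run s.abs ∧ ∀ i < j,
      s'.reg (sReg i) = s.reg (sReg i)) (p.cost s.abs.con) := by
  induction p with
  | skip => intro j s; exact ⟨s, _, .skip s, le_rfl, rfl, fun _ _ => rfl⟩
  | assign r e =>
    intro j s
    refine (Runs.seq (e.runs_compile j s) (T₂ := 2) (fun s' ⟨hk, hv⟩ =>
      .assign ⟨?_, fun i hi => ?_⟩)).mono (by simp only [cost]; omega) fun _ h => h
    · simp [run, hk.abs, Expr.eval, hv]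
    · rw [setReg_reg_of_ne _ _ (by simp), hk.scratch hi]
  | write k a e =>
    intro j s
    refine (Runs.seq (a.runs_compile j s) (T₂ := e.cost s.abs.con + 30) fun s₁ ⟨hk, hv⟩ => ?_).mono
      (by simp only [cost]; omega) fun _ h => h
    have h2 := e.runs_compile (j + 1) s₁
    rw [hk.abs] at h2
    refine Runs.seq h2 fun s₂ ⟨hk', hv'⟩ => ⟨_, _, .write s₂ _ _, ?_, ?_, fun i hi => ?_⟩
    · simp [Expr.cost, addrOf]
    · rw [addrOf_eval]
      simp only [Expr.eval]
      rw [abs_write, hk'.abs, hk.abs, hv', hk'.scratch (by omega), hv, run]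
    · exact (hk'.scratch (by omega)).trans (hk.scratch hi)
  | seq p₁ p₂ ih₁ ih₂ =>
    intro j s
    refine Runs.seq (ih₁ j s) fun s₁ ⟨h1, h2⟩ => ?_
    have h := ih₂ j s₁
    rw [h1, (run_con p₁ _).1] at h
    exact h.mono le_rfl fun s₂ ⟨h3, h4⟩ => ⟨h3, fun i hi => (h4 i hi).trans (h2 i hi)⟩
  | cond e p₁ p₂ ih₁ ih₂ =>
    intro j s
    refine (Runs.seq (e.runs_compile j s) (T₂ := 1 + 1 + p₁.cost s.abs.con + p₂.cost s.abs.con)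
      (fun s₁ ⟨hk, hv⟩ => ?_)).mono (by simp only [cost]; omega) fun _ h => h
    have h1 := ih₁ j s₁
    have h2 := ih₂ j s₁
    rw [hk.abs] at h1 h2
    refine Runs.cond (fun h => h1.mono le_rfl ?_) (fun h => h2.mono le_rfl ?_)
    · rintro s' ⟨a, b⟩
      simp only [Expr.eval, hv] at h
      exact ⟨by simp [a, run, h], fun i hi => (b i hi).trans (hk.scratch hi)⟩
    · rintro s' ⟨a, b⟩
      simp only [Expr.eval, hv] at h
      exact ⟨by simp [a, run, h], fun i hi => (b i hi).trans (hk.scratch hi)⟩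
  | iter i c p ih =>
    intro j s
    let I : ℕ → State → Prop := fun k s' => s'.reg (sReg j) = k ∧
      s'.abs = iterFor (fun k s => p.run (s.setVar i k)) k s.abs ∧
      ∀ i < j, s'.reg (sReg i) = s.reg (sReg i)
    have hcon : ∀ k s', I k s' → s'.abs.con = s.abs.con := by
      rintro k s' ⟨-, h, -⟩
      rw [h]
      exact iterFor_inv (fun _ (s' : Env) => s'.con = s.abs.con) rfl fun k s' _ h => by
        simp [run_con, h]
    refine Runs.mono (T := 2 + (s.abs.con c * (4 + (2 + (p.cost s.abs.con + 4))) + 4))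
      (.assign_seq <| Runs.mono (Runs.loop (N := s.abs.con c) (I := I) ?_ ?_ ?_) le_rfl ?_) ?_
      fun _ h => h
    · rintro k s' hI
      have := congrFun (hcon k s' hI) c
      simp only [abs_con] at this
      simp [Expr.eval, hI.1, this]
    · rintro k s' hk hI
      obtain ⟨h1, h2, h3⟩ := id hI
      apply Runs.assign_seq
      have h := ih (j + 1) (s'.setReg (vReg i) k)
      simp only [abs_setReg_vReg, setVar_con, hcon k s' hI] at h
      simp only [Expr.eval, h1]
      refine Runs.seq h fun s₂ ⟨h4, h5⟩ => .assign ⟨?_, ?_, fun i' hi' => ?_⟩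
      · simp only [setReg_reg_self, Expr.eval]
        rw [h5 j (by omega), setReg_reg_of_ne _ _ (by simp), h1]
      · rw [abs_setReg_sReg, h4, h2]; rfl
      · rw [setReg_reg_of_ne _ _ (by simp; omega), h5 i' (by omega),
          setReg_reg_of_ne _ _ (by simp), h3 i' hi']
    · exact ⟨by simp [Expr.eval], by simp [iterFor],
        fun i' hi' => by rw [setReg_reg_of_ne _ _ (by simp; omega)]⟩
    · rintro s' ⟨-, h1, h2⟩
      exact ⟨h1, h2⟩
    · simp only [cost, abs_con]
      generalize s.reg (cReg c) = x
      have : x * (4 + (2 + (p.cost s.abs.con + 4))) ≤ x * (p.cost s.abs.con + 30) :=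
        Nat.mul_le_mul_left _ (by omega)
      omega

end RAM

namespace RAM

/-! ### Cost bounds -/

/-- The constants that count as table sizes in cost bounds. -/
def isBig (c : ℕ) : Bool := c == 10 || c == 11

/-- Exponents of a cost bound: of the small constants and of the table size. -/
def Ex.deg : Ex → ℕ × ℕ
  | .lit _ => 0
  | .con _ => 0
  | .var _ => 0
  | .inp e => e.deg
  | .arr _ e => e.deg
  | .add e₁ e₂ => e₁.deg ⊔ e₂.deg
  | .sub e₁ e₂ => e₁.deg ⊔ e₂.deg
  | .half e => e.deg
  | .ite e e₁ e₂ => e.deg ⊔ e₁.deg ⊔ e₂.deg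
  | .sum _ c e => e.deg + (if isBig c then (0, 1) else (1, 0))

/-- Coefficient of a cost bound. -/
def Ex.size : Ex → ℕ
  | .lit _ => 2
  | .con _ => 2
  | .var _ => 2
  | .inp e => e.size + 10
  | .arr _ e => e.size + 30
  | .add e₁ e₂ => e₁.size + e₂.size + 10
  | .sub e₁ e₂ => e₁.size + e₂.size + 10
  | .half e => e.size + 10
  | .ite e e₁ e₂ => e.size + e₁.size + e₂.size + 10
  | .sum _ _ e => e.size + 60

/-- Exponents of a cost bound: of the small constants and of the table size. -/
def Cmd.deg : Cmd → ℕ × ℕ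
  | .skip => 0
  | .assign _ e => e.deg
  | .write _ a e => a.deg ⊔ e.deg
  | .seq p₁ p₂ => p₁.deg ⊔ p₂.deg
  | .cond e p₁ p₂ => e.deg ⊔ p₁.deg ⊔ p₂.deg
  | .iter _ c p => p.deg + (if isBig c then (0, 1) else (1, 0))

/-- Coefficient of a cost bound. -/
def Cmd.size : Cmd → ℕ
  | .skip => 1
  | .assign _ e => e.size + 10
  | .write _ a e => a.size + e.size + 30
  | .seq p₁ p₂ => p₁.size + p₂.size
  | .cond e p₁ p₂ => e.size + p₁.size + p₂.size + 10
  | .iter _ _ p => p.size + 60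

/-- The monomial with given exponents. -/
def mono (X N : ℕ) (d : ℕ × ℕ) : ℕ := X ^ d.1 * N ^ d.2

theorem mono_le {X N : ℕ} (hX : 1 ≤ X) (hN : 1 ≤ N) {d d' : ℕ × ℕ} (h : d ≤ d') :
    mono X N d ≤ mono X N d' :=
  Nat.mul_le_mul (Nat.pow_le_pow_right hX h.1) (Nat.pow_le_pow_right hN h.2)

theorem one_le_mono {X N : ℕ} (hX : 1 ≤ X) (hN : 1 ≤ N) (d : ℕ × ℕ) : 1 ≤ mono X N d :=
  Nat.one_le_iff_ne_zero.2 (by unfold mono; positivity)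

theorem mono_add (X N : ℕ) (d d' : ℕ × ℕ) : mono X N (d + d') = mono X N d * mono X N d' := by
  simp only [mono, Prod.fst_add, Prod.snd_add, pow_add]; ring

/-- Monomials are at least 1, so the overhead of each round and of the loop itself is absorbed by
the coefficient. -/
theorem loop_cost_le {X N z C S : ℕ} (hX : 1 ≤ X) (hN : 1 ≤ N) {d d' : ℕ × ℕ}
    (hz : z ≤ mono X N d') (hC : C ≤ S * mono X N d) :
    z * (C + 30) + 30 ≤ (S + 60) * mono X N (d + d') := by
  have h1 := one_le_mono hX hN d
  have h2 := one_le_mono hX hN d'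
  rw [mono_add]
  generalize mono X N d = A at *
  generalize mono X N d' = B at *
  calc z * (C + 30) + 30 ≤ B * (S * A + 30 * A) + 30 * (A * B) := by
        apply Nat.add_le_add
        · exact Nat.mul_le_mul hz (by omega)
        · exact Nat.le_mul_of_pos_right _ (Nat.mul_pos h1 h2)
    _ = (S + 60) * (A * B) := by ring

/-- Reduces the cost of a concrete expression to `size` and `deg`, which are computed from the
syntax alone. -/
theorem Ex.cost_le {κ : ℕ → ℕ} {X N : ℕ} (hX : 1 ≤ X) (hN : 1 ≤ N)
    (hκ : ∀ c, κ c ≤ mono X N (if isBig c then (0, 1) else (1, 0))) (e : Ex) :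
    e.cost κ ≤ e.size * mono X N e.deg := by
  have key : ∀ {a d d'}, d ≤ d' → a * mono X N d ≤ a * mono X N d' :=
    fun h => Nat.mul_le_mul_left _ (mono_le hX hN h)
  have h1 := one_le_mono hX hN
  induction e with
  | lit m => simp [cost, size, deg, mono]
  | con c => simp [cost, size, deg, mono]
  | var r => simp [cost, size, deg, mono]
  | inp e ih => simp only [cost, size, deg, add_mul]; have := h1 e.deg; omega
  | arr k e ih => simp only [cost, size, deg, add_mul]; have := h1 e.deg; omega
  | half e ih => simp only [cost, size, deg, add_mul]; have := h1 e.deg; omega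
  | add e₁ e₂ ih₁ ih₂ =>
    simp only [cost, size, deg, add_mul]
    have := h1 (e₁.deg ⊔ e₂.deg)
    have := ih₁.trans (key (le_sup_left (b := e₂.deg)))
    have := ih₂.trans (key (le_sup_right (a := e₁.deg)))
    omega
  | sub e₁ e₂ ih₁ ih₂ =>
    simp only [cost, size, deg, add_mul]
    have := h1 (e₁.deg ⊔ e₂.deg)
    have := ih₁.trans (key (le_sup_left (b := e₂.deg)))
    have := ih₂.trans (key (le_sup_right (a := e₁.deg)))
    omega
  | ite e e₁ e₂ ih ih₁ ih₂ =>
    simp only [cost, size, deg, add_mul]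
    have := h1 (e.deg ⊔ e₁.deg ⊔ e₂.deg)
    have := ih.trans (key (d' := e.deg ⊔ e₁.deg ⊔ e₂.deg) (le_sup_left.trans le_sup_left))
    have := ih₁.trans (key (d' := e.deg ⊔ e₁.deg ⊔ e₂.deg) (le_sup_right.trans le_sup_left))
    have := ih₂.trans (key (d' := e.deg ⊔ e₁.deg ⊔ e₂.deg) le_sup_right)
    omega
  | sum i c e ih => exact loop_cost_le hX hN (hκ c) ih

theorem Cmd.cost_le {κ : ℕ → ℕ} {X N : ℕ} (hX : 1 ≤ X) (hN : 1 ≤ N)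
    (hκ : ∀ c, κ c ≤ mono X N (if isBig c then (0, 1) else (1, 0))) (p : Cmd) :
    p.cost κ ≤ p.size * mono X N p.deg := by
  have key : ∀ {a d d'}, d ≤ d' → a * mono X N d ≤ a * mono X N d' :=
    fun h => Nat.mul_le_mul_left _ (mono_le hX hN h)
  have h1 := one_le_mono hX hN
  have he := Ex.cost_le hX hN hκ
  induction p with
  | skip => simp [cost, size, deg, mono]
  | assign r e =>
    simp only [cost, size, deg, add_mul]; have := h1 e.deg; have := he e; omega
  | write k e₁ e₂ =>
    simp only [cost, size, deg, add_mul]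
    have := h1 (e₁.deg ⊔ e₂.deg)
    have := (he e₁).trans (key (le_sup_left (b := e₂.deg)))
    have := (he e₂).trans (key (le_sup_right (a := e₁.deg)))
    omega
  | seq p₁ p₂ ih₁ ih₂ =>
    simp only [cost, size, deg, add_mul]
    have := ih₁.trans (key (le_sup_left (b := p₂.deg)))
    have := ih₂.trans (key (le_sup_right (a := p₁.deg)))
    omega
  | cond e e₁ e₂ ih₁ ih₂ =>
    simp only [cost, size, deg, add_mul]
    have := h1 (e.deg ⊔ e₁.deg ⊔ e₂.deg)
    have := (he e).trans (key (d' := e.deg ⊔ e₁.deg ⊔ e₂.deg) (le_sup_left.trans le_sup_left))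
    have := ih₁.trans (key (d' := e.deg ⊔ e₁.deg ⊔ e₂.deg) (le_sup_right.trans le_sup_left))
    have := ih₂.trans (key (d' := e.deg ⊔ e₁.deg ⊔ e₂.deg) le_sup_right)
    omega
  | iter i c e ih => exact loop_cost_le hX hN (hκ c) ih

end RAM

/-! ### Labelings and their keys -/

/-- Graph data on the vertices `0, …, n - 1`: vertex weights, adjacency, and a bound on cluster
sizes. -/
structure Inst where
  n : ℕ
  E : ℕ
  wt : ℕ → ℕ
  adj : ℕ → ℕ → ℕ

namespace Inst

variable (I : Inst)

/-- Total value of the vertices with label `i`. -/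
def wsum (f : ℕ → ℕ) (l : ℕ → ℕ) (i : ℕ) : ℕ := ∑ x ∈ range I.n, if l x = i then f x else 0

/-- Number of vertices with label `i`. -/
def sz (l : ℕ → ℕ) (i : ℕ) : ℕ := I.wsum (fun _ => 1) l i

/-- Total weight of the vertices with label `i`. -/
def tau (l : ℕ → ℕ) (i : ℕ) : ℕ := I.wsum I.wt l i

/-- All labels occur fewer than `E` times. -/
def Cap (l : ℕ → ℕ) : Prop := ∀ i < I.n, I.sz l i < I.E

/-- The key of a labeling encodes the multiset of the weights of its labels. -/
def key (l : ℕ → ℕ) : ℕ := ∑ i ∈ range I.n, (I.n + 1) ^ I.tau l i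

/-- The key together with the weight of the label of the vertex `r`. -/
def rkey (r : ℕ) (l : ℕ → ℕ) : ℕ := I.key l + (I.n + 1) ^ (I.E * I.E) * I.tau l (l r)

/-- The ordered pair `(u, v)` is an edge inside a cluster. -/
def Kept (l : ℕ → ℕ) (u v : ℕ) : Prop := I.adj u v ≠ 0 ∧ l u = l v ∧ l u < I.n

instance (l : ℕ → ℕ) (u v : ℕ) : Decidable (I.Kept l u v) := by unfold Kept; infer_instance

/-- Number of ordered pairs that are edges inside clusters. -/
def keep (l : ℕ → ℕ) : ℕ := ∑ u ∈ range I.n, ∑ v ∈ range I.n, if I.Kept l u v then 1 else 0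

/-- Number of ordered pairs that are not edges inside clusters. -/
def miss (l : ℕ → ℕ) : ℕ := ∑ u ∈ range I.n, ∑ v ∈ range I.n, if I.Kept l u v then 0 else 1

variable {I}

/-- Tables minimize `miss`, while `keep` is what adds up when labelings are combined; this identity
passes between the two. -/
theorem keep_add_miss (l : ℕ → ℕ) : I.keep l + I.miss l = I.n * I.n := by
  unfold keep miss
  rw [← sum_add_distrib]
  simp_rw [← sum_add_distrib]
  have : ∀ u v, ((if I.Kept l u v then 1 else 0) + if I.Kept l u v then 0 else 1) = 1 := by
    intro u v; split_ifs <;> rfl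
  simp [this]

theorem wsum_congr {f l l' : ℕ → ℕ} (h : ∀ x < I.n, l x = l' x) (i : ℕ) :
    I.wsum f l i = I.wsum f l' i :=
  sum_congr rfl fun x hx => by rw [h x (mem_range.1 hx)]

theorem key_congr {l l' : ℕ → ℕ} (h : ∀ x < I.n, l x = l' x) : I.key l = I.key l' :=
  sum_congr rfl fun i _ => by rw [tau, tau, wsum_congr h]

theorem rkey_congr {l l' : ℕ → ℕ} {r : ℕ} (h : ∀ x < I.n, l x = l' x) (hr : l r = l' r) :
    I.rkey r l = I.rkey r l' := by
  rw [rkey, rkey, key_congr h, hr, tau, tau, wsum_congr h]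

theorem cap_congr {l l' : ℕ → ℕ} (h : ∀ x < I.n, l x = l' x) : I.Cap l ↔ I.Cap l' := by
  unfold Cap sz; simp_rw [wsum_congr h]

theorem miss_congr {l l' : ℕ → ℕ} (h : ∀ x < I.n, l x = l' x) : I.miss l = I.miss l' :=
  sum_congr rfl fun u hu => sum_congr rfl fun v hv => by
    simp only [Kept, h u (mem_range.1 hu), h v (mem_range.1 hv)]

/-- Every weight is `E` or `1`. -/
def TwoWeights (I : Inst) : Prop := ∀ x < I.n, I.wt x = I.E ∨ I.wt x = 1

theorem tau_split (hw : I.TwoWeights) (l : ℕ → ℕ) (i : ℕ) :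
    I.tau l i = I.E * I.wsum (fun x => if I.wt x = I.E then 1 else 0) l i +
      I.wsum (fun x => if I.wt x = I.E then 0 else 1) l i ∧
    I.sz l i = I.wsum (fun x => if I.wt x = I.E then 1 else 0) l i +
      I.wsum (fun x => if I.wt x = I.E then 0 else 1) l i := by
  simp only [tau, sz, wsum, mul_sum, ← sum_add_distrib]
  constructor <;> refine sum_congr rfl fun x hx => ?_
  · rcases hw x (mem_range.1 hx) with h | h
    · split_ifs <;> simp_all
    · split_ifs <;> simp_all
  · split_ifs <;> rfl

/-- With fewer than `E` vertices in total there are fewer than `E` light ones, so the two counts are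
the quotient and the remainder of the weight by `E`. -/
theorem heavy_eq_div (hw : I.TwoWeights) {l : ℕ → ℕ} {i : ℕ} (h : I.sz l i < I.E) :
    I.wsum (fun x => if I.wt x = I.E then 1 else 0) l i = I.tau l i / I.E ∧
    I.wsum (fun x => if I.wt x = I.E then 0 else 1) l i = I.tau l i % I.E := by
  obtain ⟨h1, h2⟩ := tau_split hw l i
  have h3 : I.wsum (fun x => if I.wt x = I.E then 0 else 1) l i < I.E := by omega
  rw [h1]
  constructor
  · rw [Nat.mul_add_div (by omega), Nat.div_eq_of_lt h3, add_zero]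
  · rw [Nat.mul_add_mod, Nat.mod_eq_of_lt h3]

theorem sz_eq (hw : I.TwoWeights) {l : ℕ → ℕ} {i : ℕ} (h : I.sz l i < I.E) :
    I.sz l i = I.tau l i / I.E + I.tau l i % I.E := by
  obtain ⟨h1, h2⟩ := heavy_eq_div hw h
  rw [(tau_split hw l i).2, h1, h2]

theorem tau_lt (hw : I.TwoWeights) {l : ℕ → ℕ} {i : ℕ} (h : I.sz l i < I.E) :
    I.tau l i < I.E * I.E := by
  obtain ⟨h1, h2⟩ := tau_split hw l i
  generalize I.wsum _ l i = r at *
  generalize I.wsum _ l i = b at *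
  rw [h1]
  have : I.E * (r + 1) ≤ I.E * I.E ∨ b < 1 := by
    left; exact Nat.mul_le_mul_left _ (by omega)
  rw [mul_add] at this
  have : I.E * r ≤ I.E * r := le_rfl
  have : I.E * r + b < I.E * (r + 1) := by rw [mul_add]; omega
  exact this.trans_le (Nat.mul_le_mul_left _ (by omega))

/-- Each of the n labels contributes at most (n + 1)^(E² - 1). -/
theorem key_lt (hw : I.TwoWeights) {l : ℕ → ℕ} (h : I.Cap l) :
    I.key l < (I.n + 1) ^ (I.E * I.E) := by
  rcases Nat.eq_zero_or_pos I.n with hn | hn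
  · simp [key, hn]
  have hE : 0 < I.E := (Nat.zero_le _).trans_lt (h 0 hn)
  obtain ⟨m, hm⟩ : ∃ m, I.E * I.E = m + 1 := ⟨I.E * I.E - 1, by have := Nat.mul_pos hE hE; omega⟩
  calc I.key l ≤ ∑ i ∈ range I.n, (I.n + 1) ^ m := by
        refine sum_le_sum fun i hi => Nat.pow_le_pow_right (by omega) ?_
        have := tau_lt hw (h i (mem_range.1 hi)); omega
    _ = I.n * (I.n + 1) ^ m := by simp
    _ < (I.n + 1) * (I.n + 1) ^ m := by
        apply Nat.mul_lt_mul_of_pos_right (by omega); positivity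
    _ = (I.n + 1) ^ (I.E * I.E) := by rw [hm, pow_succ, mul_comm]

theorem rkey_lt (hw : I.TwoWeights) {l : ℕ → ℕ} {r : ℕ} (h : I.Cap l)
    (hr : I.tau l (l r) < I.E * I.E) :
    I.rkey r l < (I.n + 1) ^ (I.E * I.E) * (I.E * I.E) := by
  have h1 := key_lt hw h
  unfold rkey
  generalize (I.n + 1) ^ (I.E * I.E) = N at *
  calc _ < N * (I.tau l (l r) + 1) := by rw [mul_add]; omega
    _ ≤ _ := Nat.mul_le_mul_left _ hr

/-- The root weight sits above all digits of the key, so division with remainder by (n + 1)^(E²)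
recovers both. -/
theorem rkey_inj (hw : I.TwoWeights) {l l' : ℕ → ℕ} {r r' : ℕ} (h : I.Cap l) (h' : I.Cap l')
    (hr : I.rkey r l = I.rkey r' l') : I.key l = I.key l' ∧ I.tau l (l r) = I.tau l' (l' r') := by
  have h1 := key_lt hw h
  have h2 := key_lt hw h'
  unfold rkey at hr
  generalize (I.n + 1) ^ (I.E * I.E) = N at *
  have a : (I.key l + N * I.tau l (l r)) % N = I.key l := by
    rw [Nat.add_mul_mod_self_left, Nat.mod_eq_of_lt h1]
  have b : (I.key l' + N * I.tau l' (l' r')) % N = I.key l' := by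
    rw [Nat.add_mul_mod_self_left, Nat.mod_eq_of_lt h2]
  have hk : I.key l = I.key l' := by rw [← a, ← b, hr]
  refine ⟨hk, ?_⟩
  rw [hk] at hr
  exact Nat.eq_of_mul_eq_mul_left (by omega) (Nat.add_left_cancel hr)

theorem digits_unique {B : ℕ} : ∀ (m : ℕ) (c c' : ℕ → ℕ), (∀ t, c t < B) → (∀ t, c' t < B) →
    ∑ t ∈ range m, c t * B ^ t = ∑ t ∈ range m, c' t * B ^ t → ∀ t < m, c t = c' t := by
  intro m
  induction m with
  | zero => intro _ _ _ _ _ t ht; omega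
  | succ m ih =>
    intro c c' hc hc' h
    have hB : 0 < B := (Nat.zero_le _).trans_lt (hc 0)
    have hs : ∀ c : ℕ → ℕ, ∑ t ∈ range (m + 1), c t * B ^ t =
        c 0 + B * ∑ t ∈ range m, c (t + 1) * B ^ t := by
      intro c
      rw [sum_range_succ', mul_sum, add_comm]
      simp only [pow_zero, mul_one]
      congr 1
      exact sum_congr rfl fun t _ => by ring
    rw [hs c, hs c'] at h
    have h0 : c 0 = c' 0 := by
      have := congrArg (· % B) h
      simpa [Nat.add_mul_mod_self_left, Nat.mod_eq_of_lt (hc 0), Nat.mod_eq_of_lt (hc' 0)]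
        using this
    rw [h0] at h
    have h1 := Nat.eq_of_mul_eq_mul_left hB (Nat.add_left_cancel h)
    have := ih (fun t => c (t + 1)) (fun t => c' (t + 1)) (fun t => hc _) (fun t => hc' _) h1
    intro t ht
    rcases t with _ | t
    · exact h0
    · exact this t (by omega)

/-- Number of labels of weight `t`. -/
def cnt (I : Inst) (l : ℕ → ℕ) (t : ℕ) : ℕ := #{i ∈ range I.n | I.tau l i = t}

theorem sum_tau_eq (hw : I.TwoWeights) {l : ℕ → ℕ} (h : I.Cap l) (f : ℕ → ℕ) :
    ∑ i ∈ range I.n, f (I.tau l i) = ∑ t ∈ range (I.E * I.E), I.cnt l t * f t := by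
  rw [← sum_fiberwise_of_maps_to (t := range (I.E * I.E)) (g := fun i => I.tau l i)
    (fun i hi => mem_range.2 (tau_lt hw (h i (mem_range.1 hi))))]
  refine sum_congr rfl fun t _ => ?_
  rw [cnt, card_eq_sum_ones, sum_mul]
  refine sum_congr rfl fun i hi => ?_
  rw [(mem_filter.1 hi).2, one_mul]

/-- At most n labels have a given weight, so these counts are the digits of the key in base n + 1.
-/
theorem cnt_eq (hw : I.TwoWeights) {l l' : ℕ → ℕ} (h : I.Cap l) (h' : I.Cap l')
    (hk : I.key l = I.key l') (t : ℕ) : I.cnt l t = I.cnt l' t := by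
  have hb : ∀ l t, I.cnt l t < I.n + 1 := fun l t =>
    Nat.lt_succ_of_le ((card_filter_le _ _).trans (by simp))
  by_cases ht : t < I.E * I.E
  · unfold key at hk
    rw [sum_tau_eq hw h (fun t => (I.n + 1) ^ t), sum_tau_eq hw h' (fun t => (I.n + 1) ^ t)] at hk
    exact digits_unique _ _ _ (hb l) (hb l') hk t ht
  · have : ∀ l, I.Cap l → I.cnt l t = 0 := by
      intro l hl
      refine card_eq_zero.2 (filter_eq_empty_iff.2 fun i hi => ?_)
      have := tau_lt hw (hl i (mem_range.1 hi)); omega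
    rw [this l h, this l' h']

/-- Every sum over clusters of a function of their weights is therefore a function of the key. This
is applied to the squares of the cluster sizes. -/
theorem sum_eq_of_key (hw : I.TwoWeights) {l l' : ℕ → ℕ} (h : I.Cap l) (h' : I.Cap l')
    (hk : I.key l = I.key l') (f : ℕ → ℕ) :
    ∑ i ∈ range I.n, f (I.tau l i) = ∑ i ∈ range I.n, f (I.tau l' i) := by
  rw [sum_tau_eq hw h, sum_tau_eq hw h']
  exact sum_congr rfl fun t _ => by rw [cnt_eq hw h h' hk]

theorem exists_label_of_key (hw : I.TwoWeights) {l l' : ℕ → ℕ} (h : I.Cap l) (h' : I.Cap l')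
    (hk : I.key l = I.key l') {i : ℕ} (hi : i < I.n) :
    ∃ i' < I.n, I.tau l' i' = I.tau l i := by
  have h1 : 0 < I.cnt l (I.tau l i) := card_pos.2 ⟨i, by simp [hi]⟩
  rw [cnt_eq hw h h' hk] at h1
  obtain ⟨i', hi'⟩ := card_pos.1 h1
  simp only [mem_filter, mem_range] at hi'
  exact ⟨i', hi'⟩

theorem exists_labels_of_key (hw : I.TwoWeights) {l l' : ℕ → ℕ} (h : I.Cap l) (h' : I.Cap l')
    (hk : I.key l = I.key l') {i j : ℕ} (hi : i < I.n) (hj : j < I.n) (hij : i ≠ j) :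
    ∃ i' < I.n, ∃ j' < I.n, i' ≠ j' ∧ I.tau l' i' = I.tau l i ∧ I.tau l' j' = I.tau l j := by
  by_cases ht : I.tau l i = I.tau l j
  -- Two labels of equal weight need two different counterparts, so the count must exceed 1.
  · have h1 : 1 < I.cnt l (I.tau l i) :=
      one_lt_card.2 ⟨i, by simp [hi], j, by simp [hj, ht], hij⟩
    rw [cnt_eq hw h h' hk] at h1
    obtain ⟨i', hi', j', hj', hne⟩ := one_lt_card.1 h1
    simp only [mem_filter, mem_range] at hi' hj'
    exact ⟨i', hi'.1, j', hj'.1, hne, hi'.2, hj'.2.trans ht⟩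
  · obtain ⟨i', hi', h1⟩ := exists_label_of_key hw h h' hk hi
    obtain ⟨j', hj', h2⟩ := exists_label_of_key hw h h' hk hj
    exact ⟨i', hi', j', hj', fun e => ht (by rw [← h1, ← h2, e]), h1, h2⟩

/-! ### Merging two labels -/

/-- Relabel `j` as `i`. -/
def merge (l : ℕ → ℕ) (i j : ℕ) (x : ℕ) : ℕ := if l x = j then i else l x

theorem wsum_merge {f l : ℕ → ℕ} {i j : ℕ} (hij : i ≠ j) (k : ℕ) :
    I.wsum f (merge l i j) k =
      if k = i then I.wsum f l i + I.wsum f l j else if k = j then 0 else I.wsum f l k := by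
  unfold wsum merge
  split_ifs with h1 h2
  · rw [← sum_add_distrib]
    refine sum_congr rfl fun x _ => ?_
    split_ifs <;> grind
  · exact sum_eq_zero fun x _ => by split_ifs <;> grind
  · refine sum_congr rfl fun x _ => ?_
    split_ifs <;> grind

/-- The emptied label `j` still contributes (n + 1)^0, hence the final 1. The point is that the new
key depends only on the old key and the two weights. -/
theorem key_merge {l : ℕ → ℕ} {i j : ℕ} (hi : i < I.n) (hj : j < I.n) (hij : i ≠ j) :
    I.key (merge l i j) + (I.n + 1) ^ I.tau l i + (I.n + 1) ^ I.tau l j =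
      I.key l + (I.n + 1) ^ (I.tau l i + I.tau l j) + 1 := by
  have hsplit : ∀ g : ℕ → ℕ, ∑ k ∈ range I.n, g k =
      g i + (g j + ∑ k ∈ ((range I.n).erase i).erase j, g k) := by
    intro g
    rw [add_sum_erase _ _ (by simp [hj, hij.symm]), add_sum_erase _ _ (by simp [hi])]
  unfold key
  rw [hsplit, hsplit (fun k => (I.n + 1) ^ I.tau l k)]
  have : ∑ k ∈ ((range I.n).erase i).erase j, (I.n + 1) ^ I.tau (merge l i j) k =
      ∑ k ∈ ((range I.n).erase i).erase j, (I.n + 1) ^ I.tau l k := by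
    refine sum_congr rfl fun k hk => ?_
    simp only [mem_erase] at hk
    rw [tau, wsum_merge hij, if_neg hk.2.1, if_neg hk.1]; rfl
  rw [this]
  simp only [tau, wsum_merge hij, if_true, if_neg hij.symm, pow_zero]
  omega

theorem miss_merge_le {l : ℕ → ℕ} {i : ℕ} (hi : i < I.n) (j : ℕ) :
    I.miss (merge l i j) ≤ I.miss l := by
  refine sum_le_sum fun u _ => sum_le_sum fun v _ => ?_
  unfold Kept merge
  split_ifs <;> grind

/-- `l` has the same key as `m` and misses at most as many edges. -/
structure Sim (I : Inst) (r : ℕ) (l m : ℕ → ℕ) : Prop where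
  cap_left : I.Cap l
  cap_right : I.Cap m
  rkey_eq : I.rkey r l = I.rkey r m
  miss_le : I.miss l ≤ I.miss m

/-- Below the cap, sizes are functions of weights, so the merged clusters of `l` and `m` are equally
large. -/
theorem cap_merge_of_cap (hw : I.TwoWeights) {l m : ℕ → ℕ} {i j i' j' : ℕ} (hi : i < I.n)
    (hi' : i' < I.n) (hij : i ≠ j) (hij' : i' ≠ j') (hj : j < I.n) (hj' : j' < I.n)
    (hl : I.Cap l) (hm : I.Cap m)
    (h1 : I.tau l i = I.tau m i') (h2 : I.tau l j = I.tau m j') (hc : I.Cap (merge m i' j')) :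
    I.Cap (merge l i j) := by
  intro k hk
  have hci := hc i' hi'
  unfold sz at hci ⊢
  rw [wsum_merge hij]
  rw [wsum_merge hij', if_pos rfl] at hci
  split_ifs with a b
  · have e1 := sz_eq hw (hl i hi)
    have e2 := sz_eq hw (hl j hj)
    have e3 := sz_eq hw (hm i' hi')
    have e4 := sz_eq hw (hm j' hj')
    rw [h1] at e1
    rw [h2] at e2
    unfold sz at e1 e2 e3 e4
    omega
  · omega
  · exact hl k hk

/-! ### Labelings of parts of the vertex set -/

/-- `l` labels the vertices that are owned by `v`, with labels owned by `v`. -/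
def Owned (I : Inst) (own : ℕ → ℕ) (v : ℕ) (l : ℕ → ℕ) : Prop :=
  ∀ x < I.n, (own x = v → l x < I.n ∧ own (l x) = v) ∧ (own x ≠ v → l x = I.n)

/-- Common extension of labelings of disjoint sets. -/
def union (I : Inst) (l₁ l₂ : ℕ → ℕ) (x : ℕ) : ℕ := if l₁ x < I.n then l₁ x else l₂ x

/-- Transfer of everything owned by `u` to `v`. -/
def give (own : ℕ → ℕ) (u v : ℕ) (x : ℕ) : ℕ := if own x = u then v else own x

/-- Edges between vertices of different owners join the owners. -/
def OwnedEdges (I : Inst) (own : ℕ → ℕ) : Prop :=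
  ∀ x < I.n, ∀ y < I.n, I.adj x y ≠ 0 → own x ≠ own y → own x = x ∧ own y = y

theorem Owned.cases {own : ℕ → ℕ} {u v : ℕ} {l₁ l₂ : ℕ → ℕ} (huv : u ≠ v)
    (h₁ : I.Owned own v l₁) (h₂ : I.Owned own u l₂) {x : ℕ} (hx : x < I.n) :
    (own x = v ∧ l₁ x < I.n ∧ own (l₁ x) = v ∧ l₂ x = I.n) ∨
    (own x = u ∧ l₁ x = I.n ∧ l₂ x < I.n ∧ own (l₂ x) = u) ∨
    (own x ≠ v ∧ own x ≠ u ∧ l₁ x = I.n ∧ l₂ x = I.n) := by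
  have a := h₁ x hx
  have b := h₂ x hx
  grind

theorem owned_union {own : ℕ → ℕ} {u v : ℕ} {l₁ l₂ : ℕ → ℕ} (huv : u ≠ v)
    (h₁ : I.Owned own v l₁) (h₂ : I.Owned own u l₂) :
    I.Owned (give own u v) v (I.union l₁ l₂) := by
  intro x hx
  unfold give union
  rcases Owned.cases huv h₁ h₂ hx with h | h | h <;> grind

theorem owned_merge {own : ℕ → ℕ} {v : ℕ} {l : ℕ → ℕ} (h : I.Owned own v l) {i : ℕ}
    (hi : i < I.n) (hv : own i = v) {j : ℕ} (hj : j < I.n) : I.Owned own v (merge l i j) := by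
  intro x hx
  have := h x hx
  unfold merge
  grind

theorem wsum_union {own : ℕ → ℕ} {u v : ℕ} {l₁ l₂ : ℕ → ℕ} (huv : u ≠ v)
    (h₁ : I.Owned own v l₁) (h₂ : I.Owned own u l₂) (f : ℕ → ℕ) {i : ℕ} (hi : i < I.n) :
    I.wsum f (I.union l₁ l₂) i = I.wsum f l₁ i + I.wsum f l₂ i := by
  unfold wsum
  rw [← sum_add_distrib]
  refine sum_congr rfl fun x hx => ?_
  unfold union
  rcases Owned.cases huv h₁ h₂ (mem_range.1 hx) with h | h | h <;> grind

theorem wsum_eq_zero {own : ℕ → ℕ} {v : ℕ} {l : ℕ → ℕ} (h : I.Owned own v l) (f : ℕ → ℕ)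
    {i : ℕ} (hi : i < I.n) (hv : own i ≠ v) : I.wsum f l i = 0 := by
  refine sum_eq_zero fun x hx => if_neg ?_
  rintro rfl
  have := h x (mem_range.1 hx)
  grind

/-- Every label is empty in at least one of the two labelings, where it contributes (n + 1)^0 = 1.
This surplus of one per label is the summand `I.n`. -/
theorem key_union {own : ℕ → ℕ} {u v : ℕ} {l₁ l₂ : ℕ → ℕ} (huv : u ≠ v)
    (h₁ : I.Owned own v l₁) (h₂ : I.Owned own u l₂) :
    I.key (I.union l₁ l₂) + I.n = I.key l₁ + I.key l₂ := by
  unfold key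
  have hn : ∑ i ∈ range I.n, (I.n + 1) ^ I.tau (I.union l₁ l₂) i + I.n =
      ∑ i ∈ range I.n, ((I.n + 1) ^ I.tau (I.union l₁ l₂) i + 1) := by simp [sum_add_distrib]
  rw [hn, ← sum_add_distrib]
  refine sum_congr rfl fun i hi => ?_
  have hi := mem_range.1 hi
  rw [tau, wsum_union huv h₁ h₂ _ hi]
  by_cases hv : own i = v
  · have : own i ≠ u := by rw [hv]; exact huv.symm
    simp [tau, wsum_eq_zero h₂ _ hi this]
  · simp [tau, wsum_eq_zero h₁ _ hi hv, add_comm]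

theorem cap_union {own : ℕ → ℕ} {u v : ℕ} {l₁ l₂ : ℕ → ℕ} (huv : u ≠ v)
    (h₁ : I.Owned own v l₁) (h₂ : I.Owned own u l₂) (c₁ : I.Cap l₁) (c₂ : I.Cap l₂) :
    I.Cap (I.union l₁ l₂) := by
  intro i hi
  have a := c₁ i hi
  have b := c₂ i hi
  unfold sz at *
  rw [wsum_union huv h₁ h₂ _ hi]
  by_cases hv : own i = v
  · have : own i ≠ u := by rw [hv]; exact huv.symm
    simpa [wsum_eq_zero h₂ _ hi this] using a
  · simpa [wsum_eq_zero h₁ _ hi hv] using b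

/-- Vertices of different parts have labels with different owners, so no edge between the parts is
kept. -/
theorem keep_union {own : ℕ → ℕ} {u v : ℕ} {l₁ l₂ : ℕ → ℕ} (huv : u ≠ v)
    (h₁ : I.Owned own v l₁) (h₂ : I.Owned own u l₂) :
    I.keep (I.union l₁ l₂) = I.keep l₁ + I.keep l₂ := by
  unfold keep
  rw [← sum_add_distrib]
  refine sum_congr rfl fun x hx => ?_
  rw [← sum_add_distrib]
  refine sum_congr rfl fun y hy => ?_
  unfold Kept union
  rcases Owned.cases huv h₁ h₂ (mem_range.1 hx) with h | h | h <;>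
  rcases Owned.cases huv h₁ h₂ (mem_range.1 hy) with h' | h' | h' <;> grind

/-- Common extension of two labelings that merges the clusters of `v` and `u`. -/
def join (I : Inst) (v u : ℕ) (l₁ l₂ : ℕ → ℕ) : ℕ → ℕ := merge (I.union l₁ l₂) (l₁ v) (l₂ u)

/-- By `OwnedEdges`, only an edge between the owners `u` and `v` can run between the parts. The gain
is thus independent of the labelings, and comparisons of `miss` survive the fusion. -/
theorem keep_join {own : ℕ → ℕ} {u v : ℕ} {l₁ l₂ : ℕ → ℕ} (huv : u ≠ v) (hu : u < I.n)
    (hv : v < I.n) (hou : own u = u) (hov : own v = v) (he : I.OwnedEdges own)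
    (h₁ : I.Owned own v l₁) (h₂ : I.Owned own u l₂) :
    I.keep (I.join v u l₁ l₂) = I.keep (I.union l₁ l₂) + ∑ x ∈ range I.n, ∑ y ∈ range I.n,
      if (x = u ∧ y = v ∨ x = v ∧ y = u) ∧ I.adj x y ≠ 0 then 1 else 0 := by
  unfold keep
  rw [← sum_add_distrib]
  refine sum_congr rfl fun x hx => ?_
  rw [← sum_add_distrib]
  refine sum_congr rfl fun y hy => ?_
  have e := he x (mem_range.1 hx) y (mem_range.1 hy)
  have a := (h₁ v hv).1 hov
  have b := (h₂ u hu).1 hou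
  unfold join merge Kept union
  rcases Owned.cases huv h₁ h₂ (mem_range.1 hx) with h | h | h <;>
  rcases Owned.cases huv h₁ h₂ (mem_range.1 hy) with h' | h' | h' <;> grind

/-- Principle of optimality for parts that stay separate: the keys of the parts determine the key of
the union, and kept edges add up. -/
theorem sim_union (hw : I.TwoWeights) {own : ℕ → ℕ} {u v : ℕ} {l₁ l₂ m₁ m₂ : ℕ → ℕ} (huv : u ≠ v)
    (hv : v < I.n) (hov : own v = v)
    (h₁ : I.Owned own v l₁) (h₂ : I.Owned own u l₂)
    (k₁ : I.Owned own v m₁) (k₂ : I.Owned own u m₂)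
    (s₁ : I.Sim v l₁ m₁) (s₂ : I.Sim u l₂ m₂) :
    I.Sim v (I.union l₁ l₂) (I.union m₁ m₂) := by
  refine ⟨cap_union huv h₁ h₂ s₁.1 s₂.1, cap_union huv k₁ k₂ s₁.2 s₂.2, ?_, ?_⟩
  · obtain ⟨a, b⟩ := rkey_inj hw s₁.1 s₁.2 s₁.3
    obtain ⟨c, -⟩ := rkey_inj hw s₂.1 s₂.2 s₂.3
    have e1 := key_union huv h₁ h₂
    have e2 := key_union huv k₁ k₂
    have hl := (h₁ v hv).1 hov
    have hm := (k₁ v hv).1 hov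
    have hl' : I.union l₁ l₂ v = l₁ v := if_pos hl.1
    have hm' : I.union m₁ m₂ v = m₁ v := if_pos hm.1
    have t1 : I.tau (I.union l₁ l₂) (l₁ v) = I.tau l₁ (l₁ v) := by
      rw [tau, wsum_union huv h₁ h₂ _ hl.1,
        wsum_eq_zero h₂ _ hl.1 (by rw [hl.2]; exact huv.symm)]; rfl
    have t2 : I.tau (I.union m₁ m₂) (m₁ v) = I.tau m₁ (m₁ v) := by
      rw [tau, wsum_union huv k₁ k₂ _ hm.1,
        wsum_eq_zero k₂ _ hm.1 (by rw [hm.2]; exact huv.symm)]; rfl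
    rw [rkey, rkey, hl', hm', t1, t2, b]
    omega
  · have a := keep_add_miss (I := I) (I.union l₁ l₂)
    have b := keep_add_miss (I := I) (I.union m₁ m₂)
    have := keep_add_miss (I := I) l₁
    have := keep_add_miss (I := I) l₂
    have := keep_add_miss (I := I) m₁
    have := keep_add_miss (I := I) m₂
    have := s₁.miss_le
    have := s₂.miss_le
    rw [keep_union huv h₁ h₂] at a
    rw [keep_union huv k₁ k₂] at b
    omega

/-- Principle of optimality for fused root clusters. The key after the fusion also depends on the
weights of the two root clusters, which is why tables are indexed by `rkey` rather than `key`. -/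
theorem sim_join (hw : I.TwoWeights) {own : ℕ → ℕ} {u v : ℕ} {l₁ l₂ m₁ m₂ : ℕ → ℕ} (huv : u ≠ v)
    (hu : u < I.n) (hv : v < I.n) (hou : own u = u) (hov : own v = v) (he : I.OwnedEdges own)
    (h₁ : I.Owned own v l₁) (h₂ : I.Owned own u l₂)
    (k₁ : I.Owned own v m₁) (k₂ : I.Owned own u m₂)
    (s₁ : I.Sim v l₁ m₁) (s₂ : I.Sim u l₂ m₂) (hc : I.Cap (I.join v u m₁ m₂)) :
    I.Sim v (I.join v u l₁ l₂) (I.join v u m₁ m₂) := by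
  have hU := sim_union hw huv hv hov h₁ h₂ k₁ k₂ s₁ s₂
  have hl := (h₁ v hv).1 hov
  have hm := (k₁ v hv).1 hov
  have hl2 := (h₂ u hu).1 hou
  have hm2 := (k₂ u hu).1 hou
  have nl : l₁ v ≠ l₂ u := fun e => huv (by rw [← hl.2, e, hl2.2])
  have nm : m₁ v ≠ m₂ u := fun e => huv (by rw [← hm.2, e, hm2.2])
  obtain ⟨a, b⟩ := rkey_inj hw hU.1 hU.2 hU.3
  obtain ⟨-, c⟩ := rkey_inj hw s₂.1 s₂.2 s₂.3
  have hl' : I.union l₁ l₂ v = l₁ v := if_pos hl.1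
  have hm' : I.union m₁ m₂ v = m₁ v := if_pos hm.1
  have t1 : I.tau (I.union l₁ l₂) (l₂ u) = I.tau l₂ (l₂ u) := by
    rw [tau, wsum_union huv h₁ h₂ _ hl2.1, wsum_eq_zero h₁ _ hl2.1 (by rw [hl2.2]; exact huv),
      zero_add]; rfl
  have t2 : I.tau (I.union m₁ m₂) (m₂ u) = I.tau m₂ (m₂ u) := by
    rw [tau, wsum_union huv k₁ k₂ _ hm2.1, wsum_eq_zero k₁ _ hm2.1 (by rw [hm2.2]; exact huv),
      zero_add]; rfl
  rw [hl', hm'] at b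
  have c' : I.tau (I.union l₁ l₂) (l₂ u) = I.tau (I.union m₁ m₂) (m₂ u) := by rw [t1, t2, c]
  refine ⟨cap_merge_of_cap hw hl.1 hm.1 nl nm hl2.1 hm2.1 hU.1 hU.2 b c' hc, hc, ?_, ?_⟩
  · have e1 := key_merge (l := I.union l₁ l₂) hl.1 hl2.1 nl
    have e2 := key_merge (l := I.union m₁ m₂) hm.1 hm2.1 nm
    rw [b, c', a] at e1
    have r1 : I.join v u l₁ l₂ v = l₁ v := by
      unfold join merge; rw [hl', if_neg nl]
    have r2 : I.join v u m₁ m₂ v = m₁ v := by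
      unfold join merge; rw [hm', if_neg nm]
    have q1 : I.tau (I.join v u l₁ l₂) (l₁ v) = I.tau (I.join v u m₁ m₂) (m₁ v) := by
      unfold join tau
      rw [wsum_merge nl, wsum_merge nm, if_pos rfl, if_pos rfl]
      unfold tau at b c'
      rw [b, c']
    rw [rkey, rkey, r1, r2, q1]
    unfold join
    omega
  · have a := keep_add_miss (I := I) (I.union l₁ l₂)
    have b := keep_add_miss (I := I) (I.union m₁ m₂)
    have c := keep_add_miss (I := I) (I.join v u l₁ l₂)
    have d := keep_add_miss (I := I) (I.join v u m₁ m₂)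
    rw [keep_join huv hu hv hou hov he h₁ h₂] at c
    rw [keep_join huv hu hv hou hov he k₁ k₂] at d
    have := hU.miss_le
    omega

/-- Any merging of two labels can be mirrored in a labeling with the same key. -/
theorem exists_sim_merge (hw : I.TwoWeights) {l m : ℕ → ℕ} (hl : I.Cap l) (hm : I.Cap m)
    (hk : I.key l = I.key m) (hmiss : I.miss l ≤ I.miss m) {i j : ℕ} (hi : i < I.n)
    (hj : j < I.n) (hij : i ≠ j) (hc : I.Cap (merge m i j))
    (he : I.miss (merge m i j) = I.miss m) :
    ∃ i' < I.n, ∃ j' < I.n, I.Cap (merge l i' j') ∧ I.key (merge l i' j') = I.key (merge m i j) ∧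
      I.miss (merge l i' j') ≤ I.miss (merge m i j) := by
  -- Only the weights of the merged labels matter, so any two distinct labels of `l` with these
  -- weights will do.
  obtain ⟨i', hi', j', hj', hne, h1, h2⟩ := exists_labels_of_key hw hm hl hk.symm hi hj hij
  refine ⟨i', hi', j', hj', cap_merge_of_cap hw hi' hi hne hij hj' hj hl hm h1 h2 hc, ?_,
    (miss_merge_le hi' j').trans (hmiss.trans he.ge)⟩
  have e1 := key_merge (l := l) hi' hj' hne
  have e2 := key_merge (l := m) hi hj hij
  rw [h1, h2, hk] at e1
  omega

end Inst

namespace RAM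

/-! ### Frame conditions -/

/-- The program contains an assignment to the variable `r`. -/
def Cmd.setsVar (r : ℕ) : Cmd → Bool
  | .skip => false
  | .assign r' _ => r' == r
  | .write _ _ _ => false
  | .seq p₁ p₂ => p₁.setsVar r || p₂.setsVar r
  | .cond _ p₁ p₂ => p₁.setsVar r || p₂.setsVar r
  | .iter i _ p => i == r || p.setsVar r

/-- The program contains an assignment to the array `k`. -/
def Cmd.setsArr (k : Fin 8) : Cmd → Bool
  | .skip => false
  | .assign _ _ => false
  | .write k' _ _ => k' == k
  | .seq p₁ p₂ => p₁.setsArr k || p₂.setsArr k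
  | .cond _ p₁ p₂ => p₁.setsArr k || p₂.setsArr k
  | .iter _ _ p => p.setsArr k

theorem setVar_var (s : Env) (r x r' : ℕ) :
    (s.setVar r x).var r' = if r' = r then x else s.var r' := by
  simp [Env.setVar, Function.update_apply]

theorem setArr_arr (s : Env) (k : Fin 8) (a x : ℕ) (k' : Fin 8) :
    (s.setArr k a x).arr k' = if k' = k then Function.update (s.arr k) a x else s.arr k' := by
  simp only [Env.setArr, Function.update_apply]

theorem run_var {r : ℕ} (p : Cmd) (h : p.setsVar r = false) :
    ∀ s, (p.run s).var r = s.var r := by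
  induction p with
  | skip => simp [Cmd.run]
  | assign r' e =>
    intro s
    simp only [Cmd.setsVar, beq_eq_false_iff_ne] at h
    simp [Cmd.run, setVar_var, h.symm]
  | write k a e => simp [Cmd.run]
  | seq p₁ p₂ ih₁ ih₂ =>
    simp only [Cmd.setsVar, Bool.or_eq_false_iff] at h
    simp [Cmd.run, ih₁ h.1, ih₂ h.2]
  | cond e p₁ p₂ ih₁ ih₂ =>
    simp only [Cmd.setsVar, Bool.or_eq_false_iff] at h
    intro s; simp only [Cmd.run]; split_ifs <;> simp [ih₁ h.1, ih₂ h.2]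
  | iter i c p ih =>
    simp only [Cmd.setsVar, Bool.or_eq_false_iff, beq_eq_false_iff_ne] at h
    intro s
    exact iterFor_inv (fun _ (s' : Env) => s'.var r = s.var r) rfl
      fun k s' _ h' => by rw [ih h.2, setVar_var, if_neg h.1.symm, h']

theorem run_arr {k : Fin 8} (p : Cmd) (h : p.setsArr k = false) :
    ∀ s, (p.run s).arr k = s.arr k := by
  induction p with
  | skip => simp [Cmd.run]
  | assign r' e => simp [Cmd.run]
  | write k' a e =>
    simp only [Cmd.setsArr, beq_eq_false_iff_ne] at h
    simp [Cmd.run, setArr_arr, h.symm]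
  | seq p₁ p₂ ih₁ ih₂ =>
    simp only [Cmd.setsArr, Bool.or_eq_false_iff] at h
    simp [Cmd.run, ih₁ h.1, ih₂ h.2]
  | cond e p₁ p₂ ih₁ ih₂ =>
    simp only [Cmd.setsArr, Bool.or_eq_false_iff] at h
    intro s; simp only [Cmd.run]; split_ifs <;> simp [ih₁ h.1, ih₂ h.2]
  | iter i c p ih =>
    simp only [Cmd.setsArr] at h
    intro s
    exact iterFor_inv (fun _ (s' : Env) => s'.arr k = s.arr k) rfl
      fun _ s' _ h' => by rw [ih h, setVar_arr, h']

/-- Property `Z` is established in one round of a loop and kept by all rounds. -/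
theorem iterFor_hit {α : Type*} (I Z : α → Prop) {f : ℕ → α → α} {N i : ℕ} {s : α} (h0 : I s)
    (hI : ∀ k s, k < N → I s → I (f k s)) (hi : i < N) (hit : ∀ s, I s → Z (f i s))
    (hZ : ∀ k s, k < N → I s → Z s → Z (f k s)) : I (iterFor f N s) ∧ Z (iterFor f N s) := by
  have := iterFor_inv (fun k s => I s ∧ (i < k → Z s)) (f := f) (N := N) (s := s) ⟨h0, by omega⟩
    (by
      rintro k s hk ⟨a, b⟩
      refine ⟨hI k s hk a, fun h => ?_⟩
      rcases Nat.lt_succ_iff_lt_or_eq.1 h with h | rfl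
      · exact hZ k s hk a (b h)
      · exact hit s a)
  exact ⟨this.1, this.2 hi⟩

/-! ### The building blocks of the algorithm

Constants: `0` number of vertices `n`, `6` size bound `E`, `7` `n + 1`, `8` `E²`, `9` `n - 1`,
`10` `(n + 1) ^ E²`, `11` table size.
Arrays: `0` current labeling, `1` values and `2` labelings of table entries, `3` position of the
table of a vertex, `4` marks of eliminated vertices, `5` powers of `n + 1`, `6` auxiliary labeling.
Variables: `6` root of the current labeling, `7` position of the current table, `8` and `9`
position and value of a new entry. -/

/-- Case distinction on equality. -/
def Ex.eqE (a b t f : Ex) : Ex := .ite (.add (.sub a b) (.sub b a)) f t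

@[simp] theorem eval_eqE (a b t f : Ex) (s : Env) :
    (Ex.eqE a b t f).eval s = if a.eval s = b.eval s then t.eval s else f.eval s := by
  simp only [Ex.eqE, Ex.eval]
  by_cases h : a.eval s = b.eval s
  · simp [h]
  · have h' : a.eval s - b.eval s + (b.eval s - a.eval s) ≠ 0 := by omega
    simp only [ne_eq, h', not_false_eq_true, if_true, h, if_false]

/-- The product with the number of vertices. -/
def Ex.mulN (e : Ex) : Ex := .sum 4 0 e

/-- The entry of the adjacency matrix. -/
def adjE (u v : ℕ) : Ex := .inp (.add (.add (.con 0) (.mulN (.var u))) (.var v))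

/-- The number of vertices with the label in variable `1`. -/
def szE : Ex := .sum 0 0 (.eqE (.arr 0 (.var 0)) (.var 1) (.lit 1) (.lit 0))

/-- The weight of a label. -/
def tauE (e : Ex) : Ex :=
  .sum 0 0 (.eqE (.arr 0 (.var 0)) e (.ite (.inp (.var 0)) (.lit 1) (.con 6)) (.lit 0))

/-- The number of labels that are used too often. -/
def capE : Ex := .sum 1 0 (.ite (.sub (.con 6) szE) (.lit 0) (.lit 1))

/-- The key of the current labeling. -/
def keyE : Ex := .add (.sum 1 0 (.arr 5 (tauE (.var 1))))
  (.sum 4 8 (.ite (.sub (tauE (.arr 0 (.var 6))) (.var 4)) (.con 10) (.lit 0)))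

/-- The number of ordered pairs that are not edges inside clusters. -/
def missE : Ex := .sum 2 0 (.sum 3 0 (.ite (adjE 2 3)
  (.eqE (.arr 0 (.var 2)) (.arr 0 (.var 3))
    (.ite (.sub (.con 0) (.arr 0 (.var 2))) (.lit 0) (.lit 1)) (.lit 1)) (.lit 1)))

/-- The instance that is described by the input. -/
def Env.inst (s : Env) : Inst where
  n := s.con 0
  E := s.con 6
  wt x := if s.inp x ≠ 0 then 1 else s.con 6
  adj u v := s.inp (s.con 0 + s.con 0 * u + v)

theorem twoWeights_inst (s : Env) : s.inst.TwoWeights := fun x _ => by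
  by_cases h : s.inp x = 0 <;> simp [Env.inst, h]

@[simp] theorem inst_setVar (s : Env) (r x : ℕ) : (s.setVar r x).inst = s.inst := rfl

theorem inst_eq {s s' : Env} (h1 : s'.con = s.con) (h2 : s'.inp = s.inp) : s'.inst = s.inst := by
  simp only [Env.inst, h1, h2]

@[simp] theorem inst_run (p : Cmd) (s : Env) : (p.run s).inst = s.inst :=
  inst_eq (run_con p s).1 (run_con p s).2

theorem eval_szE (s : Env) : szE.eval s = s.inst.sz (s.arr 0) (s.var 1) := by
  simp [szE, Ex.eval, Inst.sz, Inst.wsum, setVar_var, Env.inst]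

theorem eval_tauE (s : Env) (e : Ex) (h : ∀ k, e.eval (s.setVar 0 k) = e.eval s) :
    (tauE e).eval s = s.inst.tau (s.arr 0) (e.eval s) := by
  simp [tauE, Ex.eval, Inst.tau, Inst.wsum, setVar_var, Env.inst, h]

theorem eval_capE (s : Env) : capE.eval s = 0 ↔ s.inst.Cap (s.arr 0) := by
  simp only [capE, Ex.eval, sum_eq_zero_iff, mem_range, eval_szE, Inst.Cap]
  refine forall₂_congr fun i _ => ?_
  simp only [setVar_con, setVar_arr, inst_setVar, setVar_var, if_true]
  have : s.inst.E = s.con 6 := rfl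
  rw [this]
  by_cases h : s.inst.sz (s.arr 0) i < s.con 6
  · have h' : s.con 6 - s.inst.sz (s.arr 0) i ≠ 0 := by omega
    simp only [ne_eq, h', not_false_eq_true, if_true, h]
  · have h' : s.con 6 - s.inst.sz (s.arr 0) i = 0 := by omega
    simp [h', h]

/-- Variable 4 is the summation index inside `mulN`, so a row index stored there would be
overwritten; the second alternative covers this case. -/
theorem eval_adjE (s : Env) (u v : ℕ) :
    (adjE u v).eval s = s.inst.adj (if u = 4 then 0 else s.var u) (s.var v) ∨ u = 4 := by
  by_cases h : u = 4
  · exact Or.inr h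
  · left
    simp [adjE, Ex.mulN, Ex.eval, Env.inst, setVar_var, h]

theorem eval_missE (s : Env) : missE.eval s = s.inst.miss (s.arr 0) := by
  simp only [missE, Ex.eval, Inst.miss]
  refine sum_congr rfl fun u _ => sum_congr rfl fun v _ => ?_
  rcases eval_adjE ((s.setVar 2 u).setVar 3 v) 2 3 with h | h
  · rw [h]
    simp only [Inst.Kept, eval_eqE, Ex.eval, setVar_var, setVar_con, setVar_arr, inst_setVar]
    have : s.inst.n = s.con 0 := rfl
    simp only [this, ne_eq, Nat.sub_eq_zero_iff_le, not_le]
    norm_num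
    grind
  · omega

/-- The constants and the table of powers have their intended values. -/
structure Env.Ok (s : Env) : Prop where
  pos : 0 < s.con 0
  c7 : s.con 7 = s.con 0 + 1
  c8 : s.con 8 = s.con 6 * s.con 6
  c9 : s.con 9 = s.con 0 - 1
  c10 : s.con 10 = (s.con 0 + 1) ^ (s.con 6 * s.con 6)
  c11 : s.con 11 = (s.con 0 + 1) ^ (s.con 6 * s.con 6) * (s.con 6 * s.con 6)
  pow : ∀ t < s.con 6 * s.con 6, s.arr 5 t = (s.con 0 + 1) ^ t

theorem Env.Ok.of_eq {s s' : Env} (h : s.Ok) (h1 : s'.con = s.con) (h2 : s'.arr 5 = s.arr 5) :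
    s'.Ok := by
  constructor <;> simp only [h1, h2]
  exacts [h.1, h.2, h.3, h.4, h.5, h.6, h.7]

theorem Env.Ok.run {s : Env} (h : s.Ok) (p : Cmd) (hp : p.setsArr 5 = false) : (p.run s).Ok :=
  h.of_eq (run_con p s).1 (run_arr p hp s)

theorem Env.Ok.setVar {s : Env} (h : s.Ok) (r x : ℕ) : (s.setVar r x).Ok :=
  h.of_eq rfl rfl

/-- Multiplication by counting, as the machine cannot multiply: exactly `t` of the summands are
nonzero. -/
theorem sum_lt_mul {M t N : ℕ} (h : t ≤ M) :
    ∑ z ∈ range M, (if t - z ≠ 0 then N else 0) = N * t := by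
  rw [← sum_filter, sum_const, smul_eq_mul, mul_comm]
  congr 1
  have : filter (fun z => t - z ≠ 0) (range M) = range t := by
    ext z; simp only [mem_filter, mem_range]; omega
  rw [this, card_range]

/-- The cap is needed because the table of powers is only known to be correct for exponents below
E². -/
theorem eval_keyE {s : Env} (h : s.Ok) (hc : s.inst.Cap (s.arr 0))
    (ht : s.inst.tau (s.arr 0) (s.arr 0 (s.var 6)) < s.con 6 * s.con 6) :
    keyE.eval s = s.inst.rkey (s.var 6) (s.arr 0) := by
  simp only [keyE, Ex.eval, Inst.rkey, Inst.key]
  congr 1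
  · refine sum_congr rfl fun i hi => ?_
    rw [eval_tauE]
    · simp only [Ex.eval, setVar_arr, setVar_var, if_true, inst_setVar]
      exact h.pow _ (Inst.tau_lt (twoWeights_inst s) (hc i (mem_range.1 hi)))
    · intro k; simp [Ex.eval, setVar_var]
  · have : ∀ k, (tauE (.arr 0 (.var 6))).eval (s.setVar 4 k) =
        s.inst.tau (s.arr 0) (s.arr 0 (s.var 6)) := by
      intro k
      rw [eval_tauE]
      · simp [Ex.eval, setVar_var]
      · intro k; simp [Ex.eval, setVar_var]
    simp only [this, setVar_var, if_true, setVar_con]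
    rw [h.c8, sum_lt_mul ht.le, h.c10]
    rfl

/-- Store the current labeling as the entry at variable `8` with the value in variable `9`. -/
def store : Cmd := .seq (.write 1 (.var 8) (.var 9))
  (.iter 5 0 (.write 2 (.add (.mulN (.var 8)) (.var 5)) (.arr 0 (.var 5))))

/-- Store the current labeling unless there is an entry with at most the same value. -/
def relax : Cmd := .cond
  (.ite (.arr 1 (.var 8)) (.sub (.arr 1 (.var 8)) (.var 9)) (.lit 1)) store .skip

/-- Enter the current labeling into the current table. -/
def insertCmd : Cmd := .cond capE .skip
  (.seq (.assign 8 (.add (.var 7) keyE)) (.seq (.assign 9 (.add missE (.lit 1))) relax))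

/-- The labeling that is stored at `a`. -/
def Env.lab (s : Env) (a x : ℕ) : ℕ := if x < s.con 0 then s.arr 2 (s.con 0 * a + x) else s.con 0

theorem lab_congr {s s' : Env} (h1 : s'.con = s.con) (h2 : s'.arr 2 = s.arr 2) (a : ℕ) :
    s'.lab a = s.lab a := by
  funext x; simp only [Env.lab, h1, h2]

theorem run_store (s : Env) :
    (store.run s).arr 1 = Function.update (s.arr 1) (s.var 8) (s.var 9) ∧
    (∀ a, a ≠ s.var 8 → (store.run s).lab a = s.lab a) ∧
    ∀ x < s.con 0, (store.run s).lab (s.var 8) x = s.arr 0 x := by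
  have hf : ∀ (k x : ℕ) (s' : Env), s'.con = s.con → s'.var 8 = s.var 8 →
      (Ex.add (.mulN (.var 8)) (.var 5)).eval (s'.setVar 5 k) = s.con 0 * s.var 8 + k := by
    intro k x s' h1 h2
    simp [Ex.eval, Ex.mulN, setVar_var, h1, h2]
  have key := iterFor_inv (N := s.con 0) (fun k (s' : Env) => s'.con = s.con ∧ s'.var 8 = s.var 8 ∧
      s'.arr 0 = s.arr 0 ∧ s'.arr 1 = Function.update (s.arr 1) (s.var 8) (s.var 9) ∧
      (∀ x < k, s'.arr 2 (s.con 0 * s.var 8 + x) = s.arr 0 x) ∧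
      (∀ b, (∀ x < s.con 0, b ≠ s.con 0 * s.var 8 + x) → s'.arr 2 b = s.arr 2 b))
    (f := fun k s => (Cmd.write 2 (.add (.mulN (.var 8)) (.var 5)) (.arr 0 (.var 5))).run
      (s.setVar 5 k)) (s := s.setArr 1 (s.var 8) (s.var 9))
    (by simp [setArr_arr])
    (by
      rintro k s' hk ⟨h1, h2, h3, h4, h5, h6⟩
      simp only [Cmd.run, hf k 0 s' h1 h2]
      refine ⟨h1, by simpa [setVar_var] using h2, by simpa [setArr_arr] using h3,
        by simpa [setArr_arr] using h4, fun x hx => ?_, fun b hb => ?_⟩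
      · by_cases hxk : x = k
        · subst hxk; simp [setArr_arr, Ex.eval, setVar_var, h3]
        · have := h5 x (by omega)
          simp [setArr_arr, hxk, this]
      · have := hb k hk
        simp [setArr_arr, this, h6 b hb])
  have hrun : store.run s = iterFor (fun k s =>
      (Cmd.write 2 (.add (.mulN (.var 8)) (.var 5)) (.arr 0 (.var 5))).run (s.setVar 5 k))
      (s.con 0) (s.setArr 1 (s.var 8) (s.var 9)) := rfl
  rw [hrun]
  obtain ⟨h1, -, -, h4, h5, h6⟩ := key
  refine ⟨h4, fun a ha => funext fun x => ?_, fun x hx => ?_⟩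
  · simp only [Env.lab, h1]
    split_ifs with hx
    · apply h6
      intro y hy e
      -- Since the offset is less than n, dividing the position by n recovers the index of the
      -- entry.
      apply ha
      have e1 : (s.con 0 * a + x) / s.con 0 = a := by
        rw [Nat.mul_add_div (by omega), Nat.div_eq_of_lt hx, add_zero]
      have e2 : (s.con 0 * s.var 8 + y) / s.con 0 = s.var 8 := by
        rw [Nat.mul_add_div (by omega), Nat.div_eq_of_lt hy, add_zero]
      rw [← e1, e, e2]
    · rfl
  · simp only [Env.lab, h1, if_pos hx]
    exact h5 x hx

/-- The table at `base` holds labelings with property `G` at the positions given by their keys, with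
the numbers of pairs they miss as values. -/
def Env.Sound (s : Env) (G : (ℕ → ℕ) → Prop) (r base : ℕ) : Prop :=
  ∀ k < s.con 11, s.arr 1 (base + k) ≠ 0 → s.arr 1 (base + k) = s.inst.miss (s.lab (base + k)) + 1 ∧
    s.inst.Cap (s.lab (base + k)) ∧ s.inst.rkey r (s.lab (base + k)) = k ∧ G (s.lab (base + k))

/-- There is an entry at `a` that misses at most `m` pairs. -/
def Env.Cont (s : Env) (a m : ℕ) : Prop := s.arr 1 a ≠ 0 ∧ s.arr 1 a ≤ m + 1

/-- The tables are changed at most at positions from `base` to `base + N`, where entries with a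
smaller value may replace others. -/
structure Upd (base N : ℕ) (s s' : Env) : Prop where
  con : s'.con = s.con
  inp : s'.inp = s.inp
  val : ∀ a, a < base ∨ base + N ≤ a → s'.arr 1 a = s.arr 1 a
  lab : ∀ a, a < base ∨ base + N ≤ a → s'.lab a = s.lab a
  cont : ∀ a m, s.Cont a m → s'.Cont a m

theorem Upd.of_eq {base N : ℕ} {s s' : Env} (h1 : s'.con = s.con) (h2 : s'.inp = s.inp)
    (h3 : s'.arr 1 = s.arr 1) (h4 : s'.arr 2 = s.arr 2) : Upd base N s s' :=
  ⟨h1, h2, fun a _ => by rw [h3], fun a _ => lab_congr h1 h4 a, fun a m => by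
    simp only [Env.Cont, h3]; exact id⟩

theorem Upd.refl (base N : ℕ) (s : Env) : Upd base N s s := .of_eq rfl rfl rfl rfl

theorem Upd.trans {base N : ℕ} {s s' s'' : Env} (h : Upd base N s s') (h' : Upd base N s' s'') :
    Upd base N s s'' :=
  ⟨h'.con.trans h.con, h'.inp.trans h.inp, fun a ha => (h'.val a ha).trans (h.val a ha),
    fun a ha => (h'.lab a ha).trans (h.lab a ha), fun a m hc => h'.cont a m (h.cont a m hc)⟩

theorem Env.Sound.of_eq {s s' : Env} {G : (ℕ → ℕ) → Prop} {r base : ℕ} (h : s.Sound G r base)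
    (h1 : s'.con = s.con) (h2 : s'.inp = s.inp) (h3 : s'.arr 1 = s.arr 1)
    (h4 : s'.arr 2 = s.arr 2) : s'.Sound G r base := by
  intro k
  rw [inst_eq h1 h2, lab_congr h1 h4, h1, h3]
  exact h k

/-- Tables outside the changed region stay sound. -/
theorem Env.Sound.upd {s s' : Env} {G : (ℕ → ℕ) → Prop} {r base base' N : ℕ}
    (h : s.Sound G r base) (hu : Upd base' N s s')
    (hb : base + s.con 11 ≤ base' ∨ base' + N ≤ base) : s'.Sound G r base := by
  intro k hk
  rw [hu.con] at hk
  rw [inst_eq hu.con hu.inp, hu.val _ (by omega), hu.lab _ (by omega)]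
  exact h k hk

/-- An entry gives way only to one with a smaller value, so `Cont` is never lost, and afterwards the
table is at least as good as the current labeling at its key. Cell n of the labeling contains n, so
that the index n can stand for an absent root. -/
theorem run_insert {s : Env} (hok : s.Ok) (hW : s.arr 0 (s.con 0) = s.con 0)
    (hr : s.var 6 ≤ s.con 0) {G : (ℕ → ℕ) → Prop}
    (hGc : ∀ l l' : ℕ → ℕ, (∀ x < s.con 0, l x = l' x) → G l → G l') (hG : G (s.arr 0))
    (ht : s.inst.Cap (s.arr 0) →
      s.inst.tau (s.arr 0) (s.arr 0 (s.var 6)) < s.con 6 * s.con 6)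
    (hs : s.Sound G (s.var 6) (s.var 7)) :
    Upd (s.var 7) (s.con 11) s (insertCmd.run s) ∧
    (insertCmd.run s).Sound G (s.var 6) (s.var 7) ∧
    (s.inst.Cap (s.arr 0) → (insertCmd.run s).Cont (s.var 7 + s.inst.rkey (s.var 6) (s.arr 0))
      (s.inst.miss (s.arr 0))) := by
  have hcon := (run_con insertCmd s)
  by_cases hc : s.inst.Cap (s.arr 0)
  swap
  · have : insertCmd.run s = s := by
      simp only [insertCmd, Cmd.run]
      rw [if_pos (by rw [Ne, eval_capE]; exact hc)]
    rw [this]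
    exact ⟨.refl _ _ _, hs, fun h => absurd h hc⟩
  set k₀ := s.inst.rkey (s.var 6) (s.arr 0) with hk₀
  have hk₀lt : k₀ < s.con 11 := by
    rw [hok.c11]
    exact Inst.rkey_lt (twoWeights_inst s) hc (ht hc)
  set s₁ := (s.setVar 8 (s.var 7 + k₀)).setVar 9 (s.inst.miss (s.arr 0) + 1) with hs₁
  have hrun : insertCmd.run s = relax.run s₁ := by
    simp only [insertCmd, Cmd.run]
    rw [if_neg (by rw [Ne, not_not, eval_capE]; exact hc)]
    simp only [Ex.eval, eval_missE, eval_keyE hok hc (ht hc), setVar_arr, inst_setVar]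
    rfl
  have v8 : s₁.var 8 = s.var 7 + k₀ := by simp [hs₁, setVar_var]
  have v9 : s₁.var 9 = s.inst.miss (s.arr 0) + 1 := by simp [hs₁, setVar_var]
  rw [hrun] at hcon ⊢
  have hlab1 : ∀ a, s₁.lab a = s.lab a := lab_congr rfl rfl
  have harr : s₁.arr = s.arr := rfl
  simp only [relax, Cmd.run] at hcon ⊢
  split_ifs at hcon ⊢ with hcond
  · obtain ⟨h1, h2, h3⟩ := run_store s₁
    rw [v8] at h2 h3
    rw [v8, v9, harr] at h1
    have hval : s.arr 1 (s.var 7 + k₀) = 0 ∨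
        s.inst.miss (s.arr 0) + 1 < s.arr 1 (s.var 7 + k₀) := by
      simp only [Ex.eval, v8, v9, harr] at hcond
      split_ifs at hcond with h0 <;> omega
    have hcont : (store.run s₁).Cont (s.var 7 + k₀) (s.inst.miss (s.arr 0)) := by
      simp [Env.Cont, h1]
    refine ⟨⟨hcon.1, hcon.2, fun a ha => ?_, fun a ha => ?_, fun a m hm => ?_⟩,
      fun k hk h0 => ?_, fun _ => hcont⟩
    · rw [h1, Function.update_of_ne (by omega)]
    · rw [h2 a (by omega), hlab1]
    · by_cases ha : a = s.var 7 + k₀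
      · subst ha
        refine ⟨hcont.1, hcont.2.trans ?_⟩
        have := hm.1; have := hm.2; omega
      · simpa [Env.Cont, h1, Function.update_of_ne ha] using hm
    · rw [hcon.1] at hk
      rw [inst_eq hcon.1 hcon.2]
      by_cases hkk : k = k₀
      · subst hkk
        have e : ∀ x < s.con 0, (store.run s₁).lab (s.var 7 + k₀) x = s.arr 0 x := h3
        have er : (store.run s₁).lab (s.var 7 + k₀) (s.var 6) = s.arr 0 (s.var 6) := by
          -- The root is a vertex or the index n; in the latter case both labelings have the value n
          -- there.
          rcases Nat.lt_or_ge (s.var 6) (s.con 0) with h | h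
          · exact e _ h
          · have : s.var 6 = s.con 0 := by omega
            rw [this, hW, Env.lab, hcon.1]
            simp
        refine ⟨?_, (Inst.cap_congr e).2 hc, Inst.rkey_congr e er,
          hGc _ _ (fun x hx => (e x hx).symm) hG⟩
        rw [h1, Function.update_self, Inst.miss_congr (I := s.inst) e]
      · have hne : s.var 7 + k ≠ s.var 7 + k₀ := by omega
        rw [h1, Function.update_of_ne hne] at h0
        rw [h1, Function.update_of_ne hne, h2 _ hne, hlab1]
        exact hs k hk h0
  · have hval : s.arr 1 (s.var 7 + k₀) ≠ 0 ∧
        s.arr 1 (s.var 7 + k₀) ≤ s.inst.miss (s.arr 0) + 1 := by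
      simp only [Ex.eval, v8, v9, harr, ne_eq, not_not] at hcond
      split_ifs at hcond with h0
      omega
    exact ⟨.of_eq rfl rfl rfl rfl, hs.of_eq rfl rfl rfl rfl, fun _ => hval⟩

end RAM

/-! ### Combining the tables of two vertices -/

namespace RAM

/-- Set the current labeling. -/
def fill (e : Ex) : Cmd := .iter 5 0 (.write 0 (.var 5) e)

/-- The expression may read the very labeling that is being overwritten, as long as it reads cells
not yet reached. Hence its value is only required in states where the cells from `k` on are
unchanged. -/
theorem run_fill {s : Env} {e : Ex} (g : ℕ → ℕ)
    (h : ∀ k < s.con 0, ∀ s' : Env, s'.con = s.con → s'.inp = s.inp →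
      (∀ r, r ≠ 5 → s'.var r = s.var r) → (∀ j, j ≠ 0 → s'.arr j = s.arr j) →
      (∀ x, k ≤ x → s'.arr 0 x = s.arr 0 x) → e.eval (s'.setVar 5 k) = g k) :
    (∀ x < s.con 0, ((fill e).run s).arr 0 x = g x) ∧
    ∀ x, s.con 0 ≤ x → ((fill e).run s).arr 0 x = s.arr 0 x := by
  have key := iterFor_inv (N := s.con 0) (fun k (s' : Env) => s'.con = s.con ∧ s'.inp = s.inp ∧
      (∀ r, r ≠ 5 → s'.var r = s.var r) ∧ (∀ j, j ≠ 0 → s'.arr j = s.arr j) ∧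
      (∀ x, k ≤ x → s'.arr 0 x = s.arr 0 x) ∧ ∀ x < k, s'.arr 0 x = g x)
    (f := fun k s => (Cmd.write 0 (.var 5) e).run (s.setVar 5 k)) (s := s)
    (by simp)
    (by
      rintro k s' hk ⟨h1, h2, h3, h4, h5, h6⟩
      have he := h k hk s' h1 h2 h3 h4 h5
      simp only [Cmd.run, he, Ex.eval, setVar_var, if_true]
      refine ⟨h1, h2, fun r hr => ?_, fun j hj => ?_, fun x hx => ?_, fun x hx => ?_⟩
      · simp [setVar_var, hr, h3 r hr]
      · simp [setArr_arr, hj, h4 j hj]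
      · have : x ≠ k := by omega
        simp [setArr_arr, this, h5 x (by omega)]
      · by_cases hxk : x = k
        · simp [setArr_arr, hxk]
        · simp [setArr_arr, hxk, h6 x (by omega)])
  exact ⟨fun x hx => key.2.2.2.2.2 x hx, fun x hx => key.2.2.2.2.1 x hx⟩

/-- Search for a vertex that passes a test. -/
def search (r : ℕ) (e : Ex) : Cmd := .iter 19 0 (.cond e (.assign r (.var 19)) .skip)

/-- The last vertex that passes wins. If none passes, the variable keeps its value, which serves as
a fallback. -/
theorem run_search {s : Env} {r : ℕ} (hr : r ≠ 19) {e : Ex} (P : ℕ → Prop)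
    (h : ∀ k < s.con 0, ∀ s' : Env, s'.con = s.con → s'.inp = s.inp → s'.arr = s.arr →
      (∀ i, i ≠ 19 → i ≠ r → s'.var i = s.var i) → (e.eval (s'.setVar 19 k) ≠ 0 ↔ P k)) :
    ((search r e).run s).arr = s.arr ∧
    (((search r e).run s).var r = s.var r ∧ (∀ k < s.con 0, ¬ P k) ∨
      ((search r e).run s).var r < s.con 0 ∧ P (((search r e).run s).var r)) := by
  have key := iterFor_inv (N := s.con 0) (fun k (s' : Env) => s'.con = s.con ∧ s'.inp = s.inp ∧
      s'.arr = s.arr ∧ (∀ i, i ≠ 19 → i ≠ r → s'.var i = s.var i) ∧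
      (s'.var r = s.var r ∧ (∀ i < k, ¬ P i) ∨ s'.var r < s.con 0 ∧ P (s'.var r)))
    (f := fun k s => (Cmd.cond e (.assign r (.var 19)) .skip).run (s.setVar 19 k)) (s := s)
    (by simp)
    (by
      rintro k s' hk ⟨h1, h2, h3, h4, h5⟩
      have he := h k hk s' h1 h2 h3 h4
      simp only [Cmd.run, Ex.eval]
      by_cases hP : P k
      · rw [if_pos (he.2 hP)]
        refine ⟨h1, h2, h3, fun i hi hir => ?_, Or.inr ?_⟩
        · simp [setVar_var, hi, hir, h4 i hi hir]
        · simp [setVar_var, hk, hP]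
      · rw [if_neg (by rw [he]; exact hP)]
        refine ⟨h1, h2, h3, fun i hi hir => ?_, ?_⟩
        · simp [setVar_var, hi, h4 i hi hir]
        · simp only [setVar_var, hr, if_false]
          rcases h5 with ⟨a, b⟩ | h5
          · refine Or.inl ⟨a, fun i hi => ?_⟩
            rcases Nat.lt_succ_iff_lt_or_eq.1 hi with hi | rfl
            · exact b i hi
            · exact hP
          · exact Or.inr h5)
  exact ⟨key.2.2.1, key.2.2.2.2⟩

/-- A label in the entry at the position given by a variable. -/
def labE (a x : ℕ) : Ex := .arr 2 (.add (.mulN (.var a)) (.var x))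

theorem eval_labE (s : Env) {a x : ℕ} (ha : a ≠ 4) (hx : s.var x < s.con 0) :
    (labE a x).eval s = s.lab (s.var a) (s.var x) := by
  simp [labE, Ex.eval, Ex.mulN, setVar_var, ha, Env.lab, hx]

/-- Combine the entries at variables `16` and `17` in both ways. -/
def pairBody : Cmd :=
  .seq (fill (.ite (.sub (.con 0) (labE 16 5)) (labE 16 5) (labE 17 5))) <|
  .seq insertCmd <|
  .seq (fill (.eqE (.arr 0 (.var 5)) (labE 17 12) (labE 16 13) (.arr 0 (.var 5)))) insertCmd

/-- Combine all entries of two tables. -/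
def pairLoop : Cmd :=
  .iter 14 11 <| .seq (.assign 16 (.add (.arr 3 (.var 13)) (.var 14))) <|
    .cond (.arr 1 (.var 16))
      (.iter 15 11 <| .seq (.assign 17 (.add (.arr 3 (.var 12)) (.var 15))) <|
        .cond (.arr 1 (.var 17)) pairBody .skip)
      .skip

theorem owned_congr {I : Inst} {own : ℕ → ℕ} {v : ℕ} (l l' : ℕ → ℕ)
    (h : ∀ x < I.n, l x = l' x) (hl : I.Owned own v l) : I.Owned own v l' := fun x hx => by
  rw [← h x hx]; exact hl x hx

theorem tau_lt_of_owned {I : Inst} (hw : I.TwoWeights) {own : ℕ → ℕ} {v : ℕ} {l : ℕ → ℕ}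
    (h : I.Owned own v l) (hv : v < I.n) (hov : own v = v) (hc : I.Cap l) :
    I.tau l (l v) < I.E * I.E :=
  Inst.tau_lt hw (hc _ ((h v hv).1 hov).1)

theorem run_insert_owned {s : Env} (hok : s.Ok) (hW : s.arr 0 (s.con 0) = s.con 0) {own : ℕ → ℕ}
    {v : ℕ} (hv : v < s.con 0) (hov : own v = v) (hr : s.var 6 = v) {l : ℕ → ℕ}
    (hl : ∀ x < s.con 0, s.arr 0 x = l x) (hG : s.inst.Owned own v l)
    (hs : s.Sound (s.inst.Owned own v) v (s.var 7)) :
    Upd (s.var 7) (s.con 11) s (insertCmd.run s) ∧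
    (insertCmd.run s).Sound (s.inst.Owned own v) v (s.var 7) ∧
    (s.inst.Cap l → (insertCmd.run s).Cont (s.var 7 + s.inst.rkey v l) (s.inst.miss l)) := by
  subst hr
  have hG' := owned_congr (I := s.inst) l (s.arr 0) (fun x hx => (hl x hx).symm) hG
  have := run_insert hok hW hv.le (G := s.inst.Owned own (s.var 6))
    (fun l l' h => owned_congr (I := s.inst) l l' h) hG'
    (fun hc => tau_lt_of_owned (twoWeights_inst s) hG' hv hov hc) hs
  refine ⟨this.1, this.2.1, fun hc => ?_⟩
  have h3 := this.2.2 ((Inst.cap_congr (I := s.inst) hl).2 hc)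
  rwa [Inst.rkey_congr (I := s.inst) hl (hl _ hv), Inst.miss_congr (I := s.inst) hl] at h3

/-- What stays true while the table at `base` for the vertex `v` is filled. -/
structure Filling (s₀ : Env) (G : (ℕ → ℕ) → Prop) (s : Env) : Prop where
  ok : s.Ok
  mark : s.arr 0 (s.con 0) = s.con 0
  var : ∀ r ∈ [6, 7, 11, 12, 13, 18], s.var r = s₀.var r
  arr : ∀ k ∈ [(3 : Fin 8), 4], s.arr k = s₀.arr k
  upd : Upd (s₀.var 7) (s₀.con 11) s₀ s
  sound : s.Sound G (s₀.var 6) (s₀.var 7)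

theorem Filling.run {s₀ s : Env} {G : (ℕ → ℕ) → Prop} (h : Filling s₀ G s) (p : Cmd)
    (hv : ∀ r ∈ [6, 7, 11, 12, 13, 18], p.setsVar r = false)
    (ha : ∀ k ∈ [(1 : Fin 8), 2, 3, 4, 5], p.setsArr k = false)
    (hm : (p.run s).arr 0 (s.con 0) = s.con 0) : Filling s₀ G (p.run s) := by
  have hc := run_con p s
  have a := fun k hk => run_arr p (ha k hk) s
  exact ⟨h.ok.run p (ha 5 (by simp)), by rw [hc.1]; exact hm,
    fun r hr => (run_var p (hv r hr) s).trans (h.var r hr),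
    fun k hk => (a k (by simp at hk ⊢; tauto)).trans (h.arr k hk),
    h.upd.trans (.of_eq hc.1 hc.2 (a 1 (by simp)) (a 2 (by simp))),
    h.sound.of_eq hc.1 hc.2 (a 1 (by simp)) (a 2 (by simp))⟩

theorem Filling.insert {s₀ s : Env} {own : ℕ → ℕ} {v : ℕ} (h6 : s₀.var 6 = v)
    (h : Filling s₀ (s₀.inst.Owned own v) s) (hv : v < s₀.con 0) (hov : own v = v) {l : ℕ → ℕ}
    (hl : ∀ x < s₀.con 0, s.arr 0 x = l x) (hG : s₀.inst.Owned own v l) :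
    Filling s₀ (s₀.inst.Owned own v) (insertCmd.run s) ∧
    Upd (s₀.var 7) (s₀.con 11) s (insertCmd.run s) ∧
    (s₀.inst.Cap l → (insertCmd.run s).Cont (s₀.var 7 + s₀.inst.rkey v l) (s₀.inst.miss l)) := by
  have hi := inst_eq h.upd.con h.upd.inp
  have hc := h.upd.con
  have e6 := h.var 6 (by simp)
  have e7 := h.var 7 (by simp)
  have hs := h.sound
  rw [← hi] at hG hs
  rw [h6] at hs
  rw [← e7] at hs
  have := run_insert_owned h.ok h.mark (by rwa [hc]) hov (e6.trans h6) (by rwa [hc]) hG hs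
  rw [hi, hc, e7] at this
  obtain ⟨h1, h2, h3⟩ := this
  refine ⟨⟨h.ok.run _ rfl, ?_, fun r hr => ?_, fun k hk => ?_, h.upd.trans h1, ?_⟩, h1, h3⟩
  · rw [h1.con, run_arr insertCmd rfl]; exact h.mark
  · rw [run_var insertCmd, h.var r hr]
    revert r; decide
  · rw [run_arr insertCmd, h.arr k hk]
    revert k; decide
  · rwa [h6]

/-- Both source entries lie below the table that is being filled, so the first insertion leaves them
intact for the second labeling. -/
theorem run_pairBody {s₀ s : Env} {own : ℕ → ℕ} {u v : ℕ} (huv : u ≠ v) (hu : u < s₀.con 0)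
    (hv : v < s₀.con 0) (hou : own u = u) (hov : own v = v)
    (h6 : s₀.var 6 = v) (h12 : s₀.var 12 = u) (h13 : s₀.var 13 = v)
    (hs : Filling s₀ (s₀.inst.Owned (Inst.give own u v) v) s) {l₁ l₂ : ℕ → ℕ}
    (hl₁ : s.lab (s.var 16) = l₁) (hl₂ : s.lab (s.var 17) = l₂)
    (ho₁ : s₀.inst.Owned own v l₁) (ho₂ : s₀.inst.Owned own u l₂)
    (ha₁ : s.var 16 < s₀.var 7) (ha₂ : s.var 17 < s₀.var 7) :
    Filling s₀ (s₀.inst.Owned (Inst.give own u v) v) (pairBody.run s) ∧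
    Upd (s₀.var 7) (s₀.con 11) s (pairBody.run s) ∧
    (s₀.inst.Cap (s₀.inst.union l₁ l₂) → (pairBody.run s).Cont
      (s₀.var 7 + s₀.inst.rkey v (s₀.inst.union l₁ l₂)) (s₀.inst.miss (s₀.inst.union l₁ l₂))) ∧
    (s₀.inst.Cap (s₀.inst.join v u l₁ l₂) → (pairBody.run s).Cont
      (s₀.var 7 + s₀.inst.rkey v (s₀.inst.join v u l₁ l₂))
      (s₀.inst.miss (s₀.inst.join v u l₁ l₂))) := by
  set own' := Inst.give own u v with hown'
  have hov' : own' v = v := by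
    simp only [hown', Inst.give, hov]; split_ifs <;> rfl
  have hU := Inst.owned_union huv ho₁ ho₂
  rw [← hown'] at hU
  have hl1v := (ho₁ v hv).1 hov
  have hl2u := (ho₂ u hu).1 hou
  have hJ : s₀.inst.Owned own' v (s₀.inst.join v u l₁ l₂) := by
    refine Inst.owned_merge hU hl1v.1 ?_ hl2u.1
    simp only [hown', Inst.give, hl1v.2]; split_ifs <;> rfl
  have hc0 := hs.upd.con
  -- the first labeling
  obtain ⟨s₁, hs₁⟩ : ∃ s₁, s₁ = (fill (.ite (.sub (.con 0) (labE 16 5)) (labE 16 5)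
    (labE 17 5))).run s := ⟨_, rfl⟩
  have hf := run_fill (s := s) (e := .ite (.sub (.con 0) (labE 16 5)) (labE 16 5)
    (labE 17 5)) (s₀.inst.union l₁ l₂) (by
      intro k hk s' h1 h2 h3 h4 _
      have e1 := eval_labE (s'.setVar 5 k) (a := 16) (x := 5) (by norm_num)
        (by simpa [setVar_var, h1] using hk)
      have e2 := eval_labE (s'.setVar 5 k) (a := 17) (x := 5) (by norm_num)
        (by simpa [setVar_var, h1] using hk)
      have hla : ∀ a, (s'.setVar 5 k).lab a = s.lab a := lab_congr h1 (h4 2 (by decide))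
      simp only [setVar_var, hla, if_true, h3 16 (by norm_num), h3 17 (by norm_num),
        if_neg (show (16 : ℕ) ≠ 5 by norm_num), if_neg (show (17 : ℕ) ≠ 5 by norm_num),
        hl₁, hl₂] at e1 e2
      simp only [Ex.eval, e1, e2, setVar_con, h1, hc0, Inst.union]
      have : s₀.inst.n = s₀.con 0 := rfl
      by_cases hlt : l₁ k < s₀.con 0
      · have : s₀.con 0 - l₁ k ≠ 0 := by omega
        simp [this, hlt, Env.inst]
      · have : s₀.con 0 - l₁ k = 0 := by omega
        simp [this, hlt, Env.inst])
  rw [← hs₁] at hf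
  have F1 : Filling s₀ (s₀.inst.Owned own' v) s₁ := by
    rw [hs₁]
    refine hs.run _ (by decide) (by decide) ?_
    rw [← hs₁, hf.2 _ le_rfl]
    exact hs.mark
  have U1 : Upd (s₀.var 7) (s₀.con 11) s s₁ := by
    rw [hs₁]
    exact .of_eq (run_con _ _).1 (run_con _ _).2 (run_arr _ rfl _) (run_arr _ rfl _)
  obtain ⟨F2, U2, C2⟩ := F1.insert h6 hv hov' (l := s₀.inst.union l₁ l₂)
    (fun x hx => hf.1 x (by rwa [hc0])) hU
  obtain ⟨s₂, hs₂⟩ : ∃ s₂, s₂ = insertCmd.run s₁ := ⟨_, rfl⟩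
  rw [← hs₂] at F2 U2 C2
  -- the second labeling
  obtain ⟨s₃, hs₃⟩ : ∃ s₃, s₃ = (fill (.eqE (.arr 0 (.var 5)) (labE 17 12) (labE 16 13)
    (.arr 0 (.var 5)))).run s₂ := ⟨_, rfl⟩
  have hc2 := F2.upd.con
  have v16 : s₂.var 16 = s.var 16 := by
    rw [hs₂, run_var _ rfl, hs₁, run_var _ rfl]
  have v17 : s₂.var 17 = s.var 17 := by
    rw [hs₂, run_var _ rfl, hs₁, run_var _ rfl]
  have U02 := U1.trans U2
  have hf' := run_fill (s := s₂) (e := .eqE (.arr 0 (.var 5)) (labE 17 12) (labE 16 13)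
    (.arr 0 (.var 5))) (s₀.inst.join v u l₁ l₂) (by
      intro k hk s' h1 h2 h3 h4 h5
      have w12 : (s'.setVar 5 k).var 12 = u := by
        rw [setVar_var, if_neg (by norm_num), h3 12 (by norm_num), F2.var 12 (by simp), h12]
      have w13 : (s'.setVar 5 k).var 13 = v := by
        rw [setVar_var, if_neg (by norm_num), h3 13 (by norm_num), F2.var 13 (by simp), h13]
      have w16 : (s'.setVar 5 k).var 16 = s.var 16 := by
        rw [setVar_var, if_neg (by norm_num), h3 16 (by norm_num), v16]
      have w17 : (s'.setVar 5 k).var 17 = s.var 17 := by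
        rw [setVar_var, if_neg (by norm_num), h3 17 (by norm_num), v17]
      have e1 := eval_labE (s'.setVar 5 k) (a := 17) (x := 12) (by norm_num)
        (by rw [w12, setVar_con, h1, hc2]; exact hu)
      have e2 := eval_labE (s'.setVar 5 k) (a := 16) (x := 13) (by norm_num)
        (by rw [w13, setVar_con, h1, hc2]; exact hv)
      have hla : ∀ a, (s'.setVar 5 k).lab a = s₂.lab a := lab_congr h1 (h4 2 (by decide))
      rw [hla, w17, U02.lab _ (Or.inl ha₂), hl₂, w12] at e1
      rw [hla, w16, U02.lab _ (Or.inl ha₁), hl₁, w13] at e2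
      -- Insertion leaves the current labeling unchanged, so the join arises from the union by
      -- renaming the root label of `u`.
      have e3 : s₂.arr 0 k = s₀.inst.union l₁ l₂ k := by
        rw [hs₂, run_arr _ rfl]
        exact hf.1 k (by rw [hc0]; rwa [hc2] at hk)
      simp only [eval_eqE, e1, e2, Ex.eval, setVar_var, if_true, setVar_arr, h5 k le_rfl, e3,
        Inst.join, Inst.merge])
  rw [← hs₃] at hf'
  have F3 : Filling s₀ (s₀.inst.Owned own' v) s₃ := by
    rw [hs₃]
    refine F2.run _ (by decide) (by decide) ?_
    rw [← hs₃, hf'.2 _ le_rfl]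
    exact F2.mark
  have U3 : Upd (s₀.var 7) (s₀.con 11) s₂ s₃ := by
    rw [hs₃]
    exact .of_eq (run_con _ _).1 (run_con _ _).2 (run_arr _ rfl _) (run_arr _ rfl _)
  obtain ⟨F4, U4, C4⟩ := F3.insert h6 hv hov' (l := s₀.inst.join v u l₁ l₂)
    (fun x hx => hf'.1 x (by rwa [hc2])) hJ
  have hrun : pairBody.run s = insertCmd.run s₃ := by
    rw [hs₃, hs₂, hs₁]; rfl
  rw [hrun]
  exact ⟨F4, (U02.trans U3).trans U4, fun hc => (U3.trans U4).cont _ _ (C2 hc), C4⟩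

/-- The simulated combination of two labelings is entered by `pairLoop`. -/
theorem run_pairLoop {s₀ : Env} {own : ℕ → ℕ} {u v : ℕ} (huv : u ≠ v) (hu : u < s₀.con 0)
    (hv : v < s₀.con 0) (hou : own u = u) (hov : own v = v) (he : s₀.inst.OwnedEdges own)
    (h6 : s₀.var 6 = v) (h12 : s₀.var 12 = u) (h13 : s₀.var 13 = v)
    (hs : Filling s₀ (s₀.inst.Owned (Inst.give own u v) v) s₀)
    (su : s₀.Sound (s₀.inst.Owned own u) u (s₀.arr 3 u))
    (sv : s₀.Sound (s₀.inst.Owned own v) v (s₀.arr 3 v))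
    (bu : s₀.arr 3 u + s₀.con 11 ≤ s₀.var 7) (bv : s₀.arr 3 v + s₀.con 11 ≤ s₀.var 7)
    {m₁ m₂ : ℕ → ℕ} (k₁ : s₀.inst.Owned own v m₁) (k₂ : s₀.inst.Owned own u m₂)
    (c₁ : s₀.inst.Cap m₁) (c₂ : s₀.inst.Cap m₂)
    (e₁ : s₀.Cont (s₀.arr 3 v + s₀.inst.rkey v m₁) (s₀.inst.miss m₁))
    (e₂ : s₀.Cont (s₀.arr 3 u + s₀.inst.rkey u m₂) (s₀.inst.miss m₂))
    {m : ℕ → ℕ} (hm : m = s₀.inst.union m₁ m₂ ∨ m = s₀.inst.join v u m₁ m₂) (hcm : s₀.inst.Cap m) :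
    Filling s₀ (s₀.inst.Owned (Inst.give own u v) v) (pairLoop.run s₀) ∧
    (pairLoop.run s₀).Cont (s₀.var 7 + s₀.inst.rkey v m) (s₀.inst.miss m) := by
  have hw := twoWeights_inst s₀
  have lt₁ : s₀.inst.rkey v m₁ < s₀.con 11 := by
    rw [hs.ok.c11]
    exact Inst.rkey_lt hw c₁ (tau_lt_of_owned hw k₁ hv hov c₁)
  have lt₂ : s₀.inst.rkey u m₂ < s₀.con 11 := by
    rw [hs.ok.c11]
    exact Inst.rkey_lt hw c₂ (tau_lt_of_owned hw k₂ hu hou c₂)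
  -- every round keeps the invariant
  let Fl := Filling s₀ (s₀.inst.Owned (Inst.give own u v) v)
  let Z : Env → Prop := fun s => s.Cont (s₀.var 7 + s₀.inst.rkey v m) (s₀.inst.miss m)
  have hval : ∀ s, Fl s → ∀ a < s₀.var 7, s.arr 1 a = s₀.arr 1 a := fun s h a ha =>
    h.upd.val a (Or.inl ha)
  have hlab : ∀ s, Fl s → ∀ a < s₀.var 7, s.lab a = s₀.lab a := fun s h a ha =>
    h.upd.lab a (Or.inl ha)
  -- the inner round
  let inner : Cmd := .seq (.assign 17 (.add (.arr 3 (.var 12)) (.var 15)))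
    (.cond (.arr 1 (.var 17)) pairBody .skip)
  have hinner : ∀ (j k : ℕ) (s : Env), j < s₀.con 11 → k < s₀.con 11 → Fl s →
      s.var 16 = s₀.arr 3 v + j → s₀.arr 1 (s₀.arr 3 v + j) ≠ 0 →
      Fl (inner.run (s.setVar 15 k)) ∧ (inner.run (s.setVar 15 k)).var 16 = s₀.arr 3 v + j ∧
      (Z s → Z (inner.run (s.setVar 15 k))) ∧
      (j = s₀.inst.rkey v m₁ → k = s₀.inst.rkey u m₂ → Z (inner.run (s.setVar 15 k))) := by
    intro j k s hj hk hF h16 hne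
    have hb17 : (Ex.add (.arr 3 (.var 12)) (.var 15)).eval (s.setVar 15 k) = s₀.arr 3 u + k := by
      simp [Ex.eval, setVar_var, hF.arr 3 (by simp), hF.var 12 (by simp), h12]
    have F0 : Fl ((s.setVar 15 k).setVar 17 (s₀.arr 3 u + k)) := by
      have := hF.run (.assign 15 (.lit k)) (by simp [Cmd.setsVar]) (by simp [Cmd.setsArr]) hF.mark
      exact this.run (.assign 17 (.lit (s₀.arr 3 u + k))) (by simp [Cmd.setsVar])
        (by simp [Cmd.setsArr]) this.mark
    have hrun : inner.run (s.setVar 15 k) = (Cmd.cond (.arr 1 (.var 17)) pairBody .skip).run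
        ((s.setVar 15 k).setVar 17 (s₀.arr 3 u + k)) := by
      simp only [inner, Cmd.run, hb17]
    rw [hrun]
    obtain ⟨s', hs'⟩ : ∃ s', s' = (s.setVar 15 k).setVar 17 (s₀.arr 3 u + k) := ⟨_, rfl⟩
    rw [← hs'] at F0 ⊢
    have w16 : s'.var 16 = s₀.arr 3 v + j := by rw [hs', ← h16]; simp [setVar_var]
    have w17 : s'.var 17 = s₀.arr 3 u + k := by rw [hs']; simp [setVar_var]
    have hZ' : Z s → Z s' := by rw [hs']; exact id
    simp only [Cmd.run, Ex.eval, w17, hval s' F0 (s₀.arr 3 u + k) (by omega)]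
    split_ifs with h0
    · obtain ⟨vv, vc, vk, vo⟩ := sv j hj hne
      obtain ⟨uv, uc, uk, uo⟩ := su k hk h0
      obtain ⟨G1, G2, G3, G4⟩ := run_pairBody huv hu hv hou hov h6 h12 h13 F0
        (l₁ := s₀.lab (s₀.arr 3 v + j)) (l₂ := s₀.lab (s₀.arr 3 u + k))
        (by rw [w16]; exact hlab s' F0 _ (by omega)) (by rw [w17]; exact hlab s' F0 _ (by omega))
        vo uo (by omega) (by omega)
      refine ⟨G1, by rw [run_var pairBody rfl, w16], fun hz => G2.cont _ _ (hZ' hz), ?_⟩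
      rintro rfl rfl
      -- The entries found at the keys of `m₁` and `m₂` need not be these labelings, but they have
      -- the same keys and miss at most as many pairs.
      have S1 : s₀.inst.Sim v (s₀.lab (s₀.arr 3 v + s₀.inst.rkey v m₁)) m₁ :=
        ⟨vc, c₁, vk, by have := e₁.2; omega⟩
      have S2 : s₀.inst.Sim u (s₀.lab (s₀.arr 3 u + s₀.inst.rkey u m₂)) m₂ :=
        ⟨uc, c₂, uk, by have := e₂.2; omega⟩
      have fin : ∀ l, s₀.inst.Sim v l m → (pairBody.run s').Cont (s₀.var 7 + s₀.inst.rkey v l)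
          (s₀.inst.miss l) → Z (pairBody.run s') := by
        intro l hS hC
        rw [hS.rkey_eq] at hC
        exact ⟨hC.1, hC.2.trans (by have := hS.miss_le; omega)⟩
      rcases hm with rfl | rfl
      · have S := Inst.sim_union hw huv hv hov vo uo k₁ k₂ S1 S2
        exact fin _ S (G3 S.cap_left)
      · have S := Inst.sim_join hw huv hu hv hou hov he vo uo k₁ k₂ S1 S2 hcm
        exact fin _ S (G4 S.cap_left)
    · refine ⟨F0, w16, hZ', ?_⟩
      rintro rfl rfl
      exact absurd e₂.1 h0
  -- the outer round
  let outer : Cmd := .seq (.assign 16 (.add (.arr 3 (.var 13)) (.var 14))) <|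
    .cond (.arr 1 (.var 16)) (.iter 15 11 inner) .skip
  have houter : ∀ (j : ℕ) (s : Env), j < s₀.con 11 → Fl s →
      Fl (outer.run (s.setVar 14 j)) ∧ (Z s → Z (outer.run (s.setVar 14 j))) ∧
      (j = s₀.inst.rkey v m₁ → Z (outer.run (s.setVar 14 j))) := by
    intro j s hj hF
    have hb16 : (Ex.add (.arr 3 (.var 13)) (.var 14)).eval (s.setVar 14 j) = s₀.arr 3 v + j := by
      simp [Ex.eval, setVar_var, hF.arr 3 (by simp), hF.var 13 (by simp), h13]
    have F0 : Fl ((s.setVar 14 j).setVar 16 (s₀.arr 3 v + j)) := by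
      have := hF.run (.assign 14 (.lit j)) (by simp [Cmd.setsVar]) (by simp [Cmd.setsArr]) hF.mark
      exact this.run (.assign 16 (.lit (s₀.arr 3 v + j))) (by simp [Cmd.setsVar])
        (by simp [Cmd.setsArr]) this.mark
    have hrun : outer.run (s.setVar 14 j) = (Cmd.cond (.arr 1 (.var 16))
      (.iter 15 11 inner) .skip).run
        ((s.setVar 14 j).setVar 16 (s₀.arr 3 v + j)) := by
      simp only [outer, Cmd.run, hb16]
    rw [hrun]
    obtain ⟨s', hs'⟩ : ∃ s', s' = (s.setVar 14 j).setVar 16 (s₀.arr 3 v + j) := ⟨_, rfl⟩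
    rw [← hs'] at F0 ⊢
    have w16 : s'.var 16 = s₀.arr 3 v + j := by rw [hs']; simp [setVar_var]
    have hZ' : Z s → Z s' := by rw [hs']; exact id
    simp only [Cmd.run, Ex.eval, w16, hval s' F0 (s₀.arr 3 v + j) (by omega)]
    have hcon : s'.con = s₀.con := F0.upd.con
    split_ifs with h0
    · rw [hcon]
      refine ⟨?_, fun hz => ?_, ?_⟩
      · exact (iterFor_inv (fun _ s => Fl s ∧ s.var 16 = s₀.arr 3 v + j) ⟨F0, w16⟩
          fun k s hk ⟨a, b⟩ => ⟨(hinner j k s hj hk a b h0).1, (hinner j k s hj hk a b h0).2.1⟩).1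
      · exact (iterFor_inv (fun _ s => (Fl s ∧ s.var 16 = s₀.arr 3 v + j) ∧ Z s)
          ⟨⟨F0, w16⟩, hZ' hz⟩ fun k s hk ⟨⟨a, b⟩, c⟩ =>
            ⟨⟨(hinner j k s hj hk a b h0).1, (hinner j k s hj hk a b h0).2.1⟩,
              (hinner j k s hj hk a b h0).2.2.1 c⟩).2
      · intro hjm
        exact (iterFor_hit (fun s => Fl s ∧ s.var 16 = s₀.arr 3 v + j) Z (i := s₀.inst.rkey u m₂)
          ⟨F0, w16⟩
          (fun k s hk ⟨a, b⟩ => ⟨(hinner j k s hj hk a b h0).1, (hinner j k s hj hk a b h0).2.1⟩)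
          lt₂ (fun s ⟨a, b⟩ => (hinner j _ s hj lt₂ a b h0).2.2.2 hjm rfl)
          (fun k s hk ⟨a, b⟩ => (hinner j k s hj hk a b h0).2.2.1)).2
    · refine ⟨F0, hZ', ?_⟩
      rintro rfl
      exact absurd e₁.1 h0
  exact iterFor_hit Fl Z (i := s₀.inst.rkey v m₁) hs (fun k s hk h => (houter k s hk h).1) lt₁
    (fun s h => (houter _ s lt₁ h).2.2 rfl) (fun k s hk h => (houter k s hk h).2.1)

end RAM

/-! ### Targets with connected clusters -/

namespace Inst

variable {I : Inst}

/-- On the vertices owned by `v`, the labeling `l` has the same clusters as `q`. -/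
def Ker (I : Inst) (own : ℕ → ℕ) (v : ℕ) (l q : ℕ → ℕ) : Prop :=
  ∀ x < I.n, ∀ y < I.n, own x = v → own y = v → (l x = l y ↔ q x = q y)

/-- Clusters of `q` have fewer than `E` vertices. -/
def Small (I : Inst) (q : ℕ → ℕ) : Prop := ∀ x < I.n, #{y ∈ range I.n | q y = q x} < I.E

/-- Clusters of `q` are connected. -/
def Conn (I : Inst) (q : ℕ → ℕ) : Prop := ∀ x < I.n, ∀ y < I.n, q x = q y →
  Relation.ReflTransGen (fun a b => a < I.n ∧ b < I.n ∧ I.adj a b ≠ 0 ∧ q a = q b) x y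

theorem sz_eq_card (l : ℕ → ℕ) (i : ℕ) : I.sz l i = #{y ∈ range I.n | l y = i} := by
  rw [card_filter]; rfl

theorem Ker.cap {own : ℕ → ℕ} {v : ℕ} {l q : ℕ → ℕ} (h : I.Ker own v l q) (ho : I.Owned own v l)
    (hq : I.Small q) : I.Cap l := by
  intro i hi
  rw [sz_eq_card]
  have hE : 0 < I.E := (Nat.zero_le _).trans_lt (hq i hi)
  rcases Finset.eq_empty_or_nonempty {y ∈ range I.n | l y = i} with he | ⟨x, hx⟩
  · rw [he]; simpa
  · simp only [mem_filter, mem_range] at hx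
    refine (card_le_card fun y hy => ?_).trans_lt (hq x hx.1)
    simp only [mem_filter, mem_range] at hy ⊢
    have a := ho x hx.1
    have b := ho y hy.1
    have c := h y hy.1 x hx.1
    grind

/-- Follow a path inside the cluster of `q` from `x` to `y`. It can leave the part of `u` only
through an edge between owners, that is, from `u` itself, and the only possible other end is `v`. So
the cluster contains both `u` and `v`. -/
theorem Conn.cross {own q : ℕ → ℕ} {u v : ℕ} (hq : I.Conn q) (he : I.OwnedEdges own)
    (huv : u ≠ v) (huniq : ∀ y < I.n, own y = y → y ≠ u → I.adj u y ≠ 0 → y = v)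
    {x y : ℕ} (hx : x < I.n) (hy : y < I.n) (hxu : own x = u) (hyv : own y = v)
    (hxy : q x = q y) : q u = q x ∧ q v = q x := by
  have : ∀ z, Relation.ReflTransGen
      (fun a b => a < I.n ∧ b < I.n ∧ I.adj a b ≠ 0 ∧ q a = q b) x z →
      q z = q x ∧ (own z = u ∨ (q u = q x ∧ q v = q x)) := by
    intro z hz
    induction hz with
    | refl => exact ⟨rfl, Or.inl hxu⟩
    | @tail b c _ hbc ih =>
      obtain ⟨hb, hc, ha, hqbc⟩ := hbc
      obtain ⟨i1, i2⟩ := ih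
      refine ⟨hqbc.symm.trans i1, ?_⟩
      rcases i2 with i2 | i2
      · by_cases hcu : own c = u
        · exact Or.inl hcu
        · right
          obtain ⟨e1, e2⟩ := he b hb c hc ha (by rw [i2]; exact fun h => hcu h.symm)
          have hbu : b = u := by rw [← e1, i2]
          subst hbu
          have := huniq c hc e2 (fun h => hcu (by rw [e2, h])) ha
          subst this
          exact ⟨i1, hqbc.symm.trans i1⟩
      · exact Or.inr i2
  rcases (this y (hq x hx y hy hxy)).2 with h | h
  · exact absurd (hyv.symm.trans h) huv.symm
  · exact h

/-- By `Conn.cross`, a cluster of `q` that meets both parts contains `u` and `v`. So either the two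
root clusters belong together and are the only ones to be fused, or no cluster crosses. -/
theorem ker_combine {own q : ℕ → ℕ} {u v : ℕ} (hq : I.Conn q) (he : I.OwnedEdges own)
    (huv : u ≠ v) (hu : u < I.n) (hv : v < I.n) (hou : own u = u) (hov : own v = v)
    (huniq : ∀ y < I.n, own y = y → y ≠ u → I.adj u y ≠ 0 → y = v)
    {m₁ m₂ : ℕ → ℕ} (k₁ : I.Owned own v m₁) (k₂ : I.Owned own u m₂)
    (r₁ : I.Ker own v m₁ q) (r₂ : I.Ker own u m₂ q) :
    I.Ker (give own u v) v (if q u = q v then I.join v u m₁ m₂ else I.union m₁ m₂) q := by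
  intro x hx y hy hx' hy'
  have cxy := fun a b c => hq.cross he huv huniq hx hy a b c
  have cyx := fun a b c => hq.cross he huv huniq hy hx a b c
  have a1 := r₁ x hx y hy
  have a2 := r₂ x hx y hy
  have b1 := r₁ x hx v hv
  have b2 := r₂ x hx u hu
  have d1 := r₁ y hy v hv
  have d2 := r₂ y hy u hu
  have e1 := (k₁ v hv).1 hov
  have e2 := (k₂ u hu).1 hou
  unfold give at hx' hy'
  split_ifs with hquv
  · unfold join merge union
    rcases Owned.cases huv k₁ k₂ hx with h | h | h <;>
    rcases Owned.cases huv k₁ k₂ hy with h' | h' | h' <;> grind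
  · unfold union
    rcases Owned.cases huv k₁ k₂ hx with h | h | h <;>
    rcases Owned.cases huv k₁ k₂ hy with h' | h' | h' <;> grind

theorem owned_give {own : ℕ → ℕ} {u v w : ℕ} (hwu : w ≠ u) (hwv : w ≠ v) (l : ℕ → ℕ) :
    I.Owned (give own u v) w l ↔ I.Owned own w l := by
  have : ∀ x, give own u v x = w ↔ own x = w := by
    intro x; unfold give; grind
  unfold Owned
  simp only [ne_eq, this]

theorem ker_give {own : ℕ → ℕ} {u v w : ℕ} (hwu : w ≠ u) (hwv : w ≠ v) (l q : ℕ → ℕ) :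
    I.Ker (give own u v) w l q ↔ I.Ker own w l q := by
  have : ∀ x, give own u v x = w ↔ own x = w := by
    intro x; unfold give; grind
  unfold Ker
  simp only [this]

/-- Edges that leave the part of `u` run from `u` to `v` and become internal; all other edges
between parts still join the same owners. -/
theorem ownedEdges_give {own : ℕ → ℕ} {u v : ℕ} (he : I.OwnedEdges own)
    (hsym : ∀ x < I.n, ∀ y < I.n, I.adj x y ≠ 0 → I.adj y x ≠ 0)
    (huniq : ∀ y < I.n, own y = y → y ≠ u → I.adj u y ≠ 0 → y = v) :
    I.OwnedEdges (give own u v) := by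
  intro x hx y hy ha hne
  have h1 := he x hx y hy ha
  have h2 := huniq x hx
  have h3 := huniq y hy
  have h4 := hsym x hx y hy ha
  unfold give at *
  grind

end Inst

/-! ### One round of leaf elimination -/

namespace RAM

/-- Test for remaining vertices with at most one remaining neighbor. -/
def leafE : Ex := .ite (.arr 4 (.var 19)) (.lit 0) (.sub (.lit 2) (.sum 0 0
  (.ite (.arr 4 (.var 0)) (.lit 0) (.ite (adjE 19 0) (.lit 1) (.lit 0)))))

/-- Test for remaining vertices other than the chosen one. -/
def otherE : Ex := .ite (.arr 4 (.var 19)) (.lit 0) (.eqE (.var 19) (.var 12) (.lit 0) (.lit 1))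

/-- Test for remaining neighbors of the chosen vertex. -/
def nbrE : Ex := .ite (.arr 4 (.var 19)) (.lit 0) (.eqE (.var 19) (.var 12) (.lit 0) (adjE 12 19))

/-- Choose a vertex to be eliminated, and the vertex that takes over its table. -/
def chooseCmd : Cmd :=
  .seq (.assign 12 (.con 0)) <| .seq (search 12 leafE) <|
  .seq (.assign 13 (.con 0)) <| .seq (search 13 otherE) (search 13 nbrE)

theorem eval_leafE (s : Env) (k : ℕ) : leafE.eval (s.setVar 19 k) ≠ 0 ↔
    s.arr 4 k = 0 ∧ #{y ∈ range s.inst.n | s.arr 4 y = 0 ∧ s.inst.adj k y ≠ 0} ≤ 1 := by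
  have e : ∀ y, (adjE 19 0).eval ((s.setVar 19 k).setVar 0 y) = s.inst.adj k y := by
    intro y
    rcases eval_adjE ((s.setVar 19 k).setVar 0 y) 19 0 with h | h
    · rw [h]; simp [setVar_var]
    · omega
  simp only [leafE, Ex.eval, e, setVar_arr, setVar_var, setVar_con, if_true]
  have : ∑ y ∈ range (s.con 0), (if s.arr 4 y ≠ 0 then 0 else
      if s.inst.adj k y ≠ 0 then 1 else 0) =
      #{y ∈ range s.inst.n | s.arr 4 y = 0 ∧ s.inst.adj k y ≠ 0} := by
    rw [card_filter]
    refine sum_congr rfl fun y _ => ?_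
    by_cases h1 : s.arr 4 y = 0 <;> by_cases h2 : s.inst.adj k y = 0 <;> simp [h1, h2]
  rw [this]
  by_cases h1 : s.arr 4 k = 0
  · simp [h1]; omega
  · simp [h1]

theorem eval_otherE (s : Env) (k : ℕ) : otherE.eval (s.setVar 19 k) ≠ 0 ↔
    s.arr 4 k = 0 ∧ k ≠ s.var 12 := by
  simp only [otherE, Ex.eval, eval_eqE, setVar_arr, setVar_var, if_true]
  by_cases h1 : s.arr 4 k = 0 <;> simp [h1]

theorem eval_nbrE (s : Env) (k : ℕ) : nbrE.eval (s.setVar 19 k) ≠ 0 ↔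
    s.arr 4 k = 0 ∧ k ≠ s.var 12 ∧ s.inst.adj (s.var 12) k ≠ 0 := by
  have e : (adjE 12 19).eval (s.setVar 19 k) = s.inst.adj (s.var 12) k := by
    rcases eval_adjE (s.setVar 19 k) 12 19 with h | h
    · rw [h]; simp [setVar_var]
    · omega
  simp only [nbrE, Ex.eval, eval_eqE, setVar_arr, setVar_var, if_true, e]
  by_cases h1 : s.arr 4 k = 0 <;> simp [h1]

/-- If the chosen vertex has no remaining neighbor, an arbitrary other remaining vertex takes over
its table, and the uniqueness clause holds vacuously. This is how different trees of the forest are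
combined. -/
theorem run_choose {s : Env} (hleaf : ∀ R ⊆ range s.inst.n, R.Nonempty →
      ∃ x ∈ R, #{y ∈ R | s.inst.adj x y ≠ 0} ≤ 1)
    (hcard : 1 < #{x ∈ range s.inst.n | s.arr 4 x = 0}) :
    ∃ u v, (chooseCmd.run s).arr = s.arr ∧ (chooseCmd.run s).var 12 = u ∧
      (chooseCmd.run s).var 13 = v ∧ u < s.con 0 ∧ v < s.con 0 ∧ u ≠ v ∧ s.arr 4 u = 0 ∧
      s.arr 4 v = 0 ∧ ∀ y < s.con 0, s.arr 4 y = 0 → y ≠ u → s.inst.adj u y ≠ 0 → y = v := by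
  set R := {x ∈ range s.inst.n | s.arr 4 x = 0} with hR
  obtain ⟨s₁, hs₁⟩ : ∃ s₁, s₁ = (search 12 leafE).run (s.setVar 12 (s.con 0)) := ⟨_, rfl⟩
  have c1 : s₁.con = s.con := by rw [hs₁, (run_con _ _).1]; rfl
  have i1 : s₁.inst = s.inst := by rw [hs₁, inst_run]; rfl
  obtain ⟨a1, b1⟩ := run_search (s := s.setVar 12 (s.con 0)) (r := 12) (e := leafE) (by norm_num)
    (fun k => s.arr 4 k = 0 ∧ #{y ∈ range s.inst.n | s.arr 4 y = 0 ∧ s.inst.adj k y ≠ 0} ≤ 1) (by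
      intro k _ s' h1 h2 h3 _
      rw [eval_leafE, inst_eq h1 h2, h3]; rfl)
  rw [← hs₁] at a1 b1
  have hu : s₁.var 12 < s.con 0 ∧ s.arr 4 (s₁.var 12) = 0 ∧
      #{y ∈ range s.inst.n | s.arr 4 y = 0 ∧ s.inst.adj (s₁.var 12) y ≠ 0} ≤ 1 := by
    rcases b1 with ⟨-, b1⟩ | b1
    · obtain ⟨x, hx, hx'⟩ := hleaf R (filter_subset _ _) (card_pos.1 (by omega))
      simp only [hR, mem_filter, mem_range] at hx
      rw [hR, filter_filter] at hx'
      exact absurd ⟨hx.2, hx'⟩ (b1 x hx.1)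
    · exact b1
  obtain ⟨s₂, hs₂⟩ : ∃ s₂, s₂ = (search 13 otherE).run (s₁.setVar 13 (s₁.con 0)) := ⟨_, rfl⟩
  have c2 : s₂.con = s.con := by rw [hs₂, (run_con _ _).1, setVar_con, c1]
  have i2 : s₂.inst = s.inst := by rw [hs₂, inst_run, inst_setVar, i1]
  have a1' : s₁.arr = s.arr := a1
  obtain ⟨a2, b2⟩ := run_search (s := s₁.setVar 13 (s₁.con 0)) (r := 13) (e := otherE) (by norm_num)
    (fun k => s.arr 4 k = 0 ∧ k ≠ s₁.var 12) (by
      intro k _ s' h1 h2 h3 h4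
      rw [eval_otherE, h3, h4 12 (by norm_num) (by norm_num), setVar_arr, a1']
      rfl)
  rw [← hs₂] at a2 b2
  have a2' : s₂.arr = s.arr := a2.trans a1'
  have w2 : s₂.var 12 = s₁.var 12 := by rw [hs₂, run_var _ rfl]; rfl
  have hv : s₂.var 13 < s.con 0 ∧ s.arr 4 (s₂.var 13) = 0 ∧ s₂.var 13 ≠ s₁.var 12 := by
    rcases b2 with ⟨-, b2⟩ | b2
    · obtain ⟨x, hx, hne⟩ := exists_mem_ne hcard (s₁.var 12)
      simp only [hR, mem_filter, mem_range] at hx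
      exact absurd ⟨hx.2, hne⟩ (b2 x (by rw [setVar_con, c1]; exact hx.1))
    · rw [setVar_con, c1] at b2; exact b2
  obtain ⟨s₃, hs₃⟩ : ∃ s₃, s₃ = (search 13 nbrE).run s₂ := ⟨_, rfl⟩
  obtain ⟨a3, b3⟩ := run_search (s := s₂) (r := 13) (e := nbrE) (by norm_num)
    (fun k => s.arr 4 k = 0 ∧ k ≠ s₁.var 12 ∧ s.inst.adj (s₁.var 12) k ≠ 0) (by
      intro k _ s' h1 h2 h3 h4
      rw [eval_nbrE, h3, h4 12 (by norm_num) (by norm_num), a2', w2, inst_eq h1 h2, i2])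
  rw [← hs₃] at a3 b3
  have w3 : s₃.var 12 = s₁.var 12 := by rw [hs₃, run_var _ rfl, w2]
  have hrun : chooseCmd.run s = s₃ := by rw [hs₃, hs₂, hs₁]; rfl
  rw [hrun]
  rw [c2] at b3
  refine ⟨s₁.var 12, s₃.var 13, a3.trans a2', w3, rfl, hu.1, ?_⟩
  rcases b3 with ⟨b3, b4⟩ | ⟨b3, b4, b5, b6⟩
  · rw [b3]
    exact ⟨hv.1, hv.2.2.symm, hu.2.1, hv.2.1, fun y hy h1 h2 h3 => absurd ⟨h1, h2, h3⟩ (b4 y hy)⟩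
  · refine ⟨b3, b5.symm, hu.2.1, b4, fun y hy h1 h2 h3 => ?_⟩
    exact card_le_one.1 hu.2.2 y (by simp [h1, h3]; exact hy) _ (by simp [b4, b6]; exact b3)

/-- Eliminate one vertex. -/
def elimRound : Cmd :=
  .seq chooseCmd <| .seq (.assign 6 (.var 13)) <| .seq (.assign 7 (.var 11)) <|
  .seq pairLoop <| .seq (.write 3 (.var 13) (.var 11)) <| .seq (.write 4 (.var 12) (.lit 1))
  (.assign 11 (.add (.var 11) (.con 11)))

/-- The target `q` is represented in the table of the vertex `v`. -/
def Env.Represents (s : Env) (q own : ℕ → ℕ) (v : ℕ) : Prop :=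
  ∃ m, s.inst.Owned own v m ∧ s.inst.Ker own v m q ∧
    s.Cont (s.arr 3 v + s.inst.rkey v m) (s.inst.miss m)

/-- The state of the elimination after `j` rounds: vertices are owned by the remaining ones. -/
structure Elim (q : ℕ → ℕ) (j : ℕ) (own : ℕ → ℕ) (s : Env) : Prop where
  ok : s.Ok
  mark : s.arr 0 (s.con 0) = s.con 0
  own_lt : ∀ x < s.con 0, own x < s.con 0
  own_own : ∀ x < s.con 0, own (own x) = own x
  edges : s.inst.OwnedEdges own
  gone : ∀ x < s.con 0, s.arr 4 x = 0 ↔ own x = x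
  card : #{x ∈ range (s.con 0) | own x = x} + j = s.con 0
  table : ∀ v < s.con 0, own v = v → s.arr 3 v + s.con 11 ≤ s.var 11
  sound : ∀ v < s.con 0, own v = v → s.Sound (s.inst.Owned own v) v (s.arr 3 v)
  repr : ∀ v < s.con 0, own v = v → s.Represents q own v
  fresh : ∀ a, s.var 11 ≤ a → s.arr 1 a = 0

/-- No table is overwritten: the combined table occupies a fresh block at the position in variable
11, and then the pointer of `v` is moved there. All other tables lie below this block and stay
valid. -/
theorem Elim.round {q : ℕ → ℕ} {j : ℕ} {own : ℕ → ℕ} {s : Env} (h : Elim q j own s)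
    (hj : j + 1 < s.con 0) (hq : s.inst.Conn q) (hsmall : s.inst.Small q)
    (hsym : ∀ x < s.inst.n, ∀ y < s.inst.n, s.inst.adj x y ≠ 0 → s.inst.adj y x ≠ 0)
    (hleaf : ∀ R ⊆ range s.inst.n, R.Nonempty → ∃ x ∈ R, #{y ∈ R | s.inst.adj x y ≠ 0} ≤ 1) :
    ∃ own', Elim q (j + 1) own' (elimRound.run s) := by
  have hR : filter (fun x => s.arr 4 x = 0) (range s.inst.n) =
      filter (fun x => own x = x) (range (s.con 0)) :=
    filter_congr fun x hx => h.gone x (mem_range.1 hx)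
  obtain ⟨u, v, ha, e12, e13, hu, hv, huv, gu, gv, huniq⟩ := run_choose (s := s) hleaf (by
    rw [hR]; have := h.card; omega)
  have hou := (h.gone u hu).1 gu
  have hov := (h.gone v hv).1 gv
  replace huniq : ∀ y < s.inst.n, own y = y → y ≠ u → s.inst.adj u y ≠ 0 → y = v :=
    fun y hy h1 => huniq y hy ((h.gone y hy).2 h1)
  -- the state before the combination of the tables
  obtain ⟨s₁, hs₁⟩ : ∃ s₁, s₁ = ((chooseCmd.run s).setVar 6 v).setVar 7 (s.var 11) := ⟨_, rfl⟩
  have c1 : s₁.con = s.con := by rw [hs₁]; exact (run_con _ _).1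
  have p1 : s₁.inp = s.inp := by rw [hs₁]; exact (run_con _ _).2
  have i1 : s₁.inst = s.inst := inst_eq c1 p1
  have a1 : s₁.arr = s.arr := by rw [hs₁]; exact ha
  have v6 : s₁.var 6 = v := by rw [hs₁]; simp [setVar_var]
  have v7 : s₁.var 7 = s.var 11 := by rw [hs₁]; simp [setVar_var]
  have v11 : s₁.var 11 = s.var 11 := by
    rw [hs₁]; simp only [setVar_var]; norm_num; exact run_var _ rfl s
  have v12 : s₁.var 12 = u := by rw [hs₁]; simp [setVar_var, e12]
  have v13 : s₁.var 13 = v := by rw [hs₁]; simp [setVar_var, e13]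
  have hlab : ∀ a, s₁.lab a = s.lab a := lab_congr c1 (by rw [a1])
  obtain ⟨m₁, k₁, r₁, t₁⟩ := h.repr v hv hov
  obtain ⟨m₂, k₂, r₂, t₂⟩ := h.repr u hu hou
  have hfill : Filling s₁ (s₁.inst.Owned (Inst.give own u v) v) s₁ := by
    refine ⟨h.ok.of_eq c1 (by rw [a1]), by rw [a1, c1]; exact h.mark, fun _ _ => rfl,
      fun _ _ => rfl, .refl _ _ _, fun k _ h0 => absurd ?_ h0⟩
    rw [v7, a1]; exact h.fresh _ (by omega)
  have hsound : ∀ w < s.con 0, own w = w → s₁.Sound (s₁.inst.Owned own w) w (s₁.arr 3 w) := by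
    intro w hw how
    rw [i1, a1]
    exact (h.sound w hw how).of_eq c1 p1 (by rw [a1]) (by rw [a1])
  have hK := Inst.ker_combine hq h.edges huv hu hv hou hov huniq k₁ k₂ r₁ r₂
  -- The combination that the target prescribes: the root clusters are fused exactly if `u` and `v`
  -- share a cluster of `q`.
  set m := if q u = q v then s.inst.join v u m₁ m₂ else s.inst.union m₁ m₂ with hm
  have hU := Inst.owned_union huv k₁ k₂
  have l1v := (k₁ v hv).1 hov
  have l2u := (k₂ u hu).1 hou
  have hO : s.inst.Owned (Inst.give own u v) v m := by
    rw [hm]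
    split_ifs
    · refine Inst.owned_merge hU l1v.1 ?_ l2u.1
      simp only [Inst.give, l1v.2]; split_ifs <;> rfl
    · exact hU
  have hcm : s.inst.Cap m := hK.cap hO hsmall
  obtain ⟨hF, hC⟩ := run_pairLoop (s₀ := s₁) huv (by rwa [c1]) (by rwa [c1]) hou hov
    (by rw [i1]; exact h.edges) v6 v12 v13 hfill (hsound u hu hou) (hsound v hv hov)
    (by rw [a1, c1, v7]; exact h.table u hu hou) (by rw [a1, c1, v7]; exact h.table v hv hov)
    (m₁ := m₁) (m₂ := m₂) (by rwa [i1]) (by rwa [i1]) (by rw [i1]; exact r₁.cap k₁ hsmall)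
    (by rw [i1]; exact r₂.cap k₂ hsmall) (by rw [i1]; simpa only [Env.Cont, a1] using t₁)
    (by rw [i1]; simpa only [Env.Cont, a1] using t₂) (m := m) (by
      rw [i1, hm]
      split_ifs
      · exact Or.inr rfl
      · exact Or.inl rfl) (by rwa [i1])
  obtain ⟨s₂, hs₂⟩ : ∃ s₂, s₂ = pairLoop.run s₁ := ⟨_, rfl⟩
  rw [← hs₂] at hF hC
  have c2 : s₂.con = s.con := hF.upd.con.trans c1
  have p2 : s₂.inp = s.inp := hF.upd.inp.trans p1
  have i2 : s₂.inst = s.inst := inst_eq c2 p2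
  have f11 := (hF.var 11 (by simp)).trans v11
  have f12 := (hF.var 12 (by simp)).trans v12
  have f13 := (hF.var 13 (by simp)).trans v13
  have f3 : s₂.arr 3 = s.arr 3 := (hF.arr 3 (by simp)).trans (by rw [a1])
  have f4 : s₂.arr 4 = s.arr 4 := (hF.arr 4 (by simp)).trans (by rw [a1])
  rw [i1, v7] at hC
  -- the final state
  obtain ⟨s₃, hs₃⟩ : ∃ s₃, s₃ = ((s₂.setArr 3 v (s.var 11)).setArr 4 u 1).setVar 11
      (s.var 11 + s.con 11) := ⟨_, rfl⟩
  have hrun : elimRound.run s = s₃ := by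
    have e1 : s₁ = (Cmd.seq (.assign 6 (.var 13)) (.assign 7 (.var 11))).run (chooseCmd.run s) := by
      rw [hs₁]
      simp only [Cmd.run, Ex.eval, e13, setVar_var, if_neg (show (11 : ℕ) ≠ 6 by norm_num)]
      rw [run_var chooseCmd rfl]
    have e2 : elimRound.run s = (Cmd.seq (.write 3 (.var 13) (.var 11)) (.seq
      (.write 4 (.var 12) (.lit 1)) (.assign 11 (.add (.var 11) (.con 11))))).run s₂ := by
      rw [hs₂, e1]; rfl
    rw [e2, hs₃]
    simp only [Cmd.run, Ex.eval, setArr_var, setArr_con, f11, f12, f13, c2]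
  rw [hrun]
  have c3 : s₃.con = s.con := by rw [hs₃]; exact c2
  have p3 : s₃.inp = s.inp := by rw [hs₃]; exact p2
  have i3 : s₃.inst = s.inst := inst_eq c3 p3
  have g0 : s₃.arr 0 = s₂.arr 0 := by rw [hs₃]; simp [setArr_arr]
  have g1 : s₃.arr 1 = s₂.arr 1 := by rw [hs₃]; simp [setArr_arr]
  have g2 : s₃.arr 2 = s₂.arr 2 := by rw [hs₃]; simp [setArr_arr]
  have g5 : s₃.arr 5 = s₂.arr 5 := by rw [hs₃]; simp [setArr_arr]
  have g3 : s₃.arr 3 = Function.update (s.arr 3) v (s.var 11) := by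
    rw [hs₃]; simp [setArr_arr, f3]
  have g4 : s₃.arr 4 = Function.update (s.arr 4) u 1 := by rw [hs₃]; simp [setArr_arr, f4]
  have g11 : s₃.var 11 = s.var 11 + s.con 11 := by rw [hs₃]; simp [setVar_var]
  have hgive : ∀ x, Inst.give own u v x = x ↔ own x = x ∧ x ≠ u := by
    intro x; unfold Inst.give; grind
  have hupd : Upd (s.var 11) (s.con 11) s s₃ := by
    have := hF.upd
    rw [v7, c1] at this
    exact ((Upd.of_eq c1 p1 (by rw [a1]) (by rw [a1])).trans this).trans
      (.of_eq (c3.trans c2.symm) (p3.trans p2.symm) g1 g2)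
  refine ⟨Inst.give own u v, ?_⟩
  constructor
  · exact hF.ok.of_eq (c3.trans c2.symm) g5
  · have := hF.mark
    rw [c2] at this
    rw [c3, g0, this]
  · intro x hx
    rw [c3] at hx ⊢
    unfold Inst.give
    split_ifs
    exacts [hv, h.own_lt x hx]
  · intro x hx
    rw [c3] at hx
    have := h.own_own x hx
    unfold Inst.give
    grind
  · rw [i3]
    exact Inst.ownedEdges_give h.edges hsym huniq
  · intro x hx
    rw [c3] at hx
    rw [hgive, g4, ← h.gone x hx]
    by_cases hxu : x = u <;> simp [hxu]
  · rw [c3]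
    have : filter (fun x => Inst.give own u v x = x) (range (s.con 0)) =
        (filter (fun x => own x = x) (range (s.con 0))).erase u := by
      ext x; simp only [hgive, mem_filter, mem_erase, mem_range]; tauto
    rw [this, card_erase_of_mem (by simp [hu, hou])]
    have := h.card
    omega
  · intro w hw how
    rw [c3] at hw ⊢
    rw [hgive] at how
    rw [g3, g11]
    by_cases hwv : w = v
    · simp [hwv]
    · rw [Function.update_of_ne hwv]
      have := h.table w hw how.1
      omega
  · intro w hw how
    rw [c3] at hw
    rw [hgive] at how
    rw [g3, i3]
    by_cases hwv : w = v
    · subst hwv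
      rw [Function.update_self]
      have := hF.sound
      rw [v6, v7, i1] at this
      exact this.of_eq (c3.trans c2.symm) (p3.trans p2.symm) g1 g2
    · rw [Function.update_of_ne hwv]
      have h1 := (h.sound w hw how.1).upd hupd (Or.inl (h.table w hw how.1))
      intro k hk h0
      obtain ⟨x1, x2, x3, x4⟩ := h1 k hk h0
      exact ⟨x1, x2, x3, (Inst.owned_give how.2 hwv _).2 x4⟩
  · intro w hw how
    rw [c3] at hw
    rw [hgive] at how
    unfold Env.Represents
    rw [g3, i3]
    by_cases hwv : w = v
    · subst hwv
      rw [Function.update_self]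
      exact ⟨m, hO, hK, by simpa only [Env.Cont, g1] using hC⟩
    · rw [Function.update_of_ne hwv]
      obtain ⟨m', y1, y2, y3⟩ := h.repr w hw how.1
      exact ⟨m', (Inst.owned_give how.2 hwv _).2 y1, (Inst.ker_give how.2 hwv _ _).2 y2,
        hupd.cont _ _ y3⟩
  · intro a haa
    rw [g11] at haa
    rw [hupd.val a (Or.inr haa)]
    exact h.fresh a (by omega)

end RAM

/-! ### Tables of single vertices and the whole elimination -/

namespace RAM

/-- Build the table of a single vertex. -/
def single : Cmd :=
  .seq (fill (.eqE (.var 5) (.var 10) (.var 10) (.con 0))) <| .seq (.assign 6 (.var 10)) <|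
  .seq (.assign 7 (.var 11)) <| .seq insertCmd <| .seq (.write 3 (.var 10) (.var 11))
  (.assign 11 (.add (.var 11) (.con 11)))

/-- Build the tables of all single vertices. -/
def initCmd : Cmd := .seq (.write 0 (.con 0) (.con 0)) (.iter 10 0 single)

/-- The tables of the vertices below `k` have been built. -/
structure Singles (q : ℕ → ℕ) (k : ℕ) (s : Env) : Prop where
  ok : s.Ok
  mark : s.arr 0 (s.con 0) = s.con 0
  gone : ∀ x, s.arr 4 x = 0
  table : ∀ v < k, s.arr 3 v + s.con 11 ≤ s.var 11
  sound : ∀ v < k, s.Sound (s.inst.Owned id v) v (s.arr 3 v)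
  repr : ∀ v < k, s.Represents q id v
  fresh : ∀ a, s.var 11 ≤ a → s.arr 1 a = 0

theorem Singles.step {q : ℕ → ℕ} {k : ℕ} {s : Env} (h : Singles q k s) (hk : k < s.con 0)
    (hsmall : s.inst.Small q) : Singles q (k + 1) (single.run (s.setVar 10 k)) := by
  have hs0 : (s.setVar 10 k).inst = s.inst := rfl
  obtain ⟨s₁, hs₁⟩ : ∃ s₁, s₁ = (fill (.eqE (.var 5) (.var 10) (.var 10) (.con 0))).run
    (s.setVar 10 k) := ⟨_, rfl⟩
  -- The only labeling owned by `k`: it labels itself, and all other vertices carry the mark n of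
  -- unlabeled vertices.
  let m : ℕ → ℕ := fun x => if x = k then k else s.con 0
  have hf := run_fill (s := s.setVar 10 k) (e := .eqE (.var 5) (.var 10) (.var 10) (.con 0)) m (by
    intro j _ s' h1 _ h3 _ _
    simp [Ex.eval, setVar_var, h3 10 (by norm_num), h1, m])
  rw [← hs₁] at hf
  have hO : s.inst.Owned id k m := by
    intro x hx
    simp only [id, m]
    constructor
    · rintro rfl; simp [hx]
    · intro hne; simp [hne]; rfl
  have hK : s.inst.Ker id k m q := by
    rintro x _ y _ rfl rfl; simp
  have hcm := hK.cap hO hsmall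
  obtain ⟨s₂, hs₂⟩ : ∃ s₂, s₂ = (s₁.setVar 6 k).setVar 7 (s.var 11) := ⟨_, rfl⟩
  have c1 : s₁.con = s.con := by rw [hs₁]; exact (run_con _ _).1
  have p1 : s₁.inp = s.inp := by rw [hs₁]; exact (run_con _ _).2
  have c2 : s₂.con = s.con := by rw [hs₂]; exact c1
  have p2 : s₂.inp = s.inp := by rw [hs₂]; exact p1
  have i2 : s₂.inst = s.inst := inst_eq c2 p2
  have a2 : ∀ j, j ≠ 0 → s₂.arr j = s.arr j := by
    intro j hj
    rw [hs₂, setVar_arr, setVar_arr, hs₁]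
    exact run_arr _ (by simpa [fill, Cmd.setsArr] using hj.symm) (s.setVar 10 k)
  have a20 : s₂.arr 0 = s₁.arr 0 := by rw [hs₂]; rfl
  have v6 : s₂.var 6 = k := by rw [hs₂]; simp [setVar_var]
  have v7 : s₂.var 7 = s.var 11 := by rw [hs₂]; simp [setVar_var]
  have v11 : s₂.var 11 = s.var 11 := by
    rw [hs₂, setVar_var, if_neg (by norm_num), setVar_var, if_neg (by norm_num), hs₁,
      run_var _ rfl, setVar_var, if_neg (by norm_num)]
  have v10 : s₂.var 10 = k := by
    rw [hs₂, setVar_var, if_neg (by norm_num), setVar_var, if_neg (by norm_num), hs₁,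
      run_var _ rfl, setVar_var, if_pos rfl]
  have hins := run_insert_owned (s := s₂) (own := id) (v := k) (l := m)
    (h.ok.of_eq c2 (a2 5 (by decide)))
    (by rw [a20, c2]; exact (hf.2 _ le_rfl).trans h.mark) (by rwa [c2]) rfl v6
    (by rw [a20, c2]; exact hf.1) (by rw [i2]; exact hO)
    (by
      intro j hj h0
      rw [a2 1 (by decide), v7] at h0
      exact absurd (h.fresh _ (by omega)) h0)
  rw [i2, v7, c2] at hins
  obtain ⟨U, S, C⟩ := hins
  replace C := C hcm
  obtain ⟨s₃, hs₃⟩ : ∃ s₃, s₃ = insertCmd.run s₂ := ⟨_, rfl⟩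
  rw [← hs₃] at U S C
  have a3 : ∀ j, insertCmd.setsArr j = false → s₃.arr j = s₂.arr j := by
    intro j hj; rw [hs₃]; exact run_arr _ hj s₂
  have w10 : s₃.var 10 = k := by rw [hs₃, run_var _ rfl, v10]
  have w11 : s₃.var 11 = s.var 11 := by rw [hs₃, run_var _ rfl, v11]
  have c3 : s₃.con = s.con := U.con.trans c2
  have p3 : s₃.inp = s.inp := U.inp.trans p2
  obtain ⟨s₄, hs₄⟩ : ∃ s₄, s₄ = (s₃.setArr 3 k (s.var 11)).setVar 11 (s.var 11 + s.con 11) :=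
    ⟨_, rfl⟩
  have hrun : single.run (s.setVar 10 k) = s₄ := by
    have e1 : s₂ = (Cmd.seq (.assign 6 (.var 10)) (.assign 7 (.var 11))).run s₁ := by
      have x10 : s₁.var 10 = k := by rw [hs₁, run_var _ rfl]; simp [setVar_var]
      have x11 : s₁.var 11 = s.var 11 := by rw [hs₁, run_var _ rfl]; simp [setVar_var]
      rw [hs₂]
      simp only [Cmd.run, Ex.eval, setVar_var, if_neg (show (11 : ℕ) ≠ 6 by norm_num), x10, x11]
    have e2 : single.run (s.setVar 10 k) = (Cmd.seq (.write 3 (.var 10) (.var 11))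
        (.assign 11 (.add (.var 11) (.con 11)))).run s₃ := by
      rw [hs₃, e1, hs₁]; rfl
    rw [e2, hs₄]
    simp only [Cmd.run, Ex.eval, setArr_var, setArr_con, w10, w11, c3]
  rw [hrun]
  have c4 : s₄.con = s.con := by rw [hs₄]; exact c3
  have p4 : s₄.inp = s.inp := by rw [hs₄]; exact p3
  have i4 : s₄.inst = s.inst := inst_eq c4 p4
  have g3 : s₄.arr 3 = Function.update (s.arr 3) k (s.var 11) := by
    rw [hs₄]; simp [setArr_arr, a3 3 rfl, a2 3 (by decide)]
  have g : ∀ j, j ≠ 3 → s₄.arr j = s₃.arr j := by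
    intro j hj; rw [hs₄]; simp [setArr_arr, hj]
  have g11 : s₄.var 11 = s.var 11 + s.con 11 := by rw [hs₄]; simp [setVar_var]
  have hupd : Upd (s.var 11) (s.con 11) s s₄ :=
    ((Upd.of_eq c2 p2 (a2 1 (by decide)) (a2 2 (by decide))).trans U).trans
      (.of_eq (c4.trans c3.symm) (p4.trans p3.symm) (g 1 (by decide)) (g 2 (by decide)))
  constructor
  · refine h.ok.of_eq c4 ?_
    rw [g 5 (by decide), a3 5 rfl, a2 5 (by decide)]
  · rw [c4, g 0 (by decide), a3 0 rfl, a20]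
    exact (hf.2 _ le_rfl).trans h.mark
  · intro x
    rw [g 4 (by decide), a3 4 rfl, a2 4 (by decide)]
    exact h.gone x
  · intro v hv
    rw [c4, g3, g11]
    by_cases hvk : v = k
    · simp [hvk]
    · rw [Function.update_of_ne hvk]
      have := h.table v (by omega)
      omega
  · intro v hv
    rw [g3, i4]
    by_cases hvk : v = k
    · subst hvk
      rw [Function.update_self]
      exact S.of_eq (c4.trans c3.symm) (p4.trans p3.symm) (g 1 (by decide)) (g 2 (by decide))
    · rw [Function.update_of_ne hvk]
      exact (h.sound v (by omega)).upd hupd (Or.inl (h.table v (by omega)))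
  · intro v hv
    unfold Env.Represents
    rw [g3, i4]
    by_cases hvk : v = k
    · subst hvk
      rw [Function.update_self]
      exact ⟨m, hO, hK, by simpa only [Env.Cont, g 1 (by decide)] using C⟩
    · rw [Function.update_of_ne hvk]
      obtain ⟨m', y1, y2, y3⟩ := h.repr v (by omega)
      exact ⟨m', y1, y2, hupd.cont _ _ y3⟩
  · intro a ha
    rw [g11] at ha
    rw [hupd.val a (Or.inr ha)]
    exact h.fresh a (by omega)

theorem run_init {q : ℕ → ℕ} {s : Env} (hok : s.Ok) (h1 : ∀ a, s.arr 1 a = 0)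
    (h4 : ∀ x, s.arr 4 x = 0) (hsmall : s.inst.Small q) :
    Elim q 0 id (initCmd.run s) := by
  have hI : (initCmd.run s).inst = s.inst := inst_run _ _
  have key := iterFor_inv (N := s.con 0) (fun k s' => s'.con = s.con ∧ s'.inp = s.inp ∧
    Singles q k s') (f := fun k s => single.run (s.setVar 10 k))
    (s := s.setArr 0 (s.con 0) (s.con 0))
    ⟨rfl, rfl, hok.of_eq rfl (by simp [setArr_arr]), by simp [setArr_arr],
      by simpa [setArr_arr] using h4, by omega, by omega, by omega,
      by simpa [setArr_arr] using fun a _ => h1 a⟩ (by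
    rintro k s' hk ⟨c, p, h⟩
    refine ⟨(run_con _ _).1.trans c, (run_con _ _).2.trans p, h.step (by rwa [c]) ?_⟩
    rwa [inst_eq c p])
  have hrun : initCmd.run s = iterFor (fun k s => single.run (s.setVar 10 k)) (s.con 0)
    (s.setArr 0 (s.con 0) (s.con 0)) := rfl
  rw [← hrun] at key
  obtain ⟨c, p, h⟩ := key
  constructor
  · exact h.ok
  · exact h.mark
  · intro x hx; exact hx
  · intro x _; rfl
  · intro x _ y _ _ _; exact ⟨rfl, rfl⟩
  · intro x _; simp [h.gone]
  · simp
  · intro v hv _; exact h.table v (by rwa [c] at hv)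
  · intro v hv _; exact h.sound v (by rwa [c] at hv)
  · intro v hv _; exact h.repr v (by rwa [c] at hv)
  · exact h.fresh

theorem Elim.setVar {q : ℕ → ℕ} {j : ℕ} {own : ℕ → ℕ} {s : Env} (h : Elim q j own s) {r : ℕ}
    (hr : r ≠ 11) (x : ℕ) : Elim q j own (s.setVar r x) := by
  have : (s.setVar r x).var 11 = s.var 11 := by rw [setVar_var, if_neg hr.symm]
  obtain ⟨a, b, c, d, e, f, g, h, i, j, k⟩ := h
  exact ⟨a.setVar r x, b, c, d, e, f, g, by rwa [this], i, j, by rwa [this]⟩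

/-- Eliminate all vertices but one. -/
def elimCmd : Cmd := .seq (.iter 18 9 elimRound)
  (.seq (.assign 13 (.con 0)) (search 13 (.ite (.arr 4 (.var 19)) (.lit 0) (.lit 1))))

/-- Each round removes one owner. After n - 1 rounds a single one is left, and since owners own
themselves it owns every vertex. -/
theorem run_elim {q : ℕ → ℕ} {s : Env} (h : Elim q 0 id s) (hq : s.inst.Conn q)
    (hsmall : s.inst.Small q)
    (hsym : ∀ x < s.inst.n, ∀ y < s.inst.n, s.inst.adj x y ≠ 0 → s.inst.adj y x ≠ 0)
    (hleaf : ∀ R ⊆ range s.inst.n, R.Nonempty → ∃ x ∈ R, #{y ∈ R | s.inst.adj x y ≠ 0} ≤ 1) :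
    ∃ own z, Elim q (s.con 0 - 1) own (elimCmd.run s) ∧ (elimCmd.run s).var 13 = z ∧
      z < s.con 0 ∧ ∀ x < s.con 0, own x = z := by
  have key := iterFor_inv (N := s.con 9) (fun k s' => s'.con = s.con ∧ s'.inp = s.inp ∧
    ∃ own, Elim q k own s') (f := fun k s => elimRound.run (s.setVar 18 k)) (s := s)
    ⟨rfl, rfl, id, h⟩ (by
    rintro k s' hk ⟨c, p, own, h'⟩
    have hi := inst_eq c p
    refine ⟨(run_con _ _).1.trans c, (run_con _ _).2.trans p, (h'.setVar (r := 18) (by norm_num)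
      k).round ?_ ?_ ?_ ?_ ?_⟩
    · rw [setVar_con, c]; rw [h.ok.c9] at hk; omega
    all_goals rw [inst_setVar, hi]; assumption)
  obtain ⟨s₁, hs₁⟩ : ∃ s₁, s₁ = (Cmd.iter 18 9 elimRound).run s := ⟨_, rfl⟩
  have hs₁' : s₁ = iterFor (fun k s => elimRound.run (s.setVar 18 k)) (s.con 9) s := hs₁
  rw [← hs₁', h.ok.c9] at key
  obtain ⟨c, p, own, h'⟩ := key
  have h'' := h'.setVar (r := 13) (by norm_num) (s.con 0)
  have hf := run_search (s := s₁.setVar 13 (s.con 0)) (r := 13)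
    (e := .ite (.arr 4 (.var 19)) (.lit 0) (.lit 1)) (by norm_num) (fun k => s₁.arr 4 k = 0) (by
      intro k _ s' h1 h2 h3 _
      simp [Ex.eval, setVar_var, h3])
  have hrun : elimCmd.run s = (search 13 (.ite (.arr 4 (.var 19)) (.lit 0) (.lit 1))).run
      (s₁.setVar 13 (s.con 0)) := by
    rw [hs₁, ← c, hs₁]; rfl
  rw [← hrun] at hf
  obtain ⟨fa, fb⟩ := hf
  have hpos := h.ok.pos
  have hcard := h'.card
  rw [c] at hcard
  obtain ⟨y, hy⟩ := card_eq_one.1 (show #{x ∈ range (s.con 0) | own x = x} = 1 by omega)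
  have hy' : y ∈ filter (fun x => own x = x) (range (s.con 0)) := by rw [hy]; simp
  simp only [mem_filter, mem_range] at hy'
  have hz : (elimCmd.run s).var 13 < s.con 0 ∧ s₁.arr 4 ((elimCmd.run s).var 13) = 0 := by
    rcases fb with ⟨-, fb⟩ | fb
    · exact absurd ((h'.gone y (by rw [c]; exact hy'.1)).2 hy'.2)
        (fb y (by rw [setVar_con, c]; exact hy'.1))
    · rw [setVar_con, c] at fb; exact fb
  have hzo := (h'.gone _ (by rw [c]; exact hz.1)).1 hz.2
  have hu : ∀ x < s.con 0, own x = x → x = y := by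
    intro x hx ho
    have : x ∈ filter (fun x => own x = x) (range (s.con 0)) := by simp [hx, ho]
    rw [hy] at this
    simpa using this
  refine ⟨own, _, ?_, rfl, hz.1, fun x hx => ?_⟩
  · have c' : (elimCmd.run s).con = (s₁.setVar 13 (s.con 0)).con :=
      (run_con elimCmd s).1.trans c.symm
    have p' : (elimCmd.run s).inp = (s₁.setVar 13 (s.con 0)).inp :=
      (run_con elimCmd s).2.trans p.symm
    have v' : (elimCmd.run s).var 11 = (s₁.setVar 13 (s.con 0)).var 11 := by
      rw [hrun]; exact run_var _ rfl _
    have hl : ∀ a, (elimCmd.run s).lab a = (s₁.setVar 13 (s.con 0)).lab a :=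
      lab_congr c' (by rw [fa])
    have i' := inst_eq c' p'
    constructor
    · exact h''.ok.of_eq c' (by rw [fa])
    · rw [fa, c']; exact h''.mark
    · rw [c']; exact h''.own_lt
    · rw [c']; exact h''.own_own
    · rw [i']; exact h''.edges
    · rw [c', fa]; exact h''.gone
    · rw [c']; exact h''.card
    · rw [c', fa, v']; exact h''.table
    · rw [c', fa, i']
      exact fun v hv ho => (h''.sound v hv ho).of_eq c' p' (by rw [fa]) (by rw [fa])
    · unfold Env.Represents Env.Cont
      rw [c', fa, i']; exact h''.repr
    · rw [fa, v']; exact h''.fresh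
  · have e1 := hu (own x) (by have := h'.own_lt x (by rwa [c]); rwa [c] at this)
      (h'.own_own x (by rwa [c]))
    rw [e1, hu _ hz.1 hzo]

end RAM

/-! ### Disconnected clusters, objective value and fairness -/

namespace Inst

variable {I : Inst}

/-- All vertices have labels. -/
def Full (I : Inst) (l : ℕ → ℕ) : Prop := ∀ x < I.n, l x < I.n

/-- `m` has clusters contained in those of `q`, and keeps the same edges. -/
structure Mid (I : Inst) (q m : ℕ → ℕ) : Prop where
  full : I.Full m
  le : ∀ x < I.n, ∀ y < I.n, m x = m y → q x = q y
  edge : ∀ x < I.n, ∀ y < I.n, I.adj x y ≠ 0 → q x = q y → m x = m y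

theorem Mid.cap {q m : ℕ → ℕ} (h : I.Mid q m) (hq : I.Small q) : I.Cap m := by
  intro i hi
  rw [sz_eq_card]
  rcases Finset.eq_empty_or_nonempty {y ∈ range I.n | m y = i} with he | ⟨x, hx⟩
  · rw [he]; exact (Nat.zero_le _).trans_lt (hq i hi)
  · simp only [mem_filter, mem_range] at hx
    refine (card_le_card fun y hy => ?_).trans_lt (hq x hx.1)
    simp only [mem_filter, mem_range] at hy ⊢
    exact ⟨hy.1, h.le y hy.1 x hx.1 (hy.2.trans hx.2.symm)⟩

/-- All these labelings keep precisely the edges inside clusters of `q`, so passing from components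
to full clusters changes no kept edge. -/
theorem Mid.miss_eq {q m m' : ℕ → ℕ} (h : I.Mid q m) (h' : I.Mid q m') : I.miss m = I.miss m' := by
  refine sum_congr rfl fun x hx => sum_congr rfl fun y hy => ?_
  have hx := mem_range.1 hx
  have hy := mem_range.1 hy
  have := h.full x hx
  have := h'.full x hx
  have := h.le x hx y hy
  have := h'.le x hx y hy
  have := h.edge x hx y hy
  have := h'.edge x hx y hy
  unfold Kept
  grind

theorem Mid.merge {q m : ℕ → ℕ} (h : I.Mid q m) {x y : ℕ} (hx : x < I.n) (hy : y < I.n)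
    (hq : q x = q y) : I.Mid q (merge m (m x) (m y)) := by
  refine ⟨fun a ha => ?_, fun a ha b hb => ?_, fun a ha b hb => ?_⟩
  · have := h.full a ha
    have := h.full x hx
    unfold Inst.merge
    split_ifs <;> assumption
  · have := h.le a ha b hb
    have := h.le a ha y hy
    have := h.le b hb y hy
    have := h.le a ha x hx
    have := h.le x hx b hb
    unfold Inst.merge
    grind
  · have := h.edge a ha b hb
    unfold Inst.merge
    grind

/-- The number of labels in use is the decreasing quantity that limits the number of merging rounds.
-/
theorem card_image_merge_lt {m : ℕ → ℕ} {x y : ℕ} (hx : x < I.n) (hy : y < I.n)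
    (hxy : m x ≠ m y) :
    #((range I.n).image (merge m (m x) (m y))) < #((range I.n).image m) := by
  apply card_lt_card
  refine (ssubset_iff_of_subset fun a ha => ?_).2 ⟨m y, ?_, ?_⟩
  · obtain ⟨b, hb, rfl⟩ := mem_image.1 ha
    unfold merge
    split_ifs
    · exact mem_image_of_mem _ (by simpa)
    · exact mem_image_of_mem _ hb
  · exact mem_image_of_mem _ (by simpa)
  · intro h
    obtain ⟨b, hb, h⟩ := mem_image.1 h
    unfold merge at h
    grind

/-- Number of ordered pairs with equal labels. -/
def same (I : Inst) (l : ℕ → ℕ) : ℕ :=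
  ∑ u ∈ range I.n, ∑ v ∈ range I.n, if l u = l v then 1 else 0

/-- Objective value: up to constants, twice the cost. -/
def val (I : Inst) (l : ℕ → ℕ) : ℕ := I.same l + (I.miss l + I.miss l)

theorem same_eq {l : ℕ → ℕ} (h : I.Full l) : I.same l = ∑ i ∈ range I.n, I.sz l i * I.sz l i := by
  have h1 : ∀ u ∈ range I.n, (∑ v ∈ range I.n, if l u = l v then 1 else 0) =
      ∑ i ∈ range I.n, if l u = i then I.sz l i else 0 := by
    intro u hu
    rw [sum_ite_eq, if_pos (mem_range.2 (h u (mem_range.1 hu)))]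
    refine sum_congr rfl fun v _ => ?_
    simp only [eq_comm]
  rw [same, sum_congr rfl h1, sum_comm]
  refine sum_congr rfl fun i _ => ?_
  rw [← sum_filter, sum_const, smul_eq_mul, ← sz_eq_card]

/-- The number of pairs with equal labels is the sum of the squared cluster sizes, and sizes are
functions of weights. So among labelings with equal keys, `val` is decided by `miss` alone. -/
theorem same_eq_of_key (hw : I.TwoWeights) {l m : ℕ → ℕ} (hl : I.Cap l) (hm : I.Cap m)
    (fl : I.Full l) (fm : I.Full m) (hk : I.key l = I.key m) : I.same l = I.same m := by
  rw [same_eq fl, same_eq fm]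
  have e : ∀ l, I.Cap l → ∑ i ∈ range I.n, I.sz l i * I.sz l i = ∑ i ∈ range I.n,
      (fun t => (t / I.E + t % I.E) * (t / I.E + t % I.E)) (I.tau l i) := by
    intro l hl
    refine sum_congr rfl fun i hi => ?_
    rw [sz_eq hw (hl i (mem_range.1 hi))]
  rw [e l hl, e m hm]
  exact sum_eq_of_key hw hl hm hk (fun t => (t / I.E + t % I.E) * (t / I.E + t % I.E))

/-- Number of heavy vertices with label `i`. -/
def heavy (I : Inst) (l : ℕ → ℕ) (i : ℕ) : ℕ := I.wsum (fun x => if I.wt x = I.E then 1 else 0) l i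

/-- Number of light vertices with label `i`. -/
def light (I : Inst) (l : ℕ → ℕ) (i : ℕ) : ℕ := I.wsum (fun x => if I.wt x = I.E then 0 else 1) l i

/-- In every cluster, both kinds of vertices make up at least the fraction `p / 2q`. -/
def Fair (I : Inst) (p q : ℕ) (l : ℕ → ℕ) : Prop := ∀ i < I.n,
  p * I.sz l i ≤ q * (I.heavy l i + I.heavy l i) ∧ p * I.sz l i ≤ q * (I.light l i + I.light l i)

/-- Fairness only constrains which compositions occur, and the key tells these. -/
theorem Fair.of_key (hw : I.TwoWeights) {l m : ℕ → ℕ} (hl : I.Cap l) (hm : I.Cap m)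
    (hk : I.key l = I.key m) {p q : ℕ} (h : I.Fair p q m) : I.Fair p q l := by
  intro i hi
  obtain ⟨j, hj, e⟩ := exists_label_of_key hw hl hm hk hi
  have := h j hj
  rw [heavy, light, sz_eq hw (hm j hj), (heavy_eq_div hw (hm j hj)).1,
    (heavy_eq_div hw (hm j hj)).2, e] at this
  rwa [heavy, light, sz_eq hw (hl i hi), (heavy_eq_div hw (hl i hi)).1,
    (heavy_eq_div hw (hl i hi)).2]

theorem wsum_of_ker {l m : ℕ → ℕ} (h : ∀ x < I.n, ∀ y < I.n, l x = l y ↔ m x = m y)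
    (f : ℕ → ℕ) {x : ℕ} (hx : x < I.n) : I.wsum f l (l x) = I.wsum f m (m x) :=
  sum_congr rfl fun y hy => by simp only [h y (mem_range.1 hy) x hx]

theorem Fair.of_ker {l m : ℕ → ℕ} (h : ∀ x < I.n, ∀ y < I.n, l x = l y ↔ m x = m y) {p q : ℕ}
    (fm : I.Full m) (hf : I.Fair p q m) : I.Fair p q l := by
  intro i hi
  by_cases hx : ∃ x < I.n, l x = i
  · obtain ⟨x, hx, rfl⟩ := hx
    have := hf (m x) (fm x hx)
    unfold sz heavy light at *
    rwa [wsum_of_ker h _ hx, wsum_of_ker h _ hx, wsum_of_ker h _ hx]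
  · push Not at hx
    have : I.sz l i = 0 := sum_eq_zero fun x hx' => if_neg (hx x (mem_range.1 hx'))
    simp [this]

theorem same_of_ker {l m : ℕ → ℕ} (h : ∀ x < I.n, ∀ y < I.n, l x = l y ↔ m x = m y) :
    I.same l = I.same m :=
  sum_congr rfl fun x hx => sum_congr rfl fun y hy => by
    simp only [h x (mem_range.1 hx) y (mem_range.1 hy)]

theorem full_congr (l l' : ℕ → ℕ) (h : ∀ x < I.n, l x = l' x) (hl : I.Full l) : I.Full l' :=
  fun x hx => by rw [← h x hx]; exact hl x hx

theorem tau_eq_zero_of_full {l : ℕ → ℕ} (h : I.Full l) : I.tau l I.n = 0 :=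
  sum_eq_zero fun x hx => if_neg (h x (mem_range.1 hx)).ne

/-- The index n as root means that there is no root: no vertex carries the label n, so the extra
digit is zero. -/
theorem rkey_eq_key {l : ℕ → ℕ} (h : I.Full l) (hn : l I.n = I.n) : I.rkey I.n l = I.key l := by
  rw [rkey, hn, tau_eq_zero_of_full h, mul_zero, add_zero]

end Inst

/-! ### Dropping the root and closing the table under mergings -/

namespace RAM

theorem Filling.insertFull {s₀ s : Env} (h6 : s₀.var 6 = s₀.con 0)
    (h : Filling s₀ s₀.inst.Full s) {l : ℕ → ℕ} (hl : ∀ x < s₀.con 0, s.arr 0 x = l x)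
    (hG : s₀.inst.Full l) :
    Filling s₀ s₀.inst.Full (insertCmd.run s) ∧ Upd (s₀.var 7) (s₀.con 11) s (insertCmd.run s) ∧
    (s₀.inst.Cap l → (insertCmd.run s).Cont (s₀.var 7 + s₀.inst.key l) (s₀.inst.miss l)) := by
  have hi := inst_eq h.upd.con h.upd.inp
  have hc := h.upd.con
  have e6 := (h.var 6 (by simp)).trans h6
  have e7 := h.var 7 (by simp)
  have hG' := Inst.full_congr l (s.arr 0) (fun x hx => (hl x hx).symm) hG
  have hm := h.mark
  rw [hc] at hm
  have := run_insert (s := s) h.ok h.mark (by rw [e6, hc]) (G := s₀.inst.Full)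
    (fun l l' h => Inst.full_congr l l' (by rwa [hc] at h)) hG' (by
      intro hcap
      rw [e6, hm, hi]
      have h0 : s₀.inst.tau (s.arr 0) (s₀.con 0) = 0 := Inst.tau_eq_zero_of_full hG'
      rw [h0, hc]
      have hE : s.inst.sz (s.arr 0) 0 < s.con 6 := hcap 0 h.ok.pos
      rw [hc] at hE
      exact Nat.mul_pos (by omega) (by omega)) (by rw [e6, ← h6, e7]; exact h.sound)
  rw [hi, hc, e7, e6] at this
  obtain ⟨h1, h2, h3⟩ := this
  refine ⟨⟨h.ok.run _ rfl, ?_, fun r hr => ?_, fun k hk => ?_, h.upd.trans h1, ?_⟩, h1, ?_⟩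
  · rw [h1.con, run_arr insertCmd rfl]; exact h.mark
  · rw [run_var insertCmd, h.var r hr]
    revert r; decide
  · rw [run_arr insertCmd, h.arr k hk]
    revert k; decide
  · rwa [h6]
  · intro hcap
    have := h3 ((Inst.cap_congr (I := s₀.inst) hl).2 hcap)
    rwa [show s₀.inst.rkey (s₀.con 0) (s.arr 0) = s₀.inst.key (s.arr 0) from
      Inst.rkey_eq_key hG' hm, Inst.key_congr (I := s₀.inst) hl,
      Inst.miss_congr (I := s₀.inst) hl] at this

/-- Load the entry at the position given by a variable. -/
def load (a : ℕ) : Cmd := fill (labE a 5)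

theorem run_load {s : Env} {a : ℕ} (h4 : a ≠ 4) (h5 : a ≠ 5) :
    (∀ x < s.con 0, ((load a).run s).arr 0 x = s.lab (s.var a) x) ∧
    ∀ x, s.con 0 ≤ x → ((load a).run s).arr 0 x = s.arr 0 x := by
  refine run_fill (s.lab (s.var a)) ?_
  intro k hk s' h1 h2 h3 h6 _
  have e := eval_labE (s'.setVar 5 k) (a := a) (x := 5) h4 (by simpa [setVar_var, h1] using hk)
  have hl : (s'.setVar 5 k).lab = s.lab := funext (lab_congr h1 (h6 2 (by decide)))
  rw [e, hl]
  simp [setVar_var, h5, h3 a h5]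

/-- Enter all entries for the last vertex into a new table without a root. -/
def gatherCmd : Cmd := .seq (.assign 6 (.con 0)) <| .seq (.assign 7 (.var 11)) <|
  .iter 14 11 <| .seq (.assign 16 (.add (.arr 3 (.var 13)) (.var 14))) <|
    .cond (.arr 1 (.var 16)) (.seq (load 16) insertCmd) .skip

theorem run_gather {q : ℕ → ℕ} {j : ℕ} {own : ℕ → ℕ} {s : Env} {z : ℕ} (h : Elim q j own s)
    (hz : s.var 13 = z) (hz0 : z < s.con 0) (hown : ∀ x < s.con 0, own x = z)
    (hsmall : s.inst.Small q) :
    ∃ s₀, s₀.inst = s.inst ∧ s₀.con = s.con ∧ s₀.var 6 = s₀.con 0 ∧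
    Filling s₀ s₀.inst.Full (gatherCmd.run s) ∧
    ∃ m, s.inst.Full m ∧ (∀ x < s.con 0, ∀ y < s.con 0, m x = m y ↔ q x = q y) ∧
    (gatherCmd.run s).Cont (s₀.var 7 + s.inst.key m) (s.inst.miss m) := by
  have hw := twoWeights_inst s
  set s₀ := (s.setVar 6 (s.con 0)).setVar 7 (s.var 11) with hs₀
  have i0 : s₀.inst = s.inst := rfl
  have c0 : s₀.con = s.con := rfl
  have v6 : s₀.var 6 = s.con 0 := by simp [hs₀, setVar_var]
  have v7 : s₀.var 7 = s.var 11 := by simp [hs₀, setVar_var]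
  have v13 : s₀.var 13 = z := by simp [hs₀, setVar_var, hz]
  have hzo : own z = z := hown z hz0
  obtain ⟨m, k₁, r₁, t₁⟩ := h.repr z hz0 hzo
  have fm : s.inst.Full m := fun x hx => ((k₁ x hx).1 (hown x hx)).1
  have hcm := r₁.cap k₁ hsmall
  have hF0 : Filling s₀ s₀.inst.Full s₀ :=
    ⟨h.ok.of_eq rfl rfl, h.mark, fun _ _ => rfl, fun _ _ => rfl, .refl _ _ _,
      fun k _ h0 => absurd (by rw [v7]; exact h.fresh _ (by omega)) h0⟩
  have ht := h.table z hz0 hzo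
  let body : Cmd := .seq (.assign 16 (.add (.arr 3 (.var 13)) (.var 14))) <|
    .cond (.arr 1 (.var 16)) (.seq (load 16) insertCmd) .skip
  let Z : Env → Prop := fun s' => s'.Cont (s₀.var 7 + s.inst.key m) (s.inst.miss m)
  have hbody : ∀ (k : ℕ) (s' : Env), k < s.con 11 → Filling s₀ s₀.inst.Full s' →
      Filling s₀ s₀.inst.Full (body.run (s'.setVar 14 k)) ∧
      (Z s' → Z (body.run (s'.setVar 14 k))) ∧
      (k = s.inst.rkey z m → Z (body.run (s'.setVar 14 k))) := by
    intro k s' hk hF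
    have hb : (Ex.add (.arr 3 (.var 13)) (.var 14)).eval (s'.setVar 14 k) = s.arr 3 z + k := by
      simp [Ex.eval, setVar_var, hF.arr 3 (by simp), hF.var 13 (by simp), v13]
      rfl
    have F1 : Filling s₀ s₀.inst.Full ((s'.setVar 14 k).setVar 16 (s.arr 3 z + k)) := by
      have := hF.run (.assign 14 (.lit k)) (by simp [Cmd.setsVar]) (by simp [Cmd.setsArr]) hF.mark
      exact this.run (.assign 16 (.lit (s.arr 3 z + k))) (by simp [Cmd.setsVar])
        (by simp [Cmd.setsArr]) this.mark
    have hrun : body.run (s'.setVar 14 k) = (Cmd.cond (.arr 1 (.var 16))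
        (.seq (load 16) insertCmd) .skip).run ((s'.setVar 14 k).setVar 16 (s.arr 3 z + k)) := by
      simp only [body, Cmd.run, hb]
    rw [hrun]
    have hZ1 : Z s' → Z ((s'.setVar 14 k).setVar 16 (s.arr 3 z + k)) := id
    generalize hs1 : (s'.setVar 14 k).setVar 16 (s.arr 3 z + k) = s₁ at *
    have w16 : s₁.var 16 = s.arr 3 z + k := by rw [← hs1]; simp [setVar_var]
    have hv : s₁.arr 1 (s.arr 3 z + k) = s.arr 1 (s.arr 3 z + k) := F1.upd.val _ (Or.inl (by omega))
    have hl : s₁.lab (s.arr 3 z + k) = s.lab (s.arr 3 z + k) := F1.upd.lab _ (Or.inl (by omega))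
    have hc1 : s₁.con = s.con := F1.upd.con
    simp only [Cmd.run, Ex.eval, w16, hv]
    split_ifs with h0
    · obtain ⟨x1, x2, x3, x4⟩ := h.sound z hz0 hzo k hk h0
      have hld := run_load (s := s₁) (a := 16) (by norm_num) (by norm_num)
      rw [w16, hl, hc1] at hld
      have F2 : Filling s₀ s₀.inst.Full ((load 16).run s₁) := by
        refine F1.run _ (by decide) (by decide) ?_
        rw [hc1, hld.2 _ le_rfl, ← hc1]
        exact F1.mark
      have U2 : Upd (s₀.var 7) (s₀.con 11) s₁ ((load 16).run s₁) :=
        .of_eq (run_con _ _).1 (run_con _ _).2 (run_arr _ rfl _) (run_arr _ rfl _)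
      have fl : s.inst.Full (s.lab (s.arr 3 z + k)) := fun x hx => ((x4 x hx).1 (hown x hx)).1
      obtain ⟨F3, U3, C3⟩ := F2.insertFull v6 hld.1 fl
      refine ⟨F3, fun hzz => (U2.trans U3).cont _ _ (hZ1 hzz), ?_⟩
      rintro rfl
      -- Without the root digit several entries may compete for the same key; the table keeps one
      -- that is at least as good as this one.
      have hk := (Inst.rkey_inj hw x2 hcm x3).1
      have := C3 x2
      rw [i0, hk] at this
      exact ⟨this.1, this.2.trans (by have := t₁.2; omega)⟩
    · refine ⟨F1, hZ1, ?_⟩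
      rintro rfl
      exact absurd t₁.1 h0
  have lt : s.inst.rkey z m < s.con 11 := by
    rw [h.ok.c11]
    exact Inst.rkey_lt hw hcm (tau_lt_of_owned hw k₁ hz0 hzo hcm)
  have key := iterFor_hit (Filling s₀ s₀.inst.Full) Z (N := s.con 11)
    (f := fun k s => body.run (s.setVar 14 k)) (i := s.inst.rkey z m) hF0
    (fun k s hk h => (hbody k s hk h).1) lt (fun s h => (hbody _ s lt h).2.2 rfl)
    (fun k s hk h => (hbody k s hk h).2.1)
  have hrun : gatherCmd.run s = iterFor (fun k s => body.run (s.setVar 14 k)) (s.con 11) s₀ := by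
    have : (s.setVar 6 (s.con 0)).var 11 = s.var 11 := by simp [setVar_var]
    rw [hs₀, ← this]; rfl
  rw [hrun]
  exact ⟨s₀, i0, c0, v6, key.1, m, fm, fun x hx y hy => r₁ x hx y hy (hown x hx) (hown y hy), key.2⟩

/-- Enter the merging of two labels of the auxiliary labeling. -/
def mergeBody : Cmd :=
  .seq (fill (.eqE (.arr 6 (.var 5)) (.var 21) (.var 20) (.arr 6 (.var 5)))) insertCmd

/-- Enter all mergings of two labels in labelings in the table. -/
def closureRound : Cmd :=
  .iter 14 11 <| .seq (.assign 16 (.add (.var 7) (.var 14))) <|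
    .cond (.arr 1 (.var 16))
      (.seq (.iter 5 0 (.write 6 (.var 5) (labE 16 5))) (.iter 20 0 (.iter 21 0 mergeBody))) .skip

theorem run_loadAux (s : Env) : ∀ x < s.con 0,
    ((Cmd.iter 5 0 (.write 6 (.var 5) (labE 16 5))).run s).arr 6 x = s.lab (s.var 16) x := by
  have key := iterFor_inv (N := s.con 0) (fun k (s' : Env) => s'.con = s.con ∧
      s'.var 16 = s.var 16 ∧ s'.arr 2 = s.arr 2 ∧ ∀ x < k, s'.arr 6 x = s.lab (s.var 16) x)
    (f := fun k s => (Cmd.write 6 (.var 5) (labE 16 5)).run (s.setVar 5 k)) (s := s)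
    (by simp)
    (by
      rintro k s' hk ⟨h1, h2, h3, h4⟩
      have e := eval_labE (s'.setVar 5 k) (a := 16) (x := 5) (by norm_num)
        (by simpa [setVar_var, h1] using hk)
      have hl : (s'.setVar 5 k).lab = s.lab := funext (lab_congr h1 h3)
      rw [hl] at e
      simp only [Cmd.run, e, Ex.eval, setVar_var, if_true]
      norm_num
      refine ⟨h1, by simpa [setVar_var] using h2, by simpa [setArr_arr] using h3, fun x hx => ?_⟩
      by_cases hxk : x = k
      · simp [setArr_arr, hxk, h2]
      · simp [setArr_arr, hxk, h4 x (by omega)])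
  exact key.2.2.2

/-- The table grows while it is scanned, so the entry at the key of `m` may be replaced meanwhile,
but only by a better one, and any such entry admits a merging that mirrors the given one. The loaded
entry is kept in an auxiliary array because every merging overwrites the current labeling. -/
theorem run_closureRound {s₀ s : Env} (h6 : s₀.var 6 = s₀.con 0)
    (h : Filling s₀ s₀.inst.Full s) {m : ℕ → ℕ} (hcm : s₀.inst.Cap m)
    (hC : s.Cont (s₀.var 7 + s₀.inst.key m) (s₀.inst.miss m))
    (hlt : s₀.inst.key m < s₀.con 11) (i j : ℕ) :
    Filling s₀ s₀.inst.Full (closureRound.run s) ∧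
    (closureRound.run s).Cont (s₀.var 7 + s₀.inst.key m) (s₀.inst.miss m) ∧
    (i < s₀.con 0 → j < s₀.con 0 → i ≠ j → s₀.inst.Cap (Inst.merge m i j) →
      s₀.inst.miss (Inst.merge m i j) = s₀.inst.miss m →
        (closureRound.run s).Cont (s₀.var 7 + s₀.inst.key (Inst.merge m i j))
      (s₀.inst.miss (Inst.merge m i j))) := by
  have hw := twoWeights_inst s₀
  let Z : Env → Prop := fun s' => s'.Cont (s₀.var 7 + s₀.inst.key (Inst.merge m i j))
    (s₀.inst.miss (Inst.merge m i j))
  let Fl : Env → Prop := fun s' => Filling s₀ s₀.inst.Full s' ∧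
    s'.Cont (s₀.var 7 + s₀.inst.key m) (s₀.inst.miss m)
  -- one merging
  have hmerge : ∀ (l : ℕ → ℕ) (i' j' : ℕ) (s' : Env), s₀.inst.Full l → i' < s₀.con 0 → Fl s' →
      (∀ x < s₀.con 0, s'.arr 6 x = l x) → s'.var 20 = i' →
      Fl (mergeBody.run (s'.setVar 21 j')) ∧
      (Z s' → Z (mergeBody.run (s'.setVar 21 j'))) ∧
      (∀ x < s₀.con 0, (mergeBody.run (s'.setVar 21 j')).arr 6 x = l x) ∧
      (mergeBody.run (s'.setVar 21 j')).var 20 = i' ∧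
      (s₀.inst.Cap (Inst.merge l i' j') → (mergeBody.run (s'.setVar 21 j')).Cont
        (s₀.var 7 + s₀.inst.key (Inst.merge l i' j')) (s₀.inst.miss (Inst.merge l i' j'))) := by
    intro l i' j' s' fl hi' hF hA h20
    have hc' : s'.con = s₀.con := hF.1.upd.con
    obtain ⟨s₁, hs₁⟩ : ∃ s₁, s₁ = (fill (.eqE (.arr 6 (.var 5)) (.var 21) (.var 20)
      (.arr 6 (.var 5)))).run (s'.setVar 21 j') := ⟨_, rfl⟩
    have hf := run_fill (s := s'.setVar 21 j') (e := .eqE (.arr 6 (.var 5)) (.var 21) (.var 20)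
      (.arr 6 (.var 5))) (Inst.merge l i' j') (by
        intro k hk s'' _ _ h3 h4 _
        rw [setVar_con, hc'] at hk
        have e6 : s''.arr 6 = s'.arr 6 := h4 6 (by decide)
        simp [Ex.eval, setVar_var, h3 20 (by norm_num), h3 21 (by norm_num), e6,
          hA k hk, h20, Inst.merge])
    rw [← hs₁, setVar_con, hc'] at hf
    have F0 := hF.1.run (.assign 21 (.lit j')) (by simp [Cmd.setsVar]) (by simp [Cmd.setsArr])
      hF.1.mark
    have F1 : Filling s₀ s₀.inst.Full s₁ := by
      rw [hs₁]
      refine F0.run _ (by decide) (by decide) ?_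
      change ((fill _).run (s'.setVar 21 j')).arr 0 _ = _
      rw [← hs₁]
      change s₁.arr 0 (s'.con 0) = s'.con 0
      rw [hc', hf.2 _ le_rfl, setVar_arr, ← hc']
      exact hF.1.mark
    have fm : s₀.inst.Full (Inst.merge l i' j') := by
      intro x hx
      unfold Inst.merge
      split_ifs
      exacts [hi', fl x hx]
    obtain ⟨F2, U2, C2⟩ := F1.insertFull h6 hf.1 fm
    have U1 : Upd (s₀.var 7) (s₀.con 11) s' s₁ := by
      rw [hs₁]
      exact .of_eq (run_con _ _).1 (run_con _ _).2 (run_arr _ rfl _) (run_arr _ rfl _)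
    have hrun : mergeBody.run (s'.setVar 21 j') = insertCmd.run s₁ := by rw [hs₁]; rfl
    have U := U1.trans U2
    rw [hrun]
    refine ⟨⟨F2, U.cont _ _ hF.2⟩, U.cont _ _, fun x hx => ?_, ?_, C2⟩
    · rw [run_arr _ rfl, hs₁, run_arr _ rfl]; exact hA x hx
    · rw [run_var _ rfl, hs₁, run_var _ rfl, setVar_var, if_neg (by norm_num)]; exact h20
  -- all mergings of one entry
  let body : Cmd := .seq (.assign 16 (.add (.var 7) (.var 14))) <|
    .cond (.arr 1 (.var 16))
      (.seq (.iter 5 0 (.write 6 (.var 5) (labE 16 5))) (.iter 20 0 (.iter 21 0 mergeBody))) .skip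
  have hbody : ∀ (k : ℕ) (s' : Env), k < s₀.con 11 → Fl s' →
      Fl (body.run (s'.setVar 14 k)) ∧ (Z s' → Z (body.run (s'.setVar 14 k))) ∧
      (i < s₀.con 0 → j < s₀.con 0 → i ≠ j → s₀.inst.Cap (Inst.merge m i j) →
        s₀.inst.miss (Inst.merge m i j) = s₀.inst.miss m → k = s₀.inst.key m →
        Z (body.run (s'.setVar 14 k))) := by
    intro k s' hk hF
    have hb : (Ex.add (.var 7) (.var 14)).eval (s'.setVar 14 k) = s₀.var 7 + k := by
      simp [Ex.eval, setVar_var, hF.1.var 7 (by simp)]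
    have F1 : Fl ((s'.setVar 14 k).setVar 16 (s₀.var 7 + k)) := by
      have := hF.1.run (.assign 14 (.lit k)) (by simp [Cmd.setsVar]) (by simp [Cmd.setsArr])
        hF.1.mark
      exact ⟨this.run (.assign 16 (.lit (s₀.var 7 + k))) (by simp [Cmd.setsVar])
        (by simp [Cmd.setsArr]) this.mark, hF.2⟩
    have hrun : body.run (s'.setVar 14 k) = (Cmd.cond (.arr 1 (.var 16))
        (.seq (.iter 5 0 (.write 6 (.var 5) (labE 16 5))) (.iter 20 0 (.iter 21 0 mergeBody)))
        .skip).run ((s'.setVar 14 k).setVar 16 (s₀.var 7 + k)) := by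
      simp only [body, Cmd.run, hb]
    rw [hrun]
    have hZ1 : Z s' → Z ((s'.setVar 14 k).setVar 16 (s₀.var 7 + k)) := id
    generalize hs1 : (s'.setVar 14 k).setVar 16 (s₀.var 7 + k) = s₁ at *
    have w16 : s₁.var 16 = s₀.var 7 + k := by rw [← hs1]; simp [setVar_var]
    have hc1 : s₁.con = s₀.con := F1.1.upd.con
    rw [Cmd.run]
    have hcond : (Ex.arr 1 (.var 16)).eval s₁ = s₁.arr 1 (s₀.var 7 + k) := by
      simp only [Ex.eval, w16]
    rw [hcond]
    split_ifs with h0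
    · obtain ⟨x1, x2, x3, x4⟩ := F1.1.sound k (by rwa [hc1]) h0
      rw [inst_eq F1.1.upd.con F1.1.upd.inp] at x1 x2 x3
      obtain ⟨l, hl⟩ : ∃ l, l = s₁.lab (s₀.var 7 + k) := ⟨_, rfl⟩
      rw [← hl] at x1 x2 x3 x4
      have hln : l (s₀.inst.n) = s₀.inst.n := by
        rw [hl, Env.lab, hc1]; exact if_neg (lt_irrefl _)
      have x3' : s₀.inst.key l = k := by
        rw [h6] at x3
        rw [← Inst.rkey_eq_key x4 hln]; exact x3
      obtain ⟨s₂, hs₂⟩ : ∃ s₂, s₂ = (Cmd.iter 5 0 (.write 6 (.var 5) (labE 16 5))).run s₁ :=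
        ⟨_, rfl⟩
      have hA : ∀ x < s₀.con 0, s₂.arr 6 x = l x := by
        intro x hx
        rw [hs₂, hl, ← w16]; exact run_loadAux s₁ x (by rwa [hc1])
      have F2 : Fl s₂ := by
        rw [hs₂]
        refine ⟨F1.1.run _ (by decide) (by decide) ?_, ?_⟩
        · rw [run_arr _ rfl]; exact F1.1.mark
        · unfold Env.Cont
          rw [run_arr _ rfl]; exact F1.2
      have hZ2 : Z s₁ → Z s₂ := by
        simp only [Z, Env.Cont]
        rw [hs₂, run_arr _ rfl]; exact id
      have hc2 : s₂.con = s₀.con := F2.1.upd.con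
      rw [Cmd.run, ← hs₂]
      let J : Env → Prop := fun s' => Fl s' ∧ ∀ x < s₀.con 0, s'.arr 6 x = l x
      have hcon0 : ∀ s', J s' → s'.con = s₀.con := fun s' hs' => hs'.1.1.upd.con
      have hin : ∀ (i' : ℕ) (s' : Env), i' < s₀.con 0 → J s' →
          J ((Cmd.iter 21 0 mergeBody).run (s'.setVar 20 i')) ∧
          (Z s' → Z ((Cmd.iter 21 0 mergeBody).run (s'.setVar 20 i'))) ∧
          (∀ j' < s₀.con 0, (∀ t, Fl t → t.Cont (s₀.var 7 + s₀.inst.key (Inst.merge l i' j'))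
            (s₀.inst.miss (Inst.merge l i' j')) → Z t) → s₀.inst.Cap (Inst.merge l i' j') →
            Z ((Cmd.iter 21 0 mergeBody).run (s'.setVar 20 i'))) := by
        intro i' s' hi' hJ
        have J0 : J (s'.setVar 20 i') :=
          ⟨⟨hJ.1.1.run (.assign 20 (.lit i')) (by simp [Cmd.setsVar]) (by simp [Cmd.setsArr])
            hJ.1.1.mark, hJ.1.2⟩, hJ.2⟩
        have v0 : (s'.setVar 20 i').var 20 = i' := by simp [setVar_var]
        have st : ∀ (k : ℕ) (t : Env), J t ∧ t.var 20 = i' →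
            (J (mergeBody.run (t.setVar 21 k)) ∧ (mergeBody.run (t.setVar 21 k)).var 20 = i') := by
          rintro k t ⟨a, b⟩
          obtain ⟨y1, y2, y3, y4, y5⟩ := hmerge l i' k t x4 hi' a.1 a.2 b
          exact ⟨⟨y1, y3⟩, y4⟩
        rw [Cmd.run, hcon0 _ J0]
        refine ⟨?_, fun hz => ?_, fun j' hj' hz hcap => ?_⟩
        · exact (iterFor_inv (fun _ t => J t ∧ t.var 20 = i') ⟨J0, v0⟩
            fun k t _ ht => st k t ht).1
        · exact (iterFor_inv (fun _ t => (J t ∧ t.var 20 = i') ∧ Z t) ⟨⟨J0, v0⟩, hz⟩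
            fun k t _ ht => ⟨st k t ht.1, (hmerge l i' k t x4 hi' ht.1.1.1 ht.1.1.2 ht.1.2).2.1
              ht.2⟩).2
        · exact (iterFor_hit (fun t => J t ∧ t.var 20 = i') Z (i := j') ⟨J0, v0⟩
            (fun k t _ ht => st k t ht) hj'
            (fun t ht => hz _ (st j' t ht).1.1
              ((hmerge l i' j' t x4 hi' ht.1.1 ht.1.2 ht.2).2.2.2.2 hcap))
            (fun k t _ ht => (hmerge l i' k t x4 hi' ht.1.1 ht.1.2 ht.2).2.1)).2
      have J2 : J s₂ := ⟨F2, hA⟩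
      have hrun2 : (Cmd.iter 20 0 (.iter 21 0 mergeBody)).run s₂ = iterFor (fun k s =>
          (Cmd.iter 21 0 mergeBody).run (s.setVar 20 k)) (s₀.con 0) s₂ := by
        rw [Cmd.run, hc2]
      rw [hrun2]
      refine ⟨?_, fun hz => ?_, ?_⟩
      · exact (iterFor_inv (fun _ t => J t) J2 fun k t hk ht => (hin k t hk ht).1).1
      · exact (iterFor_inv (fun _ t => J t ∧ Z t) ⟨J2, hZ2 (hZ1 hz)⟩
          fun k t hk ht => ⟨(hin k t hk ht.1).1, (hin k t hk ht.1).2.1 ht.2⟩).2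
      · rintro hi hj hij hc he rfl
        -- The labels to be merged depend on the entry `l` found at this key; it is a fixed copy,
        -- even if the table changes during the inner loops.
        obtain ⟨i', hi', j', hj', y1, y2, y3⟩ := Inst.exists_sim_merge hw x2 hcm x3'
          (by have := F1.2.2; omega) (show i < s₀.inst.n from hi) hj hij hc he
        refine (iterFor_hit J Z (i := i') J2 (fun k t hk ht => (hin k t hk ht).1) hi'
          (fun t ht => (hin i' t hi' ht).2.2 j' hj' ?_ y1)
          (fun k t hk ht => (hin k t hk ht).2.1)).2
        intro t _ ht
        rw [y2] at ht
        exact ⟨ht.1, ht.2.trans (by omega)⟩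
    · refine ⟨F1, hZ1, ?_⟩
      rintro - - - - - rfl
      exact absurd F1.2.1 h0
  have hrun : closureRound.run s = iterFor (fun k s => body.run (s.setVar 14 k)) (s₀.con 11) s := by
    rw [← h.upd.con]; rfl
  rw [hrun]
  have inv := iterFor_inv (N := s₀.con 11) (fun _ s => Fl s)
    (f := fun k s => body.run (s.setVar 14 k)) (s := s) ⟨h, hC⟩
    (fun k s hk h => (hbody k s hk h).1)
  exact ⟨inv.1, inv.2, fun hi hj hij hc he => (iterFor_hit Fl Z (i := s₀.inst.key m) ⟨h, hC⟩
    (fun k s hk h => (hbody k s hk h).1) hlt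
    (fun s h => (hbody _ s hlt h).2.2 hi hj hij hc he rfl)
    (fun k s hk h => (hbody k s hk h).2.1)).2⟩

end RAM

/-! ### Assembling the target clusters in n rounds -/

namespace RAM

/-- Enter mergings until no further ones are needed. -/
def closureCmd : Cmd := .iter 22 0 closureRound

/-- As long as `m` is strictly finer than `q`, two labels inside one cluster of `q` can be merged,
and the number of labels in use drops. It is at most n at the start and never 0, so n rounds
suffice. -/
theorem run_closure {s₀ s : Env} (h6 : s₀.var 6 = s₀.con 0)
    (h : Filling s₀ s₀.inst.Full s) {q m : ℕ → ℕ} (hq : s₀.inst.Small q) (hm : s₀.inst.Mid q m)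
    (hC : s.Cont (s₀.var 7 + s₀.inst.key m) (s₀.inst.miss m)) :
    Filling s₀ s₀.inst.Full (closureCmd.run s) ∧
    ∃ m', s₀.inst.Mid q m' ∧ (∀ x < s₀.con 0, ∀ y < s₀.con 0, m' x = m' y ↔ q x = q y) ∧
      (closureCmd.run s).Cont (s₀.var 7 + s₀.inst.key m') (s₀.inst.miss m') := by
  have hw := twoWeights_inst s₀
  have hpos : 0 < s₀.con 0 := by rw [← h.upd.con]; exact h.ok.pos
  have hE : 0 < s₀.con 6 := (Nat.zero_le _).trans_lt (hq 0 hpos)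
  have hlt : ∀ m, s₀.inst.Cap m → s₀.inst.key m < s₀.con 11 := by
    intro m hc
    rw [← h.upd.con, h.ok.c11, h.upd.con]
    exact (Inst.key_lt hw hc).trans_le (Nat.le_mul_of_pos_right _ (Nat.mul_pos hE hE))
  have key := iterFor_inv (N := s₀.con 0) (fun t s' => Filling s₀ s₀.inst.Full s' ∧
      ∃ m, s₀.inst.Mid q m ∧ s'.Cont (s₀.var 7 + s₀.inst.key m) (s₀.inst.miss m) ∧
        (#((range (s₀.con 0)).image m) + t ≤ s₀.con 0 ∨
          ∀ x < s₀.con 0, ∀ y < s₀.con 0, q x = q y → m x = m y))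
    (f := fun k s => closureRound.run (s.setVar 22 k)) (s := s)
    ⟨h, m, hm, hC, Or.inl (card_image_le.trans (card_range _).le)⟩
    (by
      rintro t s' ht ⟨hF, m, hm, hC, hd⟩
      have hF' : Filling s₀ s₀.inst.Full (s'.setVar 22 t) :=
        hF.run (.assign 22 (.lit t)) (by simp [Cmd.setsVar]) (by simp [Cmd.setsArr]) hF.mark
      have hcm := hm.cap hq
      by_cases hall : ∀ x < s₀.con 0, ∀ y < s₀.con 0, q x = q y → m x = m y
      · obtain ⟨a, b, -⟩ := run_closureRound h6 hF' hcm hC (hlt m hcm) 0 0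
        exact ⟨a, m, hm, b, Or.inr hall⟩
      · have hd := hd.resolve_right hall
        push Not at hall
        obtain ⟨x, hx, y, hy, hxy, hne⟩ := hall
        obtain ⟨a, -, b⟩ := run_closureRound h6 hF' hcm hC (hlt m hcm) (m x) (m y)
        have hm' := hm.merge hx hy hxy
        have := Inst.card_image_merge_lt (I := s₀.inst) hx hy hne
        exact ⟨a, _, hm', b (hm.full x hx) (hm.full y hy) hne (hm'.cap hq) (hm'.miss_eq hm),
          Or.inl (by change #(image _ (range (s₀.con 0))) < #(image m (range (s₀.con 0))) at this
                     omega)⟩)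
  have hrun : closureCmd.run s = iterFor (fun k s => closureRound.run (s.setVar 22 k))
      (s₀.con 0) s := by
    rw [← h.upd.con]; rfl
  rw [hrun]
  obtain ⟨a, m', b, c, d⟩ := key
  refine ⟨a, m', b, fun x hx y hy => ⟨b.le x hx y hy, ?_⟩, c⟩
  rcases d with d | d
  · have : 0 < #((range (s₀.con 0)).image m') :=
      card_pos.2 ⟨_, mem_image_of_mem _ (mem_range.2 hpos)⟩
    omega
  · exact d x hx y hy

/-! ### Choosing the best entry -/

/-- The number of heavy vertices with the label in variable `1`. -/
def heavyE : Ex :=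
  .sum 0 0 (.eqE (.arr 0 (.var 0)) (.var 1) (.ite (.inp (.var 0)) (.lit 0) (.lit 1)) (.lit 0))

/-- The number of light vertices with the label in variable `1`. -/
def lightE : Ex :=
  .sum 0 0 (.eqE (.arr 0 (.var 0)) (.var 1) (.ite (.inp (.var 0)) (.lit 1) (.lit 0)) (.lit 0))

/-- The total violation of fairness. -/
def unfairE : Ex := .sum 1 0 <| .add
  (.sub (.sum 4 1 szE) (.sum 4 2 (.add heavyE heavyE)))
  (.sub (.sum 4 1 szE) (.sum 4 2 (.add lightE lightE)))

/-- The number of ordered pairs with equal labels. -/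
def sameE : Ex :=
  .sum 2 0 (.sum 3 0 (.eqE (.arr 0 (.var 2)) (.arr 0 (.var 3)) (.lit 1) (.lit 0)))

/-- The objective value. -/
def valE : Ex := .add sameE (.add missE missE)

/-- For `E = 1` the two kinds of vertices would have the same weight, and the color could not be
read off from it. -/
theorem eval_heavyE {s : Env} (h : s.con 6 ≠ 1) :
    heavyE.eval s = s.inst.heavy (s.arr 0) (s.var 1) := by
  simp only [heavyE, Ex.eval, Inst.heavy, Inst.wsum, setVar_var, eval_eqE, Env.inst, setVar_arr,
    setVar_inp]
  refine sum_congr rfl fun x _ => ?_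
  by_cases hx : s.inp x = 0 <;> simp [hx, h.symm]

theorem eval_lightE {s : Env} (h : s.con 6 ≠ 1) :
    lightE.eval s = s.inst.light (s.arr 0) (s.var 1) := by
  simp only [lightE, Ex.eval, Inst.light, Inst.wsum, setVar_var, eval_eqE, Env.inst, setVar_arr,
    setVar_inp]
  refine sum_congr rfl fun x _ => ?_
  by_cases hx : s.inp x = 0 <;> simp [hx, h.symm]

theorem eval_unfairE {s : Env} (h : s.con 6 ≠ 1) :
    unfairE.eval s = 0 ↔ s.inst.Fair (s.con 1) (s.con 2) (s.arr 0) := by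
  simp only [unfairE, Ex.eval, sum_eq_zero_iff, mem_range, Inst.Fair]
  refine forall₂_congr fun i _ => ?_
  simp only [eval_szE, eval_heavyE (s := (s.setVar 1 i).setVar 4 _) h,
    eval_lightE (s := (s.setVar 1 i).setVar 4 _) h, setVar_con, setVar_arr, inst_setVar, setVar_var]
  simp only [if_true]
  norm_num
  rw [Nat.sub_eq_zero_iff_le, Nat.sub_eq_zero_iff_le]

theorem eval_valE (s : Env) : valE.eval s = s.inst.val (s.arr 0) := by
  simp only [valE, Ex.eval, eval_missE, Inst.val]
  congr 1
  simp [sameE, Ex.eval, Inst.same, setVar_var, Env.inst]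

/-- Consider the entry at variable `16`. -/
def considerCmd : Cmd := .seq (load 16) <| .cond unfairE .skip <|
  .seq (.assign 9 (.add valE (.lit 1))) <|
  .cond (.ite (.var 23) (.sub (.var 23) (.var 9)) (.lit 1))
    (.seq (.assign 23 (.var 9)) (.assign 24 (.var 16))) .skip

/-- Load a fair entry with the least objective value. -/
def bestCmd : Cmd := .seq (.assign 23 (.lit 0)) <| .seq
  (.iter 14 11 <| .seq (.assign 16 (.add (.var 7) (.var 14))) <|
    .cond (.arr 1 (.var 16)) considerCmd .skip) (load 24)

theorem fair_congr {I : Inst} {p q : ℕ} {l l' : ℕ → ℕ} (h : ∀ x < I.n, l x = l' x) :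
    I.Fair p q l ↔ I.Fair p q l' := by
  unfold Inst.Fair Inst.sz Inst.heavy Inst.light
  simp_rw [Inst.wsum_congr h]

theorem val_congr {I : Inst} {l l' : ℕ → ℕ} (h : ∀ x < I.n, l x = l' x) : I.val l = I.val l' := by
  unfold Inst.val
  rw [Inst.miss_congr h, Inst.same_of_ker fun x hx y hy => by rw [h x hx, h y hy]]

theorem run_best {s : Env} (h : s.con 6 ≠ 1) {k₀ : ℕ} (hk₀ : k₀ < s.con 11)
    (h0 : s.arr 1 (s.var 7 + k₀) ≠ 0)
    (hf : s.inst.Fair (s.con 1) (s.con 2) (s.lab (s.var 7 + k₀))) :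
    ∃ k < s.con 11, s.arr 1 (s.var 7 + k) ≠ 0 ∧
      (∀ x < s.con 0, (bestCmd.run s).arr 0 x = s.lab (s.var 7 + k) x) ∧
      s.inst.Fair (s.con 1) (s.con 2) (s.lab (s.var 7 + k)) ∧
      s.inst.val (s.lab (s.var 7 + k)) ≤ s.inst.val (s.lab (s.var 7 + k₀)) := by
  let P : ℕ → Prop := fun k => s.arr 1 (s.var 7 + k) ≠ 0 ∧
    s.inst.Fair (s.con 1) (s.con 2) (s.lab (s.var 7 + k))
  -- Values are shifted by 1, so that 0 in variable 23 can mean that no fair entry has been seen.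
  let V : ℕ → ℕ := fun k => s.inst.val (s.lab (s.var 7 + k)) + 1
  let body : Cmd := .seq (.assign 16 (.add (.var 7) (.var 14))) <|
    .cond (.arr 1 (.var 16)) considerCmd .skip
  let J : ℕ → Env → Prop := fun k s' => s'.con = s.con ∧ s'.inp = s.inp ∧ s'.arr 1 = s.arr 1 ∧
    s'.arr 2 = s.arr 2 ∧ s'.var 7 = s.var 7 ∧
    ((s'.var 23 = 0 ∧ ∀ i < k, ¬ P i) ∨ ∃ j < s.con 11, P j ∧ s'.var 24 = s.var 7 + j ∧
      s'.var 23 = V j ∧ ∀ i < k, P i → V j ≤ V i)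
  have key := iterFor_inv (N := s.con 11) J (f := fun k s => body.run (s.setVar 14 k))
    (s := s.setVar 23 0)
    ⟨rfl, rfl, rfl, rfl, by simp [setVar_var], Or.inl ⟨by simp [setVar_var], by simp⟩⟩
    (by
      rintro k s' hk ⟨c, p, a1, a2, v7, hd⟩
      have frame : (body.run (s'.setVar 14 k)).con = s.con ∧
          (body.run (s'.setVar 14 k)).inp = s.inp ∧ (body.run (s'.setVar 14 k)).arr 1 = s.arr 1 ∧
          (body.run (s'.setVar 14 k)).arr 2 = s.arr 2 ∧
          (body.run (s'.setVar 14 k)).var 7 = s.var 7 := by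
        refine ⟨(run_con _ _).1.trans c, (run_con _ _).2.trans p, (run_arr _ rfl _).trans a1,
          (run_arr _ rfl _).trans a2, ?_⟩
        rw [run_var _ rfl, setVar_var, if_neg (by norm_num), v7]
      refine ⟨frame.1, frame.2.1, frame.2.2.1, frame.2.2.2.1, frame.2.2.2.2, ?_⟩
      have hrun : body.run (s'.setVar 14 k) = (Cmd.cond (.arr 1 (.var 16)) considerCmd .skip).run
          ((s'.setVar 14 k).setVar 16 (s.var 7 + k)) := by
        have : (Ex.add (.var 7) (.var 14)).eval (s'.setVar 14 k) = s.var 7 + k := by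
          simp [Ex.eval, setVar_var, v7]
        simp only [body, Cmd.run, this]
      rw [hrun]
      generalize hs1 : (s'.setVar 14 k).setVar 16 (s.var 7 + k) = s₁
      have w16 : s₁.var 16 = s.var 7 + k := by rw [← hs1]; simp [setVar_var]
      have w23 : s₁.var 23 = s'.var 23 := by rw [← hs1]; simp [setVar_var]
      have w24 : s₁.var 24 = s'.var 24 := by rw [← hs1]; simp [setVar_var]
      have wc : s₁.con = s.con := by rw [← hs1]; exact c
      have wp : s₁.inp = s.inp := by rw [← hs1]; exact p
      have wa1 : s₁.arr 1 = s.arr 1 := by rw [← hs1]; exact a1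
      have wa2 : s₁.arr 2 = s.arr 2 := by rw [← hs1]; exact a2
      rw [← w23, ← w24] at hd
      have hext : ∀ t : Env, t.var 23 = s₁.var 23 → t.var 24 = s₁.var 24 → ¬ P k →
          ((t.var 23 = 0 ∧ ∀ i < k + 1, ¬ P i) ∨ ∃ j < s.con 11, P j ∧ t.var 24 = s.var 7 + j ∧
            t.var 23 = V j ∧ ∀ i < k + 1, P i → V j ≤ V i) := by
        intro t t1 t2 hP
        rw [t1, t2]
        refine hd.imp (fun hd => ⟨hd.1, fun i hi => ?_⟩) fun ⟨j, h1, h2, h3, h4, h5⟩ =>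
          ⟨j, h1, h2, h3, h4, fun i hi hPi => ?_⟩
        · rcases Nat.lt_succ_iff_lt_or_eq.1 hi with hi | rfl
          exacts [hd.2 i hi, hP]
        · rcases Nat.lt_succ_iff_lt_or_eq.1 hi with hi | rfl
          exacts [h5 i hi hPi, absurd hPi hP]
      simp only [Cmd.run, Ex.eval, w16, wa1]
      split_ifs with h1
      swap
      · exact hext _ rfl rfl fun hP => h1 hP.1
      have hld := (run_load (s := s₁) (a := 16) (by norm_num) (by norm_num)).1
      rw [w16, lab_congr wc wa2, wc] at hld
      obtain ⟨s₂, hs₂⟩ : ∃ s₂, s₂ = (load 16).run s₁ := ⟨_, rfl⟩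
      have hsplit : considerCmd.run s₁ = (Cmd.cond unfairE .skip <|
        .seq (.assign 9 (.add valE (.lit 1))) <|
        .cond (.ite (.var 23) (.sub (.var 23) (.var 9)) (.lit 1))
          (.seq (.assign 23 (.var 9)) (.assign 24 (.var 16))) .skip).run s₂ := by
        rw [hs₂]; rfl
      rw [hsplit]
      have x16 : s₂.var 16 = s.var 7 + k := by rw [hs₂, run_var _ rfl, w16]
      have x23 : s₂.var 23 = s₁.var 23 := by rw [hs₂, run_var _ rfl]
      have x24 : s₂.var 24 = s₁.var 24 := by rw [hs₂, run_var _ rfl]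
      have xc : s₂.con = s.con := by rw [hs₂, (run_con _ _).1, wc]
      have xp : s₂.inp = s.inp := by rw [hs₂, (run_con _ _).2, wp]
      rw [← hs₂] at hld
      have hfair : unfairE.eval s₂ = 0 ↔
          s.inst.Fair (s.con 1) (s.con 2) (s.lab (s.var 7 + k)) := by
        rw [eval_unfairE (by rw [xc]; exact h), inst_eq xc xp, xc]
        exact fair_congr (I := s.inst) hld
      have hval : valE.eval s₂ + 1 = V k := by
        rw [eval_valE, inst_eq xc xp, val_congr (I := s.inst) hld]
      by_cases h2 : unfairE.eval s₂ = 0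
      swap
      · rw [Cmd.run, if_pos h2]
        exact hext _ x23 x24 fun hP => h2 (hfair.2 hP.2)
      rw [Cmd.run, if_neg (not_not.2 h2), Cmd.run, Cmd.run]
      simp only [Ex.eval, hval]
      have hPk : P k := ⟨h1, hfair.1 h2⟩
      obtain ⟨s₃, hs₃⟩ : ∃ s₃, s₃ = s₂.setVar 9 (V k) := ⟨_, rfl⟩
      rw [← hs₃]
      have y9 : s₃.var 9 = V k := by rw [hs₃]; simp [setVar_var]
      have y16 : s₃.var 16 = s.var 7 + k := by rw [hs₃]; simp [setVar_var, x16]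
      have y23 : s₃.var 23 = s₁.var 23 := by rw [hs₃]; simp [setVar_var, x23]
      have y24 : s₃.var 24 = s₁.var 24 := by rw [hs₃]; simp [setVar_var, x24]
      rw [← y23, ← y24] at hd
      by_cases h3 : (Ex.ite (.var 23) (.sub (.var 23) (.var 9)) (.lit 1)).eval s₃ = 0
      · rw [Cmd.run, if_neg (not_not.2 h3), Cmd.run]
        simp only [Ex.eval, y9] at h3
        rcases hd with hd | ⟨j, h6, h7, h8, h9, h10⟩
        · simp [hd.1] at h3
        · refine Or.inr ⟨j, h6, h7, h8, h9, fun i hi hPi => ?_⟩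
          rcases Nat.lt_succ_iff_lt_or_eq.1 hi with hi | rfl
          · exact h10 i hi hPi
          · rw [h9] at h3
            have : V j = s.inst.val (s.lab (s.var 7 + j)) + 1 := rfl
            split_ifs at h3
            omega
      · rw [Cmd.run, if_pos h3]
        simp only [Cmd.run, Ex.eval, setVar_var]
        simp only [Ex.eval, y9] at h3
        norm_num [y9, y16]
        refine Or.inr ⟨k, hk, hPk, rfl, rfl, fun i hi hPi => ?_⟩
        rcases Nat.le_iff_lt_or_eq.1 hi with hi | rfl
        · rcases hd with hd | ⟨j, -, -, -, h8, h9⟩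
          · exact absurd hPi (hd.2 i hi)
          · have := h9 i hi hPi
            have : V j = s.inst.val (s.lab (s.var 7 + j)) + 1 := rfl
            split_ifs at h3 <;> omega
        · exact le_rfl)
  obtain ⟨s₃, hs₃⟩ : ∃ s₃, s₃ = iterFor (fun k s => body.run (s.setVar 14 k)) (s.con 11)
    (s.setVar 23 0) := ⟨_, rfl⟩
  have hrun : bestCmd.run s = (load 24).run s₃ := by rw [hs₃]; rfl
  rw [← hs₃] at key
  obtain ⟨c, p, a1, a2, v7, hd⟩ := key
  have hld := (run_load (s := s₃) (a := 24) (by norm_num) (by norm_num)).1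
  rw [lab_congr c a2, c] at hld
  rcases hd with hd | ⟨j, h6, h7, h8, h9, h10⟩
  · exact absurd ⟨h0, hf⟩ (hd.2 k₀ hk₀)
  · rw [hrun]
    rw [h8] at hld
    exact ⟨j, h6, h7.1, hld, h7.2, Nat.le_of_succ_le_succ (h10 k₀ hk₀ ⟨h0, hf⟩)⟩

/-- The connected components of the clusters of `q`. -/
theorem exists_components {I : Inst}
    (hsym : ∀ x < I.n, ∀ y < I.n, I.adj x y ≠ 0 → I.adj y x ≠ 0) (q : ℕ → ℕ) :
    ∃ r : ℕ → ℕ, I.Conn r ∧ (∀ x y, r x = r y → q x = q y) ∧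
      ∀ x < I.n, ∀ y < I.n, I.adj x y ≠ 0 → q x = q y → r x = r y := by
  let R : ℕ → ℕ → Prop := fun a b => a < I.n ∧ b < I.n ∧ I.adj a b ≠ 0 ∧ q a = q b
  have hs : ∀ x y, Relation.ReflTransGen R x y → Relation.ReflTransGen R y x := by
    intro x y h
    induction h with
    | refl => exact .refl
    | tail _ h ih =>
      exact .head ⟨h.2.1, h.1, hsym _ h.1 _ h.2.1 h.2.2.1, h.2.2.2.symm⟩ ih
  -- Each component is represented by the least vertex reachable inside the cluster.
  let r : ℕ → ℕ := fun x => sInf {y | Relation.ReflTransGen R x y}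
  have hr : ∀ x y, r x = r y ↔ Relation.ReflTransGen R x y := by
    intro x y
    constructor
    · intro h
      have h1 : Relation.ReflTransGen R x (r x) :=
        Nat.sInf_mem (s := {y | Relation.ReflTransGen R x y}) ⟨x, .refl⟩
      have h2 : Relation.ReflTransGen R y (r y) :=
        Nat.sInf_mem (s := {z | Relation.ReflTransGen R y z}) ⟨y, .refl⟩
      rw [← h] at h2
      exact h1.trans (hs _ _ h2)
    · intro h
      refine congrArg sInf (Set.ext fun z => ⟨fun hz => (hs _ _ h).trans hz, fun hz => h.trans hz⟩)
  refine ⟨r, fun x _ y _ h => ?_, fun x y h => ?_, fun x hx y hy ha hq => (hr x y).2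
    (.single ⟨hx, hy, ha, hq⟩)⟩
  · exact Relation.ReflTransGen.mono (fun a b hab =>
      ⟨hab.1, hab.2.1, hab.2.2.1, (hr a b).2 (.single hab)⟩) x y ((hr x y).1 h)
  · replace h := (hr x y).1 h
    induction h with
    | refl => rfl
    | tail _ h ih => exact ih.trans h.2.2.2

/-- The algorithm, after the constants and the table of powers have been computed. -/
def mainCmd : Cmd := .seq initCmd (.seq elimCmd (.seq gatherCmd (.seq closureCmd bestCmd)))

/-- The algorithm computes a fair labeling that is at least as good as any given fair labeling with
clusters of fewer than `E` vertices. -/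
theorem run_main {s : Env} (hok : s.Ok) (h1 : ∀ a, s.arr 1 a = 0) (h4 : ∀ x, s.arr 4 x = 0)
    (hsym : ∀ x < s.inst.n, ∀ y < s.inst.n, s.inst.adj x y ≠ 0 → s.inst.adj y x ≠ 0)
    (hleaf : ∀ R ⊆ range s.inst.n, R.Nonempty → ∃ x ∈ R, #{y ∈ R | s.inst.adj x y ≠ 0} ≤ 1)
    (h6 : s.con 6 ≠ 1) {q : ℕ → ℕ} (hsmall : s.inst.Small q)
    (hfair : s.inst.Fair (s.con 1) (s.con 2) q) (hfull : s.inst.Full q) :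
    s.inst.Full ((mainCmd.run s).arr 0) ∧
    s.inst.Fair (s.con 1) (s.con 2) ((mainCmd.run s).arr 0) ∧
    s.inst.val ((mainCmd.run s).arr 0) ≤ s.inst.val q := by
  -- The invariant of the elimination needs a target with connected clusters, so it is run against
  -- the components of `q`; the closure then leads back from these to `q`.
  obtain ⟨r, hconn, hle, hedge⟩ := exists_components hsym q
  have hrsmall : s.inst.Small r := fun x hx => (card_le_card fun y hy => by
    simp only [mem_filter] at hy ⊢
    exact ⟨hy.1, hle _ _ hy.2⟩).trans_lt (hsmall x hx)
  have e0 := run_init hok h1 h4 hrsmall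
  obtain ⟨s₁, hs₁⟩ : ∃ s₁, s₁ = initCmd.run s := ⟨_, rfl⟩
  have c1 : s₁.con = s.con := by rw [hs₁]; exact (run_con _ _).1
  have i1 : s₁.inst = s.inst := by rw [hs₁]; exact inst_run _ _
  rw [← hs₁] at e0
  obtain ⟨own, z, e1, hz, hz0, hown⟩ := run_elim e0 (by rwa [i1]) (by rwa [i1]) (by rwa [i1])
    (by rwa [i1])
  obtain ⟨s₂, hs₂⟩ : ∃ s₂, s₂ = elimCmd.run s₁ := ⟨_, rfl⟩
  have c2 : s₂.con = s.con := by rw [hs₂]; exact (run_con _ _).1.trans c1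
  have i2 : s₂.inst = s.inst := by rw [hs₂]; exact (inst_run _ _).trans i1
  rw [← hs₂] at e1 hz
  rw [c1] at hz0 hown
  obtain ⟨s₀, i0, c0, v6, hF, m, fm, hm, hC⟩ := run_gather e1 hz (by rwa [c2]) (by rwa [c2])
    (by rwa [i2])
  obtain ⟨s₃, hs₃⟩ : ∃ s₃, s₃ = gatherCmd.run s₂ := ⟨_, rfl⟩
  rw [← hs₃] at hF hC
  rw [c2] at hm c0
  rw [i2] at i0 fm hC
  have hmid : s.inst.Mid q m := ⟨fm, fun x hx y hy h => hle _ _ ((hm x hx y hy).1 h),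
    fun x hx y hy ha h => (hm x hx y hy).2 (hedge x hx y hy ha h)⟩
  obtain ⟨hF', m', hmid', hm', hC'⟩ := run_closure v6 hF (q := q) (m := m) (by rwa [i0])
    (by rwa [i0]) (by rwa [i0])
  obtain ⟨s₄, hs₄⟩ : ∃ s₄, s₄ = closureCmd.run s₃ := ⟨_, rfl⟩
  rw [← hs₄] at hF' hC'
  rw [i0] at hmid' hC'
  rw [c0] at hm'
  have hw := twoWeights_inst s
  have hcm' := hmid'.cap hsmall
  have c4 : s₄.con = s.con := hF'.upd.con.trans c0
  have i4 : s₄.inst = s.inst := (inst_eq hF'.upd.con hF'.upd.inp).trans i0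
  have v7 : s₄.var 7 = s₀.var 7 := hF'.var 7 (by simp)
  have sound := hF'.sound
  unfold Env.Sound at sound
  rw [v6, c4, c0, i0, i4] at sound
  rw [← v7] at sound hC'
  have hmark : ∀ k, s₄.lab k s.inst.n = s.inst.n := by
    intro k
    rw [Env.lab, c4]
    exact if_neg (lt_irrefl _)
  have hE : 0 < s.con 6 := (Nat.zero_le _).trans_lt (hsmall 0 hok.pos)
  have hlt : s.inst.key m' < s.con 11 := by
    rw [hok.c11]
    exact (Inst.key_lt hw hcm').trans_le (Nat.le_mul_of_pos_right _ (Nat.mul_pos hE hE))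
  obtain ⟨a1, a2, a3, a4⟩ := sound _ hlt hC'.1
  have a3' := (Inst.rkey_eq_key a4 (hmark _)).symm.trans a3
  have hf1 : s.inst.Fair (s.con 1) (s.con 2) (s₄.lab (s₄.var 7 + s.inst.key m')) :=
    .of_key hw a2 hcm' a3' (hfair.of_ker (fun x hx y hy => hm' x hx y hy) hfull)
  obtain ⟨k, hk, b1, b2, b3, b4⟩ := run_best (s := s₄) (by rwa [c4]) (k₀ := s.inst.key m')
    (by rwa [c4]) hC'.1 (by rwa [c4, i4])
  rw [c4, i4] at b3
  rw [i4] at b4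
  rw [c4] at hk b2
  have hrun : mainCmd.run s = bestCmd.run s₄ := by rw [hs₄, hs₃, hs₂, hs₁]; rfl
  rw [hrun]
  refine ⟨fun x hx => ?_, (fair_congr (I := s.inst) b2).2 b3, ?_⟩
  · rw [b2 x hx]
    exact (sound k hk b1).2.2.2 x hx
  · rw [val_congr (I := s.inst) b2]
    refine b4.trans ?_
    have hq : s.inst.Mid q q := ⟨hfull, fun _ _ _ _ h => h, fun _ _ _ _ _ h => h⟩
    -- The entry at the key of `m'` has as many pairs with equal labels as `m'`, hence as `q`, and
    -- misses at most as many pairs.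
    have e1 := Inst.same_eq_of_key hw a2 hcm' a4 hmid'.full a3'
    have e2 := Inst.same_of_ker (I := s.inst) (l := m') (m := q) fun x hx y hy => hm' x hx y hy
    have e3 := hmid'.miss_eq hq
    have := hC'.2
    unfold Inst.val
    omega

end RAM

namespace RAM

/-! ### The complete program -/

/-- Compute a constant. -/
def setConst (c : ℕ) (e : Ex) : Program :=
  .seq (e.compile 0) (.assign (cReg c) (.reg (sReg 0)))

/-- The size of clusters that can be split, computed from the numerator and denominator of `α`. -/
def baseSize (p q : ℕ) : ℕ := if p - (p / 2 + p / 2) ≠ 0 then q + q else q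

/-- The size of clusters that can be split, at least five. -/
def splitSize (p q : ℕ) : ℕ := if baseSize p q - 4 ≠ 0 then baseSize p q
  else baseSize p q + baseSize p q

/-- A bound on the sizes of clusters, also limited by the number of vertices. -/
def capSize (n p q : ℕ) : ℕ := n + 1 - (n + 1 - (splitSize p q + splitSize p q))

/-- The values of the constants. -/
def constVal (n p q : ℕ) : ℕ → ℕ
  | 0 => n
  | 1 => p
  | 2 => q
  | 3 => n + n * n
  | 4 => baseSize p q
  | 5 => splitSize p q
  | 6 => capSize n p q
  | 7 => n + 1
  | 8 => capSize n p q * capSize n p q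
  | 9 => n - 1
  | 10 => (n + 1) ^ (capSize n p q * capSize n p q)
  | 11 => (n + 1) ^ (capSize n p q * capSize n p q) * (capSize n p q * capSize n p q)
  | _ => 0

/-- Compute the table of powers. -/
def powCmd : Cmd := .seq (.write 5 (.lit 0) (.lit 1))
  (.iter 1 8 (.write 5 (.add (.var 1) (.lit 1)) (.sum 0 7 (.arr 5 (.var 1)))))

/-- Copy the computed labeling to the output. -/
def copyOut : Program :=
  .seq (.assign (sReg 0) (.lit 0)) <| .loop (.sub (.reg (cReg 0)) (.reg (sReg 0))) <|
    .seq (.write (.reg (sReg 0)) (.read (addrOf 0 (.reg (sReg 0)))))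
      (.assign (sReg 0) (.add (.reg (sReg 0)) (.lit 1)))

/-- The expressions for the constants after the first three. -/
def constEx : ℕ → Ex
  | 3 => .add (.con 0) (.sum 0 0 (.con 0))
  | 4 => .ite (.sub (.con 1) (.add (.half (.con 1)) (.half (.con 1)))) (.add (.con 2) (.con 2))
    (.con 2)
  | 5 => .ite (.sub (.con 4) (.lit 4)) (.con 4) (.add (.con 4) (.con 4))
  | 6 => .sub (.add (.con 0) (.lit 1))
    (.sub (.add (.con 0) (.lit 1)) (.add (.con 5) (.con 5)))
  | 7 => .add (.con 0) (.lit 1)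
  | 8 => .sum 0 6 (.con 6)
  | 9 => .sub (.con 0) (.lit 1)
  | 10 => .arr 5 (.con 8)
  | 11 => .sum 0 8 (.con 10)
  | _ => .lit 0

/-- The algorithm. -/
def program : Program :=
  .seq (.assign (cReg 1) (.reg 1)) <| .seq (.assign (cReg 2) (.reg 2)) <|
  .seq (setConst 3 (constEx 3)) <| .seq (setConst 4 (constEx 4)) <|
  .seq (setConst 5 (constEx 5)) <| .seq (setConst 6 (constEx 6)) <|
  .seq (setConst 7 (constEx 7)) <| .seq (setConst 8 (constEx 8)) <|
  .seq (setConst 9 (constEx 9)) <| .seq (powCmd.compile 0) <|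
  .seq (setConst 10 (constEx 10)) <| .seq (setConst 11 (constEx 11)) <|
  .seq (mainCmd.compile 0) copyOut

/-- The first `k` constants are set, and the input and the arrays are as given. -/
def Stage (n p q : ℕ) (f : ℕ → ℕ) (A : Fin 8 → ℕ → ℕ) (k : ℕ) (s : State) : Prop :=
  (∀ c, s.abs.con c = if c < k then constVal n p q c else 0) ∧ s.abs.inp = f ∧ s.abs.arr = A

theorem runs_setConst (c : ℕ) (e : Ex) (s : State) :
    Runs (setConst c e) s (fun s' => s'.mem = s.mem ∧ s'.reg (cReg c) = e.eval s.abs ∧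
      ∀ c', c' ≠ c → s'.reg (cReg c') = s.reg (cReg c')) (e.cost s.abs.con + 2) := by
  refine (e.runs_compile 0 s).seq fun s' h => Runs.assign ⟨h.1.1, ?_, fun c' hc => ?_⟩
  · simp [Expr.eval, h.2]
  · rw [setReg_reg_of_ne _ _ (by simpa using hc)]
    exact h.1.2 _ (Or.inl (by unfold cReg; omega))

theorem Stage.setConst {n p q : ℕ} {f : ℕ → ℕ} {A : Fin 8 → ℕ → ℕ} {k : ℕ} {s : State}
    (h : Stage n p q f A k s) (hk : 3 < k) (e : Ex) (he : e.eval s.abs = constVal n p q k) :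
    Runs (setConst k e) s (Stage n p q f A (k + 1)) (e.cost s.abs.con + 2) := by
  refine (runs_setConst k e s).mono le_rfl fun s' ⟨h1, h2, h3⟩ => ?_
  obtain ⟨a, b, c⟩ := h
  have e3 : s'.reg (cReg 3) = s.reg (cReg 3) := h3 3 (by omega)
  refine ⟨fun c' => ?_, ?_, ?_⟩
  · by_cases hc : c' = k
    · rw [abs_con, hc, h2, he, if_pos (by omega)]
    · rw [abs_con, h3 c' hc]
      have := a c'
      rw [abs_con] at this
      rw [this]
      split_ifs <;> first | rfl | omega
  · rw [← b]; simp only [State.abs, h1, e3]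
  · rw [← c]; simp only [State.abs, h1, e3]

/-- A bound for all small constants. -/
def smallBound (n p q : ℕ) : ℕ := (n + 1) ^ 2 * (2 * splitSize p q)

theorem splitSize_bounds {p q : ℕ} (hq : 0 < q) :
    q ≤ baseSize p q ∧ baseSize p q ≤ splitSize p q := by
  unfold splitSize baseSize
  split_ifs <;> omega

theorem capSize_bounds {n p q : ℕ} (hq : 0 < q) :
    0 < capSize n p q ∧ capSize n p q ≤ n + 1 ∧ capSize n p q ≤ 2 * splitSize p q := by
  have := splitSize_bounds (p := p) hq
  unfold capSize
  omega

theorem constVal_le {n p q : ℕ} (hpq : p < q) (c : ℕ) :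
    constVal n p q c ≤ mono (smallBound n p q) (constVal n p q 11)
      (if isBig c then (0, 1) else (1, 0)) := by
  have hq : 0 < q := by omega
  obtain ⟨h1, h2⟩ := splitSize_bounds (p := p) hq
  obtain ⟨h3, h4, h5⟩ := capSize_bounds (n := n) (p := p) hq
  have hM : 0 < 2 * splitSize p q := by omega
  have a1 : ∀ x, x ≤ 2 * splitSize p q → x ≤ smallBound n p q := fun x hx =>
    hx.trans (Nat.le_mul_of_pos_left _ (by positivity))
  have a2 : ∀ x, x ≤ (n + 1) ^ 2 → x ≤ smallBound n p q := fun x hx =>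
    hx.trans (Nat.le_mul_of_pos_right _ hM)
  have s1 : ∀ N, mono (smallBound n p q) N (1, 0) = smallBound n p q := by simp [mono]
  have s2 : ∀ N, mono (smallBound n p q) N (0, 1) = N := by simp [mono]
  by_cases hc : 12 ≤ c
  · obtain ⟨c, rfl⟩ := Nat.exists_eq_add_of_le hc
    rw [Nat.add_comm]
    exact Nat.zero_le _
  interval_cases c <;> simp only [isBig, constVal] <;> norm_num [s1, s2]
  · exact a2 _ (by nlinarith)
  · exact a1 _ (by omega)
  · exact a1 _ (by omega)
  · exact a2 _ (by nlinarith)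
  · exact a1 _ (by omega)
  · exact a1 _ (by omega)
  · exact a1 _ (by omega)
  · exact a2 _ (by nlinarith)
  · exact a2 _ (by nlinarith)
  · exact (a2 n (by nlinarith)).trans (Nat.le_succ _)
  · exact h3

theorem one_le_bounds {n p q : ℕ} (hpq : p < q) :
    1 ≤ smallBound n p q ∧ 1 ≤ constVal n p q 11 := by
  have hq : 0 < q := by omega
  obtain ⟨h1, h2⟩ := splitSize_bounds (p := p) hq
  obtain ⟨h3, -, -⟩ := capSize_bounds (n := n) (p := p) hq
  exact ⟨Nat.mul_pos (by positivity) (by omega), Nat.mul_pos (by positivity) (Nat.mul_pos h3 h3)⟩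

theorem Stage.cost_le {n p q : ℕ} (hpq : p < q) {f : ℕ → ℕ} {A : Fin 8 → ℕ → ℕ} {k : ℕ} {s : State}
    (h : Stage n p q f A k s) (c : ℕ) :
    s.abs.con c ≤ mono (smallBound n p q) (constVal n p q 11)
      (if isBig c then (0, 1) else (1, 0)) := by
  rw [h.1]
  by_cases hc : c < k
  · rw [if_pos hc]; exact constVal_le hpq c
  · rw [if_neg hc]; exact Nat.zero_le _

/-- Each power is the sum of n + 1 copies of the preceding one. -/
theorem run_pow {s : Env} {n N : ℕ} (h7 : s.con 7 = n + 1) (h8 : s.con 8 = N) :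
    (∀ t ≤ N, (powCmd.run s).arr 5 t = (n + 1) ^ t) := by
  have key := iterFor_inv (N := s.con 8) (fun k (s' : Env) => s'.con = s.con ∧
      ∀ t ≤ k, s'.arr 5 t = (n + 1) ^ t)
    (f := fun k s => (Cmd.write 5 (.add (.var 1) (.lit 1)) (.sum 0 7 (.arr 5 (.var 1)))).run
      (s.setVar 1 k)) (s := s.setArr 5 0 1)
    (by simp [setArr_arr])
    (by
      rintro k s' hk ⟨h1, h2⟩
      refine ⟨h1, fun t ht => ?_⟩
      simp only [Cmd.run, Ex.eval, setVar_var, setArr_arr, setVar_arr, setVar_con, h1, h7]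
      norm_num [h2 k le_rfl]
      by_cases htk : t = k + 1
      · simp [htk, pow_succ, mul_comm]
      · simp [htk, h2 t (by omega)])
  rw [h8] at key
  have hrun : powCmd.run s = iterFor (fun k s =>
      (Cmd.write 5 (.add (.var 1) (.lit 1)) (.sum 0 7 (.arr 5 (.var 1)))).run (s.setVar 1 k))
      N (s.setArr 5 0 1) := by rw [← h8]; rfl
  rw [hrun]
  exact key.2

/-- The output goes to cells below n, while the arrays begin behind the input, so copying does not
destroy what is still to be copied. -/
theorem runs_copyOut {s : State} {n : ℕ} (hn : s.abs.con 0 = n) (hS : n ≤ s.abs.con 3) :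
    Runs copyOut s (fun s' => ∀ x < n, s'.mem x = s.abs.arr 0 x) (n * 40 + 10) := by
  rw [abs_con] at hn hS
  refine (Runs.assign_seq (Runs.loop (N := n) (T := 35) (fun k s' => s'.reg (sReg 0) = k ∧
    (∀ c, s'.reg (cReg c) = s.reg (cReg c)) ∧ (∀ a, n ≤ a → s'.mem a = s.mem a) ∧
    ∀ x < k, s'.mem x = s.abs.arr 0 x) ?_ ?_ ?_)).mono ?_ ?_
  · rintro k s' ⟨h1, h2, -⟩
    simp [Expr.eval, h1, h2, hn]
  · rintro k s' hk ⟨h1, h2, h3, h4⟩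
    obtain ⟨x, hx⟩ : ∃ x, x = s'.mem ((addrOf 0 (.reg (sReg 0))).eval s') := ⟨_, rfl⟩
    have hx' : x = s.abs.arr 0 k := by
      rw [hx, addrOf_eval]
      simp only [Expr.eval, h1, h2]
      rw [h3 _ (by omega)]
      rfl
    refine ⟨_, _, .seq (.write s' _ _) (.assign _ _ _), ?_, ?_, fun c => ?_, fun a ha => ?_,
      fun y hy => ?_⟩
    · simp [Expr.cost, addrOf]
    · simp [Expr.eval, h1]
    · simp [h2]
    · simp [Expr.eval, h1, Function.update_of_ne (show a ≠ k by omega), h3 a ha]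
    · by_cases hyk : y = k
      · subst hyk
        simp only [Expr.eval, h1, Function.update_self, ← hx', hx]
      · simp [Expr.eval, h1, Function.update_of_ne hyk, h4 y (by omega)]
  · exact ⟨by simp [Expr.eval], fun c => setReg_reg_of_ne _ _ (by simp), fun a _ => rfl, by simp⟩
  · simp only [Expr.cost]; omega
  · exact fun s' h => h.2.2.2

/-- Keeps account of the steps in multiples of a single unit `B`, so that the final constant is
obtained by subtracting numerals. -/
theorem Runs.seq_budget {p₁ p₂ : Program} {s : State} {Q R : State → Prop} {B m : ℕ} (a : ℕ)
    (h₁ : Runs p₁ s R (a * B)) (ha : a ≤ m) (h₂ : ∀ s', R s' → Runs p₂ s' Q ((m - a) * B)) :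
    Runs (.seq p₁ p₂) s Q (m * B) :=
  (Runs.seq h₁ h₂).mono (by rw [← add_mul, Nat.add_sub_cancel' ha]) fun _ h => h

/-- The program halts within the stated time, and its output is the labeling that the algorithm
computes from an input with the given constants. -/
theorem runs_program {s : State} {n p q : ℕ} (hpq : p < q)
    (h : ∀ r, s.reg r = if r = 0 then n else if r = 1 then p else if r = 2 then q else 0)
    (hmem : ∀ a, n + n * n ≤ a → s.mem a = 0) :
    Runs program s (fun s' => ∃ e : Env, e.con = constVal n p q ∧ e.inp = s.mem ∧
      (∀ a, e.arr 1 a = 0) ∧ (∀ a, e.arr 4 a = 0) ∧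
      (∀ t ≤ capSize n p q * capSize n p q, e.arr 5 t = (n + 1) ^ t) ∧
      ∀ x < n, s'.mem x = (mainCmd.run e).arr 0 x)
      (20000 * mono (smallBound n p q) (constVal n p q 11) (6, 2)) := by
  obtain ⟨b1, b2⟩ := one_le_bounds (n := n) hpq
  have hone := one_le_mono b1 b2 (6, 2)
  have hcost : ∀ (e : Ex) {f A k s'}, Stage n p q f A k s' → e.deg ≤ (6, 2) →
      e.cost s'.abs.con + 2 ≤
        (e.size + 2) * mono (smallBound n p q) (constVal n p q 11) (6, 2) := by
    intro e f A k s' hs hd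
    have h1 := Ex.cost_le b1 b2 (hs.cost_le hpq) e
    have h2 := Nat.mul_le_mul_left e.size (mono_le b1 b2 hd)
    rw [add_mul]
    omega
  have hcost' : ∀ (e : Cmd) {f A k s'}, Stage n p q f A k s' → e.deg ≤ (6, 2) →
      e.cost s'.abs.con ≤ e.size * mono (smallBound n p q) (constVal n p q 11) (6, 2) := by
    intro e f A k s' hs hd
    exact (Cmd.cost_le b1 b2 (hs.cost_le hpq) e).trans
      (Nat.mul_le_mul_left e.size (mono_le b1 b2 hd))
  -- The nesting depth is read off from the syntax: at most six loops over small ranges and two over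
  -- tables.
  have hpow : powCmd.deg ≤ (6, 2) := by decide
  have hmain : mainCmd.deg ≤ (6, 2) := by decide
  have hset : ∀ {A k s'}, Stage n p q s.mem A k s' → 3 < k →
      (constEx k).deg ≤ (6, 2) → (constEx k).size ≤ 100 → (constEx k).eval s'.abs = constVal n p q k →
      Runs (setConst k (constEx k)) s' (Stage n p q s.mem A (k + 1))
        (102 * mono (smallBound n p q) (constVal n p q 11) (6, 2)) :=
    fun hs hk hd hz he => (hs.setConst hk _ he).mono
      ((hcost _ hs hd).trans (Nat.mul_le_mul_right _ (by omega))) fun _ h => h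
  have hnB : n ≤ mono (smallBound n p q) (constVal n p q 11) (6, 2) := by
    have := constVal_le (n := n) hpq 0
    exact this.trans (mono_le b1 b2 (by decide))
  -- the first constants
  let s₂ := (s.setReg (cReg 1) p).setReg (cReg 2) q
  -- Registers 1 and 2 double as variable 0 and scratch register 0. Numerator and denominator are
  -- therefore moved to registers 3 and 6, those of constants 1 and 2, before anything else runs.
  have r₂ : ∀ r, s₂.reg r = if r = 6 then q else if r = 3 then p else s.reg r := by
    intro r
    simp [s₂, State.setReg, Function.update_apply, cReg]
  have c₂ : ∀ c, s₂.abs.con c = if c < 3 then constVal n p q c else 0 := by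
    intro c
    rw [abs_con, r₂, h, cReg]
    rcases lt_or_ge c 3 with hc | hc
    · interval_cases c <;> simp [constVal]
    · rw [if_neg (by omega), if_neg (by omega), if_neg (by omega), if_neg (by omega),
        if_neg (by omega), if_neg (by omega)]
  have e₃ : (constEx 3).eval s₂.abs = n + n * n := by
    simp only [constEx, Ex.eval, c₂, setVar_con]
    simp [constVal]
  have k₃ : (constEx 3).cost s₂.abs.con ≤
      (constEx 3).size * mono (smallBound n p q) (constVal n p q 11) (6, 2) := by
    refine (Ex.cost_le b1 b2 (fun c => ?_) _).trans
      (Nat.mul_le_mul_left _ (mono_le b1 b2 (by decide)))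
    rw [c₂]
    by_cases hc : c < 3
    · rw [if_pos hc]; exact constVal_le hpq c
    · rw [if_neg hc]; exact Nat.zero_le _
  have stage₄ : ∀ s', (s'.mem = s₂.mem ∧ s'.reg (cReg 3) = (constEx 3).eval s₂.abs ∧
      ∀ c', c' ≠ 3 → s'.reg (cReg c') = s₂.reg (cReg c')) →
      Stage n p q s.mem (fun _ _ => 0) 4 s' := by
    rintro s' ⟨a1, a2, a3⟩
    rw [e₃] at a2
    refine ⟨fun c => ?_, ?_, ?_⟩
    · rw [abs_con]
      by_cases hc : c = 3
      · rw [hc, a2]; rfl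
      · rw [a3 c hc, ← abs_con, c₂]
        split_ifs <;> first | rfl | omega
    · funext a
      simp only [State.abs, a1, a2]
      split_ifs with ha
      · rfl
      · exact (hmem a (by omega)).symm
    · funext k i
      simp only [State.abs, a1, a2]
      exact hmem _ (by omega)
  generalize mono (smallBound n p q) (constVal n p q 11) (6, 2) = B at *
  have z3 : (constEx 3).size ≤ 100 := by decide
  refine Runs.seq_budget 2 (Runs.mono (Runs.assign (Q := fun t => t = s.setReg (cReg 1) p) (by
      simp [Expr.eval, h])) (by simp only [Expr.cost]; omega) fun _ h => h)
    (by norm_num) ?_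
  rintro _ rfl
  refine Runs.seq_budget 2 (Runs.mono (Runs.assign (Q := fun t => t = s₂) (by
      simp [Expr.eval, s₂, setReg_reg_of_ne, cReg, h])) (by simp only [Expr.cost]; omega)
        fun _ h => h)
    (by norm_num) ?_
  rintro _ rfl
  refine Runs.seq_budget 102 ((runs_setConst 3 (constEx 3) s₂).mono
    ((Nat.add_le_add_right k₃ 2).trans ?_) stage₄) (by norm_num) fun t h4 => ?_
  · nlinarith
  refine Runs.seq_budget 102 (hset h4 (by norm_num) (by decide) (by decide) ?_) (by norm_num)
    fun t h5 => ?_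
  · simp only [constEx, Ex.eval, h4.1]; norm_num [constVal, baseSize]
  refine Runs.seq_budget 102 (hset h5 (by norm_num) (by decide) (by decide) ?_) (by norm_num)
    fun t h6 => ?_
  · simp only [constEx, Ex.eval, h5.1]; norm_num [constVal, splitSize]
  refine Runs.seq_budget 102 (hset h6 (by norm_num) (by decide) (by decide) ?_) (by norm_num)
    fun t h7 => ?_
  · simp only [constEx, Ex.eval, h6.1]; norm_num [constVal, capSize]
  refine Runs.seq_budget 102 (hset h7 (by norm_num) (by decide) (by decide) ?_) (by norm_num)
    fun t h8 => ?_
  · simp only [constEx, Ex.eval, h7.1]; norm_num [constVal]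
  refine Runs.seq_budget 102 (hset h8 (by norm_num) (by decide) (by decide) ?_) (by norm_num)
    fun t h9 => ?_
  · simp only [constEx, Ex.eval, h8.1, setVar_con]; norm_num [constVal]
  refine Runs.seq_budget 102 (hset h9 (by norm_num) (by decide) (by decide) ?_) (by norm_num)
    fun t h10 => ?_
  · simp only [constEx, Ex.eval, h9.1]; norm_num [constVal]
  refine Runs.seq_budget powCmd.size ((powCmd.runs_compile 0 t).mono (hcost' powCmd h10 hpow)
    fun t' ht' => show Stage n p q s.mem (powCmd.run t.abs).arr 10 t' from ?_)
    (by decide) fun t' h10' => ?_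
  · obtain ⟨a, b⟩ := run_con powCmd t.abs
    unfold Stage
    rw [ht'.1, a, b]
    exact ⟨h10.1, h10.2.1, rfl⟩
  have hA1 : (powCmd.run t.abs).arr 1 = fun _ => 0 := by rw [run_arr powCmd rfl, h10.2.2]
  have hA4 : (powCmd.run t.abs).arr 4 = fun _ => 0 := by rw [run_arr powCmd rfl, h10.2.2]
  have hA5 := run_pow (s := t.abs) (n := n) (by rw [h10.1]; rfl) (h10.1 8)
  rw [if_pos (by norm_num)] at hA5
  generalize (powCmd.run t.abs).arr = A at *
  refine Runs.seq_budget 102 (hset h10' (by norm_num) (by decide) (by decide) ?_) (by decide)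
    fun t h11 => ?_
  · simp only [constEx, Ex.eval, h10'.1, h10'.2.2]; norm_num
    rw [hA5 _ le_rfl]; rfl
  refine Runs.seq_budget 102 (hset h11 (by norm_num) (by decide) (by decide) ?_) (by decide)
    fun t h12 => ?_
  · simp only [constEx, Ex.eval, h11.1, setVar_con]; norm_num [constVal]
    rw [mul_comm]
  have hcon : t.abs.con = constVal n p q := by
    funext c
    rw [h12.1]
    split_ifs with hc
    · rfl
    · obtain ⟨c, rfl⟩ := Nat.exists_eq_add_of_le (not_lt.1 hc)
      rw [Nat.add_comm]
      rfl
  refine Runs.seq_budget mainCmd.size ((mainCmd.runs_compile 0 t).mono (hcost' mainCmd h12 hmain)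
    fun t' ht' => ht'.1) (by decide) fun t' ht' => ?_
  have hc' := (run_con mainCmd t.abs).1
  rw [hcon] at hc'
  refine (runs_copyOut (n := n) (by rw [ht', hc']; rfl)
    (by rw [ht', hc']; exact Nat.le_add_right n (n * n))).mono ?_ fun t'' h => ?_
  -- What remains of the 20000 units pays for copying the output.
  · have : 50 ≤ 20000 - 2 - 2 - 102 - 102 - 102 - 102 - 102 - 102 - 102 - powCmd.size - 102 - 102 -
        mainCmd.size := by decide
    nlinarith
  refine ⟨t.abs, hcon, h12.2.1, fun a => ?_, fun a => ?_, ?_, ?_⟩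
  · rw [h12.2.2, hA1]
  · rw [h12.2.2, hA4]
  · rw [h12.2.2]; exact hA5
  · rw [← ht']; exact h

end RAM

/-! ### Costs of clusterings of forests -/

section Clustering

variable {V : Type*} [Fintype V] [DecidableEq V]

open Classical in
/-- A forest has at most `|R| - 1` edges inside a nonempty set `R`; edges are counted as ordered
pairs. -/
theorem SimpleGraph.IsAcyclic.sum_adj_le {V : Type*}
    {G : SimpleGraph V} (hG : G.IsAcyclic) {R : Finset V}
    (hR : R.Nonempty) : ∑ u ∈ R, #{v ∈ R | G.Adj u v} + 2 ≤ 2 * #R := by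
  have hH := hG.induce (R : Set V)
  -- A maximal acyclic graph on R above the induced forest is a spanning tree of the complete graph,
  -- which has |R| - 1 edges.
  obtain ⟨T, hT, hmax⟩ := exists_maximal_isAcyclic_of_le_isAcyclic (G := ⊤) le_top hH
  have : Nonempty (R : Set V) := hR.to_subtype
  have htree : T.IsTree := (SimpleGraph.connected_top.maximal_le_isAcyclic_iff_isTree le_top).1 hmax
  have h1 := htree.card_edgeFinset
  have h2 : #(G.induce (R : Set V)).edgeFinset ≤ #T.edgeFinset :=
    card_le_card (SimpleGraph.edgeFinset_mono hT)
  have h3 := (G.induce (R : Set V)).sum_degrees_eq_twice_card_edges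
  have h4 : ∑ u ∈ R, #{v ∈ R | G.Adj u v} = ∑ u : (R : Set V), (G.induce (R : Set V)).degree u := by
    rw [← sum_coe_sort R]
    refine Fintype.sum_equiv (Equiv.refl _) _ _ fun u => ?_
    rw [← SimpleGraph.card_neighborFinset_eq_degree]
    refine (card_bij (s := (G.induce (R : Set V)).neighborFinset u) (t := {v ∈ R | G.Adj u v})
      (fun (v : (R : Set V)) _ => (v : V)) ?_ ?_ ?_).symm
    · intro v hv
      simpa using hv
    · intro a _ b _ h
      exact Subtype.ext h
    · intro b hb
      simp only [mem_filter] at hb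
      exact ⟨⟨b, hb.1⟩, by simpa using hb.2, rfl⟩
  have h5 : Fintype.card (R : Set V) = #R := by simp
  omega

/-- Membership of an ordered pair in twice the cost. -/
def Bad {V : Type*} (G : SimpleGraph V) (r : V → V → Prop) (u v : V) : Prop :=
  (u ≠ v ∧ ¬ G.Adj u v ∧ r u v) ∨ (G.Adj u v ∧ ¬ r u v)

/-- An unordered pair off the diagonal has exactly two orderings. -/
theorem card_pairs_eq_two_mul {V : Type*} [Fintype V] [DecidableEq V] (p : Sym2 V → Prop)
    [DecidablePred p] (q : V × V → Prop) [DecidablePred q] (hq : ∀ x, q x ↔ p s(x.1, x.2))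
    (hp : ∀ e, p e → ¬ e.IsDiag) : #{x : V × V | q x} = 2 * #{e : Sym2 V | p e} := by
  rw [card_eq_sum_card_fiberwise (f := fun x : V × V => s(x.1, x.2))
    (t := univ.filter p) (by intro x hx; simpa [hq] using hx), mul_comm, ← smul_eq_mul,
    ← sum_const]
  refine sum_congr rfl fun e he => ?_
  induction e with | h a b => ?_
  have hab : a ≠ b := by
    have := hp _ (mem_filter.1 he).2
    simpa using this
  have : filter (fun x : V × V => s(x.1, x.2) = s(a, b)) (univ.filter q) = {(a, b), (b, a)} := by
    ext ⟨x, y⟩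
    simp only [mem_filter, mem_univ, true_and, mem_insert, mem_singleton, Prod.mk.injEq] at he ⊢
    constructor
    · rintro ⟨-, h⟩
      simpa using h
    · intro h
      have : s(x, y) = s(a, b) := by simpa using h
      exact ⟨by rw [hq, this]; exact he, this⟩
  rw [this, card_pair]
  simp [hab]

open Classical in
theorem two_mul_ccCost (G : SimpleGraph V) (P : Finpartition (univ : Finset V)) :
    2 * ccCost G P = ∑ u, ∑ v, if Bad G (fun u v => P.part u = P.part v) u v then 1 else 0 := by
  have hs : ∀ u v, SameCluster P s(u, v) ↔ P.part u = P.part v := by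
    intro u v
    simp only [SameCluster, Sym2.mem_iff]
    constructor
    · intro h; exact h u (Or.inl rfl) v (Or.inr rfl)
    · rintro h a (rfl | rfl) b (rfl | rfl) <;> simp [h]
  have e1 := card_pairs_eq_two_mul (fun e => ¬ e.IsDiag ∧ e ∉ G.edgeSet ∧ SameCluster P e)
    (fun x => x.1 ≠ x.2 ∧ ¬ G.Adj x.1 x.2 ∧ P.part x.1 = P.part x.2) (by simp [hs]) fun e h => h.1
  have e2 := card_pairs_eq_two_mul (fun e => e ∈ G.edgeSet ∧ ¬ SameCluster P e)
    (fun x => G.Adj x.1 x.2 ∧ ¬ P.part x.1 = P.part x.2) (by simp [hs])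
    fun e h => G.not_isDiag_of_mem_edgeSet h.1
  have e3 : 2 * ccCost G P =
      #{x : V × V | x.1 ≠ x.2 ∧ ¬ G.Adj x.1 x.2 ∧ P.part x.1 = P.part x.2} +
      #{x : V × V | G.Adj x.1 x.2 ∧ ¬ P.part x.1 = P.part x.2} := by
    rw [e1, e2, ccCost, intraCost, interCost, mul_add]
  rw [e3, ← card_union_of_disjoint, ← filter_or, ← sum_product', card_filter]
  · refine sum_congr rfl fun x _ => ?_
    unfold Bad
    congr!
  · rw [disjoint_filter]
    intro x _ h h'
    exact h.2.1 h'.1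

/-- Partitions are given by equivalence relations. -/
theorem exists_partition (s : Setoid V) :
    ∃ P : Finpartition (univ : Finset V), ∀ u v, P.part u = P.part v ↔ s u v := by
  classical
  refine ⟨Finpartition.ofSetoid s, fun u v => ?_⟩
  rw [← Finpartition.mem_part_iff_part_eq_part _ (mem_univ _) (mem_univ _),
    Finpartition.mem_part_ofSetoid_iff_rel]
  exact ⟨fun h => s.symm h, fun h => s.symm h⟩

theorem mem_parts_iff (P : Finpartition (univ : Finset V)) (S : Finset V) :
    S ∈ P.parts ↔ ∃ x, P.part x = S := by
  constructor
  · intro h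
    obtain ⟨x, hx⟩ := P.nonempty_of_mem_parts h
    exact ⟨x, P.part_eq_of_mem h hx⟩
  · rintro ⟨x, rfl⟩
    exact P.part_mem.2 (mem_univ x)

theorem card_colors {V : Type*} (c : V → Fin 2) (S : Finset V) :
    #{v ∈ S | c v = 0} + #{v ∈ S | c v = 1} = #S := by
  have : ∀ v, c v = 1 ↔ ¬ c v = 0 := by intro v; generalize c v = x; revert x; decide
  simp only [this]
  exact card_filter_add_card_filter_not _

/-- Under the ratio `1 : 1`, fairness of a set is given by lower bounds. -/
theorem alphaRelaxedFairSet_iff {V : Type*} [Fintype V] {c : V → Fin 2}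
    (hc : ColorsOneToOne c) {α : ℚ} (h0 : 0 < α)
    {S : Finset V} (hS : S.Nonempty) :
    AlphaRelaxedFairSet c α S ↔ ∀ i, α * #S ≤ 2 * #{v ∈ S | c v = i} := by
  have hn := card_colors c univ
  have hs := card_colors c S
  unfold ColorsOneToOne at hc
  have hspos : (0 : ℚ) < #S := by exact_mod_cast hS.card_pos
  have hVpos : (0 : ℚ) < Fintype.card V := by
    rw [← card_univ]; exact_mod_cast (hS.mono (subset_univ S)).card_pos
  have hn' : ∀ i : Fin 2, (#{v | c v = i} : ℚ) / Fintype.card V = 1 / 2 := by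
    have hn2 : ((#{v | c v = 0} : ℕ) : ℚ) + (#{v | c v = 1} : ℕ) = Fintype.card V := by
      rw [← card_univ]; exact_mod_cast hn
    have hc' : ((#{v | c v = 0} : ℕ) : ℚ) = (#{v | c v = 1} : ℕ) := by exact_mod_cast hc
    intro i
    rw [div_eq_div_iff hVpos.ne' two_ne_zero]
    revert i
    rw [Fin.forall_fin_two]
    constructor <;> linarith
  have hs2 : ((#{v ∈ S | c v = 0} : ℕ) : ℚ) + (#{v ∈ S | c v = 1} : ℕ) = #S := by exact_mod_cast hs
  have l1 : ∀ i : Fin 2, α * (#{v | c v = i} : ℚ) / Fintype.card V = α / 2 := by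
    intro i; rw [mul_div_assoc, hn']; ring
  have l2 : ∀ i : Fin 2, (#{v | c v = i} : ℚ) / (α * Fintype.card V) = 1 / (2 * α) := by
    intro i; rw [mul_comm, ← div_div, hn', div_div]
  unfold AlphaRelaxedFairSet RelaxedFairSet
  simp only [l1, l2]
  have a1 : ∀ i, (α / 2 ≤ (#{v ∈ S | c v = i} : ℚ) / #S ↔ α * #S ≤ 2 * #{v ∈ S | c v = i}) := by
    intro i
    rw [div_le_div_iff₀ two_pos hspos, mul_comm 2]
  have a2 : ∀ i, ((#{v ∈ S | c v = i} : ℚ) / #S ≤ 1 / (2 * α) ↔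
      2 * α * #{v ∈ S | c v = i} ≤ #S) := by
    intro i
    rw [div_le_div_iff₀ hspos (by positivity), one_mul, mul_comm]
  simp only [a1, a2]
  refine ⟨fun h i => (h i).1, fun h i => ⟨h i, ?_⟩⟩
  -- The upper bound for one color follows from the lower bound for the other: 2αx = 2α|S| - 2αy ≤
  -- (2α - α²)|S| ≤ |S|, the last step because (1 - α)² ≥ 0.
  have key : ∀ x y : ℚ, x + y = #S → α * #S ≤ 2 * y → 2 * α * x ≤ #S := by
    intro x y hxy hy
    have : 2 * α * x = 2 * α * #S - α * (2 * y) := by rw [← hxy]; ring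
    rw [this]
    nlinarith [mul_le_mul_of_nonneg_left hy h0.le, mul_nonneg (sq_nonneg (1 - α)) hspos.le]
  revert i
  rw [Fin.forall_fin_two]
  exact ⟨key _ _ hs2 (h 1), key _ _ (by rw [add_comm]; exact hs2) (h 0)⟩

end Clustering

/-! ### Splitting large clusters -/

section Clustering

variable {V : Type*} [Fintype V] [DecidableEq V]

open Classical in
/-- Splitting a cluster of a forest into two parts with at least five vertices each lowers the
cost. -/
theorem ccCost_lt_of_split {G : SimpleGraph V} (hG : G.IsAcyclic)
    {P Q : Finpartition (univ : Finset V)} {S T : Finset V}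
    (hS : ∀ u ∈ S, ∀ v, P.part u = P.part v ↔ v ∈ S) (hTS : T ⊆ S)
    (hT : 5 ≤ #T) (hST : 5 ≤ #(S \ T))
    (hQ : ∀ u v, Q.part u = Q.part v ↔ P.part u = P.part v ∧ (u ∈ T ↔ v ∈ T)) :
    ccCost G Q < ccCost G P := by
  have hSne : S.Nonempty := (card_pos.1 (by omega : 0 < #T)).mono hTS
  have hcard : #(S \ T) + #T = #S := card_sdiff_add_card_eq_card hTS
  have hforest := hG.sum_adj_le hSne
  -- A nonadjacent pair between the two parts stops being counted. An adjacent one starts being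
  -- counted, and with the 1 on the left this has to be compensated by 2 on the right.
  have key : ∀ u v, (if Bad G (fun u v => Q.part u = Q.part v) u v then 1 else 0) +
      ((if u ∈ T then 1 else 0) * (if v ∈ S \ T then 1 else 0) +
        (if u ∈ S \ T then 1 else 0) * (if v ∈ T then 1 else 0)) ≤
      (if Bad G (fun u v => P.part u = P.part v) u v then 1 else 0) +
        2 * (if u ∈ S then (if v ∈ S then (if G.Adj u v then 1 else 0) else 0) else 0) := by
    intro u v
    rcases eq_or_ne u v with rfl | huv
    · by_cases a1 : u ∈ T <;> simp [Bad, a1]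
    have h1 := hS u
    have h2 : v ∈ S → (P.part u = P.part v ↔ u ∈ S) := fun h => eq_comm.trans (hS v h u)
    have h3 := @hTS u
    have h4 := @hTS v
    simp only [Bad, hQ, mem_sdiff]
    by_cases a1 : u ∈ T <;> by_cases a2 : v ∈ T <;> by_cases a3 : u ∈ S <;> by_cases a4 : v ∈ S <;>
      by_cases ha : G.Adj u v <;> simp_all
  have hsum := sum_le_sum fun u (_ : u ∈ univ) => sum_le_sum fun v (_ : v ∈ univ) => key u v
  simp only [sum_add_distrib, ← mul_sum, ← sum_mul] at hsum
  rw [← two_mul_ccCost, ← two_mul_ccCost] at hsum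
  have c1 : ∀ A : Finset V, (∑ u, if u ∈ A then 1 else 0) = #A := by
    intro A; rw [← card_filter]; simp
  have c2 : (∑ u, ∑ v, if u ∈ S then (if v ∈ S then (if G.Adj u v then 1 else 0) else 0) else 0) =
      ∑ u ∈ S, #{v ∈ S | G.Adj u v} := by
    have : ∀ u, (∑ v, if u ∈ S then (if v ∈ S then (if G.Adj u v then 1 else 0) else 0) else 0) =
        if u ∈ S then #{v ∈ S | G.Adj u v} else 0 := by
      intro u
      split_ifs
      · rw [sum_ite_mem, univ_inter, card_filter]
      · simp
    simp only [this]
    rw [sum_ite_mem, univ_inter]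
  rw [c2, c1, c1] at hsum
  -- With x and y the sizes of the parts, twice the new cost plus 2xy is at most twice the old cost
  -- plus 4(x + y) - 4, and (x - 2)(y - 2) ≥ 9 gives xy > 2(x + y).
  nlinarith

/-- A large fair cluster can be split into two fair clusters. -/
theorem exists_fair_split {V : Type*} [DecidableEq V] {c : V → Fin 2} {α : ℚ} (h0 : 0 < α)
    (h1 : α < 1) {a M : ℕ}
    (hM : 2 * (a : ℚ) / α = M) {S : Finset V} (hS : ∀ i, α * #S ≤ 2 * #{v ∈ S | c v = i})
    (hlarge : 2 * M ≤ #S) : ∃ T ⊆ S, #T = M ∧ (∀ i, α * #T ≤ 2 * #{v ∈ T | c v = i}) ∧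
      ∀ i, α * #(S \ T) ≤ 2 * #{v ∈ S \ T | c v = i} := by
  have hM' : α * M = 2 * a := by rw [← hM]; field_simp
  -- The color `i` is the one that is not more frequent in S.
  obtain ⟨i, j, hij, hle, hall⟩ : ∃ i j : Fin 2, i ≠ j ∧ #{v ∈ S | c v = i} ≤ #{v ∈ S | c v = j} ∧
      ∀ x, x = i ∨ x = j := by
    rcases le_total #{v ∈ S | c v = 0} #{v ∈ S | c v = 1} with h | h
    · exact ⟨0, 1, by decide, h, by decide⟩
    · exact ⟨1, 0, by decide, h, by decide⟩
  have hsplit : ∀ S : Finset V, #{v ∈ S | c v = i} + #{v ∈ S | c v = j} = #S := by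
    intro S
    have : ∀ v, c v = j ↔ ¬ c v = i := fun v =>
      ⟨fun h h' => hij (h'.symm.trans h), fun h => (hall _).resolve_left h⟩
    simp only [this]
    exact card_filter_add_card_filter_not _
  have hs := hsplit S
  have hsq : ((#{v ∈ S | c v = i} : ℕ) : ℚ) + (#{v ∈ S | c v = j} : ℕ) = #S := by exact_mod_cast hs
  have hlq : (2 : ℚ) * M ≤ #S := by exact_mod_cast hlarge
  have ha : a ≤ #{v ∈ S | c v = i} := by
    have : (a : ℚ) ≤ #{v ∈ S | c v = i} := by
      have := hS i
      have := mul_le_mul_of_nonneg_left hlq h0.le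
      have : (0 : ℚ) ≤ a := by positivity
      linarith
    exact_mod_cast this
  have haM : 2 * a ≤ M := by
    have : (2 : ℚ) * a ≤ M := by
      rw [← hM']
      exact mul_le_of_le_one_left (by positivity) h1.le
    exact_mod_cast this
  -- The part to be split off takes `a` vertices of color `i`, exactly the fraction α/2 of M, and
  -- fills up with color `j`.
  obtain ⟨A, hA, cA⟩ := exists_subset_card_eq ha
  obtain ⟨B, hB, cB⟩ := exists_subset_card_eq (s := {v ∈ S | c v = j}) (n := M - a) (by omega)
  have hAc : ∀ v ∈ A, v ∈ S ∧ c v = i := fun v hv => mem_filter.1 (hA hv)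
  have hBc : ∀ v ∈ B, v ∈ S ∧ c v = j := fun v hv => mem_filter.1 (hB hv)
  have hTS : A ∪ B ⊆ S := union_subset (fun v hv => (hAc v hv).1) (fun v hv => (hBc v hv).1)
  have ti : {v ∈ A ∪ B | c v = i} = A := by
    ext v
    simp only [mem_filter, mem_union]
    exact ⟨fun h => h.1.resolve_right fun hb => hij (h.2.symm.trans (hBc v hb).2),
      fun h => ⟨Or.inl h, (hAc v h).2⟩⟩
  have tj : {v ∈ A ∪ B | c v = j} = B := by
    ext v
    simp only [mem_filter, mem_union]
    exact ⟨fun h => h.1.resolve_left fun hb => hij ((hAc v hb).2.symm.trans h.2),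
      fun h => ⟨Or.inr h, (hBc v h).2⟩⟩
  have hTM : #(A ∪ B) = M := by
    have := hsplit (A ∪ B)
    rw [ti, tj] at this
    omega
  have hd : ∀ x, #{v ∈ S \ (A ∪ B) | c v = x} + #{v ∈ A ∪ B | c v = x} = #{v ∈ S | c v = x} := by
    intro x
    rw [← card_union_of_disjoint, ← filter_union, sdiff_union_of_subset hTS]
    exact disjoint_filter_filter sdiff_disjoint
  have hdi := hd i
  have hdj := hd j
  have hdS := card_sdiff_add_card_eq_card hTS
  rw [ti] at hdi
  rw [tj] at hdj
  have qi : ((#{v ∈ S \ (A ∪ B) | c v = i} : ℕ) : ℚ) + a = #{v ∈ S | c v = i} := by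
    exact_mod_cast cA ▸ hdi
  have qj : ((#{v ∈ S \ (A ∪ B) | c v = j} : ℕ) : ℚ) + M = #{v ∈ S | c v = j} + a := by
    exact_mod_cast (by omega : #{v ∈ S \ (A ∪ B) | c v = j} + M = #{v ∈ S | c v = j} + a)
  have qS : ((#(S \ (A ∪ B)) : ℕ) : ℚ) + M = #S := by
    exact_mod_cast (by omega : #(S \ (A ∪ B)) + M = #S)
  have qB : ((#B : ℕ) : ℚ) + a = M := by exact_mod_cast (by omega : #B + a = M)
  have qle : ((#{v ∈ S | c v = i} : ℕ) : ℚ) ≤ #{v ∈ S | c v = j} := by exact_mod_cast hle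
  have haMq : (2 : ℚ) * a ≤ M := by exact_mod_cast haM
  have hSi := hS i
  refine ⟨A ∪ B, hTS, hTM, fun x => ?_, fun x => ?_⟩
  · rw [hTM, hM']
    rcases hall x with rfl | rfl
    · rw [ti, cA]
    · rw [tj]; linarith
  · have e : ((#(S \ (A ∪ B)) : ℕ) : ℚ) = #S - M := by linarith
    rw [e, mul_sub, hM']
    rcases hall x with rfl | rfl
    · linarith
    -- For color `j` the remaining vertices, counted twice, number at least |S| - 2M + αM. This
    -- exceeds α(|S| - M) by (1 - α)(|S| - 2M) ≥ 0.
    · have := mul_nonneg (sub_nonneg.2 h1.le) (sub_nonneg.2 hlq)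
      nlinarith

theorem mem_part_iff (P : Finpartition (univ : Finset V)) {x y : V} :
    y ∈ P.part x ↔ P.part x = P.part y := by
  rw [Finpartition.mem_part_iff_part_eq_part _ (mem_univ _) (mem_univ _), eq_comm]

/-- Clusters of a minimum-cost fair partition of a forest are small. -/
theorem IsMinCostAlphaRelaxedFair.card_lt {G : SimpleGraph V} (hG : G.IsAcyclic) {c : V → Fin 2}
    (hc : ColorsOneToOne c) {α : ℚ} (h0 : 0 < α) (h1 : α < 1) {a M : ℕ}
    (hM : 2 * (a : ℚ) / α = M) (hM5 : 5 ≤ M) {P : Finpartition (univ : Finset V)}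
    (hP : IsMinCostAlphaRelaxedFair G c α P) {S : Finset V} (hS : S ∈ P.parts) : #S < 2 * M := by
  by_contra! hlarge
  have hfair := (alphaRelaxedFairSet_iff hc h0 (P.nonempty_of_mem_parts hS)).1 (hP.1 S hS)
  obtain ⟨T, hTS, hTM, hT1, hT2⟩ := exists_fair_split h0 h1 hM hfair hlarge
  -- Refining by membership in T splits S and leaves every other cluster unchanged.
  obtain ⟨Q, hQ⟩ := exists_partition (Setoid.ker fun x => (P.part x, decide (x ∈ T)))
  have hQ' : ∀ u v, Q.part u = Q.part v ↔ P.part u = P.part v ∧ (u ∈ T ↔ v ∈ T) := by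
    intro u v
    rw [hQ, Setoid.ker_def]
    simp
  have hSP : ∀ u ∈ S, ∀ v, P.part u = P.part v ↔ v ∈ S := by
    intro u hu v
    rw [P.part_eq_of_mem hS hu, eq_comm, P.part_eq_iff_mem hS]
  have hcard := card_sdiff_add_card_eq_card hTS
  have hlt := ccCost_lt_of_split hG hSP hTS (by omega) (by omega) hQ'
  refine absurd (hP.2 Q ?_) (not_le.2 hlt)
  intro R hR
  obtain ⟨x, rfl⟩ := (mem_parts_iff Q R).1 hR
  have hne := Q.nonempty_of_mem_parts hR
  have hmem : ∀ y, y ∈ Q.part x ↔ P.part x = P.part y ∧ (x ∈ T ↔ y ∈ T) := by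
    intro y
    rw [mem_part_iff, hQ']
  by_cases hxS : x ∈ S
  · by_cases hxT : x ∈ T
    · have : Q.part x = T := by
        ext y
        rw [hmem, hSP x hxS]
        exact ⟨fun h => h.2.1 hxT, fun h => ⟨hTS h, fun _ => h, fun _ => hxT⟩⟩
      rw [this] at hne ⊢
      exact (alphaRelaxedFairSet_iff hc h0 hne).2 hT1
    · have : Q.part x = S \ T := by
        ext y
        rw [hmem, hSP x hxS, mem_sdiff]
        tauto
      rw [this] at hne ⊢
      exact (alphaRelaxedFairSet_iff hc h0 hne).2 hT2
  · have : Q.part x = P.part x := by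
      ext y
      rw [hmem, mem_part_iff]
      refine ⟨fun h => h.1, fun h => ⟨h, ?_⟩⟩
      have hx : x ∉ T := fun h => hxS (hTS h)
      have hy : y ∉ T := fun hy => hxS ((hSP y (hTS hy) x).1 h.symm)
      exact iff_of_false hx hy
    rw [this]
    exact hP.1 _ ((mem_parts_iff P _).2 ⟨x, rfl⟩)

end Clustering

/-! ### The numbers derived from `α` -/

theorem num_den {α : ℚ} (h0 : 0 < α) (h1 : α < 1) :
    0 < α.num.toNat ∧ α.num.toNat < α.den ∧ α * α.den = α.num.toNat ∧
      α.num.toNat.Coprime α.den := by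
  have hn : 0 < α.num := Rat.num_pos.2 h0
  have hc : ((α.num.toNat : ℕ) : ℤ) = α.num := Int.toNat_of_nonneg hn.le
  have hm : α * α.den = α.num.toNat := by
    rw [Rat.mul_den_eq_num]
    exact_mod_cast hc.symm
  refine ⟨by omega, ?_, hm, ?_⟩
  · have : (0 : ℚ) < α.den := by exact_mod_cast α.den_pos
    have : ((α.num.toNat : ℕ) : ℚ) < α.den := by rw [← hm]; nlinarith
    exact_mod_cast this
  · have := α.reduced
    rwa [← hc, Int.natAbs_natCast] at this

open RAM in
/-- The size computed by the program is a size of clusters that can be split off. -/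
theorem exists_splitSize {p q : ℕ} (hp : 0 < p) (hpq : p < q) :
    5 ≤ splitSize p q ∧ ∃ a, splitSize p q * p = 2 * a * q := by
  -- For α = p/q the condition 2a/α = M reads Mp = 2aq. For odd p take M = 2q and a = p, for even p
  -- take M = q and a = p/2.
  have hb : ∃ a, baseSize p q * p = 2 * a * q := by
    unfold baseSize
    split_ifs with h
    · exact ⟨p, by ring⟩
    · refine ⟨p / 2, ?_⟩
      have : p = p / 2 + p / 2 := by omega
      calc q * p = q * (p / 2 + p / 2) := by rw [← this]
        _ = 2 * (p / 2) * q := by ring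
  obtain ⟨a, ha⟩ := hb
  constructor
  · unfold splitSize baseSize
    split_ifs <;> omega
  · unfold splitSize
    split_ifs with h
    · exact ⟨a, ha⟩
    · exact ⟨a + a, by rw [add_mul, ha]; ring⟩

open RAM in
/-- The size computed by the program is minimal. -/
theorem splitSize_le {p q : ℕ} (hcop : p.Coprime q) {a M : ℕ} (hM : M * p = 2 * a * q)
    (hM4 : 4 < M) : splitSize p q ≤ M := by
  -- Coprimality forces q to divide M, and for odd p the cofactor must be even; so M is a multiple
  -- of the base size.
  have hq : q ∣ M := hcop.symm.dvd_of_dvd_mul_right ⟨2 * a, by rw [hM, mul_comm]⟩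
  have hb : baseSize p q ∣ M := by
    unfold baseSize
    split_ifs with h
    · obtain ⟨k, rfl⟩ := hq
      rcases Nat.eq_zero_or_pos q with rfl | hq
      · simp
      have hk : k * p = 2 * a := by
        apply Nat.eq_of_mul_eq_mul_right hq
        rw [← hM]; ring
      have h2 : 2 ∣ k := by
        have hp : Nat.Coprime 2 p :=
           Nat.coprime_two_left.2 ⟨p / 2, by omega⟩
        exact hp.dvd_of_dvd_mul_right ⟨a, hk⟩
      obtain ⟨k, rfl⟩ := h2
      exact ⟨k, by ring⟩
    · exact hq
  have hle := Nat.le_of_dvd (by omega) hb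
  unfold splitSize
  split_ifs with h
  · exact hle
  · obtain ⟨k, hk⟩ := hb
    -- Here the base size is at most 4, whereas M > 4.
    have : 2 ≤ k := by
      by_contra hk2
      have : k ≤ 1 := by omega
      have := Nat.mul_le_mul_left (RAM.baseSize p q) this
      omega
    have := Nat.mul_le_mul_left (RAM.baseSize p q) this
    omega

theorem clusterBound_spec {α : ℚ} (h0 : 0 < α) : ∃ M : ℕ, 2 * (alphaHat α : ℚ) / α = M ∧ 4 < M ∧
    clusterBound α = 2 * M / α := by
  obtain ⟨⟨M, hM⟩, h4⟩ := (alphaHat_isLeast h0).1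
  refine ⟨M, hM, by rw [hM] at h4; exact_mod_cast h4, ?_⟩
  rw [← hM, clusterBound]
  field_simp
  ring

/-- Clusters of optimal partitions have fewer than `d` vertices. -/
theorem card_lt_clusterBound {n : ℕ} {F : SimpleGraph (Fin n)} {c : Fin n → Fin 2} {α : ℚ}
    (hF : F.IsAcyclic) (hc : ColorsOneToOne c) (h0 : 0 < α) (h1 : α < 1)
    {P : Finpartition (univ : Finset (Fin n))} (hP : IsMinCostAlphaRelaxedFair F c α P)
    {S : Finset (Fin n)} (hS : S ∈ P.parts) : (#S : ℚ) < clusterBound α := by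
  obtain ⟨M, hM, h4, hd⟩ := clusterBound_spec h0
  have := hP.card_lt hF hc h0 h1 hM h4 hS
  have h2 : (#S : ℚ) < 2 * M := by exact_mod_cast this
  rw [hd, lt_div_iff₀ h0]
  have : (0 : ℚ) ≤ #S := by positivity
  nlinarith

-- Since p ≤ q - 1 and q ≤ M, the bound d = 2M/α is at least 2Mq/(q - 1) ≥ 2M + 2. This slack
-- absorbs the lower-order factors of the running time.
open RAM in
theorem splitSize_le_clusterBound {α : ℚ} (h0 : 0 < α) (h1 : α < 1) :
    2 * (splitSize α.num.toNat α.den : ℚ) + 2 ≤ clusterBound α := by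
  obtain ⟨M, hM, h4, hd⟩ := clusterBound_spec h0
  obtain ⟨hp, hpq, hα, hcop⟩ := num_den h0 h1
  have hden : (0 : ℚ) < α.den := by exact_mod_cast α.den_pos
  have hMq : M * α.num.toNat = 2 * alphaHat α * α.den := by
    have : (M : ℚ) * α.num.toNat = 2 * alphaHat α * α.den := by
      rw [← hM, ← hα]; field_simp
    exact_mod_cast this
  have hle := splitSize_le hcop hMq h4
  have hq := splitSize_bounds (p := α.num.toNat) (q := α.den) (by omega)
  have e1 : (splitSize α.num.toNat α.den : ℚ) ≤ M := by exact_mod_cast hle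
  have e2 : (α.den : ℚ) ≤ M := by exact_mod_cast hq.1.trans (hq.2.trans hle)
  have e3 : (α.num.toNat : ℚ) + 1 ≤ α.den := by exact_mod_cast hpq
  have e4 : (2 * (M : ℚ) + 2) * α ≤ 2 * M := by
    have : (2 * (M : ℚ) + 2) * (α * α.den) ≤ 2 * M * α.den := by
      rw [hα]
      nlinarith [Nat.cast_nonneg (α := ℚ) M]
    nlinarith
  rw [hd, le_div_iff₀ h0]
  nlinarith

/-! ### The time bound -/

/-- (1 + 1/n)^n ≤ e < 4 ≤ n². -/
theorem succ_pow_self_le {n : ℕ} (hn : 2 ≤ n) : (n + 1) ^ n ≤ n ^ (n + 2) := by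
  have hpos : (0 : ℝ) < n := by positivity
  have h1 : (1 + 1 / (n : ℝ)) ^ n ≤ 4 := by
    calc (1 + 1 / (n : ℝ)) ^ n ≤ Real.exp (1 / n) ^ n := by
          gcongr
          rw [add_comm]
          exact Real.add_one_le_exp _
      _ = Real.exp 1 := by rw [← Real.exp_nat_mul]; congr 1; field_simp
      _ ≤ 4 := by linarith [Real.exp_one_lt_d9]
  have h2 : ((n : ℝ) + 1) ^ n ≤ (n : ℝ) ^ (n + 2) := by
    have e : (n : ℝ) + 1 = n * (1 + 1 / n) := by field_simp
    rw [e, mul_pow, pow_add]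
    gcongr
    refine h1.trans ?_
    have : (2 : ℝ) ≤ n := by exact_mod_cast hn
    nlinarith
  exact_mod_cast h2

/-- Comparing n-th powers, `succ_pow_self_le` reduces the claim to (n + 2)(2E² + 16) ≤ n(2E² + 6E +
32). This holds since 4E ≤ 4n + 4 ≤ 6n and 32 ≤ 16n. -/
theorem succ_pow_le {n E : ℕ} (hn : 2 ≤ n) (hE : E ≤ n + 1) :
    (n + 1) ^ (2 * E ^ 2 + 16) ≤ n ^ (2 * E ^ 2 + 6 * E + 32) := by
  have h : ((n + 1) ^ (2 * E ^ 2 + 16)) ^ n ≤ (n ^ (2 * E ^ 2 + 6 * E + 32)) ^ n := by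
    calc ((n + 1) ^ (2 * E ^ 2 + 16)) ^ n = ((n + 1) ^ n) ^ (2 * E ^ 2 + 16) := by
          rw [← pow_mul, ← pow_mul, mul_comm]
      _ ≤ (n ^ (n + 2)) ^ (2 * E ^ 2 + 16) := Nat.pow_le_pow_left (succ_pow_self_le hn) _
      _ = n ^ ((n + 2) * (2 * E ^ 2 + 16)) := by rw [← pow_mul]
      _ ≤ n ^ ((2 * E ^ 2 + 6 * E + 32) * n) := by
          refine Nat.pow_le_pow_right (by omega) ?_
          have : 4 * E ≤ 6 * n := by omega
          nlinarith [Nat.mul_le_mul_left E this]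
      _ = (n ^ (2 * E ^ 2 + 6 * E + 32)) ^ n := by rw [← pow_mul]
  exact (Nat.pow_le_pow_iff_left (by omega)).1 h

-- Twelve extra factors n + 1 come from `smallBound`, and four from bounding the factors E in the
-- table size by n + 1. The latter is one reason for limiting the cap by n + 1.
open RAM in
theorem mono_program_le {n p q : ℕ} (hn : 2 ≤ n) (hpq : p < q) :
    mono (smallBound n p q) (constVal n p q 11) (6, 2) ≤
      n ^ (2 * capSize n p q ^ 2 + 6 * capSize n p q + 32) * (2 * splitSize p q) ^ 6 := by
  obtain ⟨-, hE, -⟩ := capSize_bounds (n := n) (p := p) (q := q) (by omega)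
  set E := capSize n p q
  have hN : constVal n p q 11 ≤ (n + 1) ^ (E * E + 2) := by
    rw [pow_add, pow_two (n + 1)]
    exact Nat.mul_le_mul_left _ (Nat.mul_le_mul hE hE)
  calc mono (smallBound n p q) (constVal n p q 11) (6, 2)
      ≤ smallBound n p q ^ 6 * ((n + 1) ^ (E * E + 2)) ^ 2 :=
        Nat.mul_le_mul_left _ (Nat.pow_le_pow_left hN 2)
    _ = (n + 1) ^ (2 * E ^ 2 + 16) * (2 * splitSize p q) ^ 6 := by unfold smallBound; ring
    _ ≤ _ := Nat.mul_le_mul_right _ (succ_pow_le hn hE)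

-- E ≤ 2M ≤ d - 2 and d ≥ 12 make the exponent of n large enough, and (2M)^6 ≤ (d + 1)^(4d) since 4d
-- ≥ 6.
open RAM in
theorem time_le {n : ℕ} (hn : 2 ≤ n) {α : ℚ} (h0 : 0 < α) (h1 : α < 1) :
    (mono (smallBound n α.num.toNat α.den) (constVal n α.num.toNat α.den 11) (6, 2) : ℝ) ≤
      (n : ℝ) ^ (2 * (clusterBound α : ℝ) ^ 2 + 6 * (clusterBound α : ℝ) + 4) *
        ((clusterBound α : ℝ) + 1) ^ (4 * (clusterBound α : ℝ)) := by
  obtain ⟨hp, hpq, -, -⟩ := num_den h0 h1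
  have hm := mono_program_le hn hpq
  obtain ⟨-, -, hE⟩ := capSize_bounds (n := n) (p := α.num.toNat) (q := α.den) (by omega)
  obtain ⟨h5, -⟩ := exists_splitSize hp hpq
  have hd : 2 * (splitSize α.num.toNat α.den : ℝ) + 2 ≤ (clusterBound α : ℝ) := by
    exact_mod_cast splitSize_le_clusterBound h0 h1
  generalize (clusterBound α : ℝ) = d at *
  generalize splitSize α.num.toNat α.den = M at *
  generalize capSize n α.num.toNat α.den = E at *
  have h5' : (5 : ℝ) ≤ M := by exact_mod_cast h5
  have hE' : (E : ℝ) ≤ 2 * M := by exact_mod_cast hE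
  have hn' : (1 : ℝ) ≤ n := by exact_mod_cast (by omega : 1 ≤ n)
  calc (mono (smallBound n α.num.toNat α.den) (constVal n α.num.toNat α.den 11) (6, 2) : ℝ)
      ≤ (n : ℝ) ^ (2 * E ^ 2 + 6 * E + 32) * (2 * M) ^ 6 := by exact_mod_cast hm
    _ ≤ _ := by
      refine mul_le_mul ?_ ?_ (by positivity) (by positivity)
      · rw [← Real.rpow_natCast]
        refine Real.rpow_le_rpow_of_exponent_le hn' ?_
        push_cast
        have : (0 : ℝ) ≤ E := by positivity
        nlinarith
      · calc (2 * (M : ℝ)) ^ 6 ≤ (d + 1) ^ 6 := by gcongr; linarith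
          _ = (d + 1) ^ (6 : ℝ) := by norm_cast
          _ ≤ _ := Real.rpow_le_rpow_of_exponent_le (by linarith) (by linarith)

namespace RAM

/-! ### Correctness -/

section Correctness

variable {n : ℕ} {F : SimpleGraph (Fin n)} {c : Fin n → Fin 2} {α : ℚ}

theorem input_color (x : Fin n) : (input F c α).mem x = c x := by
  simp [input]

-- Column indices are less than n, so the address determines row and column, and the existential in
-- `input` concerns a single pair.
open Classical in
theorem input_adj (u v : Fin n) :
    (input F c α).mem (n + n * u + v) = if F.Adj u v then 1 else 0 := by
  have h1 : ¬ n + n * u + v < n := by have : 0 ≤ n * (u : ℕ) := Nat.zero_le _; omega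
  simp only [input, h1, dif_neg, not_false_eq_true]
  refine if_congr ⟨?_, fun h => ⟨u, v, by ring, h⟩⟩ rfl rfl
  rintro ⟨u', v', h, ha⟩
  have h2 : n * (u : ℕ) + v = n * u' + v' := by
    rw [mul_comm (u' : ℕ)] at h
    omega
  have hn : 0 < n := u.pos
  have e1 : (u : ℕ) = u' := by
    have := congrArg (· / n) h2
    simpa [Nat.mul_add_div hn, Nat.div_eq_of_lt] using this
  have e2 : (v : ℕ) = v' := by
    rw [e1] at h2
    omega
  rwa [Fin.ext e1, Fin.ext e2]

theorem input_zero {a : ℕ} (ha : n + n * n ≤ a) : (input F c α).mem a = 0 := by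
  have h1 : ¬ a < n := by have : 0 ≤ n * n := Nat.zero_le _; omega
  simp only [input, h1, dif_neg, not_false_eq_true]
  refine if_neg ?_
  rintro ⟨u, v, h, -⟩
  have : ((u : ℕ) + 1) * n ≤ n * n := Nat.mul_le_mul_right _ u.2
  have := v.2
  rw [add_mul] at *
  omega

/-- The constants and the input cells are those for the instance. -/
structure Env.IsInput (e : Env) (F : SimpleGraph (Fin n)) (c : Fin n → Fin 2) (α : ℚ) : Prop where
  con : e.con = constVal n α.num.toNat α.den
  inp : e.inp = (input F c α).mem

theorem Env.IsInput.n_eq {e : Env} (h : e.IsInput F c α) : e.inst.n = n := by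
  simp [Env.inst, h.con, constVal]

theorem Env.IsInput.adj_iff {e : Env} (h : e.IsInput F c α) (u v : Fin n) :
    e.inst.adj u v ≠ 0 ↔ F.Adj u v := by
  classical
  have : e.inst.adj u v = (input F c α).mem (n + n * u + v) := by
    simp [Env.inst, h.con, h.inp, constVal]
  rw [this, input_adj]
  simp

theorem Env.IsInput.wt_eq_iff {e : Env} (h : e.IsInput F c α)
    (hE : capSize n α.num.toNat α.den ≠ 1) (x : Fin n) : e.inst.wt x = e.inst.E ↔ c x = 0 := by
  have e1 : e.inst.wt x = if (c x : ℕ) ≠ 0 then 1 else capSize n α.num.toNat α.den := by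
    simp only [Env.inst, h.inp, input_color, h.con]
    rfl
  have e2 : e.inst.E = capSize n α.num.toNat α.den := by
    simp only [Env.inst, h.con]
    rfl
  rw [e1, e2]
  by_cases h0 : c x = 0
  · simp [h0]
  · have : (c x : ℕ) ≠ 0 := fun h' => h0 (Fin.ext h')
    simp [h0, this, hE.symm]

/-- The labeling `l` represents the partition `P`. -/
def Labels (l : ℕ → ℕ) (P : Finpartition (univ : Finset (Fin n))) : Prop :=
  (∀ x < n, l x < n) ∧ ∀ u v : Fin n, l u = l v ↔ P.part u = P.part v

theorem exists_labels (P : Finpartition (univ : Finset (Fin n))) : ∃ l, Labels l P := by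
  classical
  have hne : ∀ x, (P.part x).Nonempty := fun x => ⟨x, P.mem_part (mem_univ x)⟩
  -- Every vertex is labeled by the least vertex of its cluster.
  refine ⟨fun x => if h : x < n then ((P.part ⟨x, h⟩).min' (hne _) : Fin n) else 0,
    fun x hx => ?_, fun u v => ?_⟩
  · simp only [hx, dif_pos]
    exact Fin.is_lt _
  · simp only [Fin.is_lt, dif_pos, Fin.eta]
    constructor
    · intro h
      have h1 := (mem_part_iff P).1 (min'_mem _ (hne u))
      have h2 := (mem_part_iff P).1 (min'_mem _ (hne v))
      rw [Fin.ext h] at h1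
      exact h1.trans h2.symm
    · intro h
      simp only [h]

theorem Labels.wsum {e : Env} (h : e.IsInput F c α) {l : ℕ → ℕ}
    {P : Finpartition (univ : Finset (Fin n))} (hl : Labels l P) (f : ℕ → ℕ) (x : Fin n) :
    e.inst.wsum f l (l x) = ∑ y ∈ P.part x, f y := by
  rw [Inst.wsum, h.n_eq, sum_range, ← sum_filter]
  refine sum_congr ?_ fun _ _ => rfl
  ext y
  rw [mem_filter, mem_part_iff, hl.2, eq_comm]
  simp

/-- With α = p/q the lower bounds, which suffice for the ratio 1 : 1, become inequalities between
natural numbers. Labels that are not in use satisfy them trivially. -/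
theorem Labels.fair_iff {e : Env} (h : e.IsInput F c α) (hE : capSize n α.num.toNat α.den ≠ 1)
    (hc : ColorsOneToOne c) (h0 : 0 < α) (h1 : α < 1) {l : ℕ → ℕ}
    {P : Finpartition (univ : Finset (Fin n))} (hl : Labels l P) :
    e.inst.Fair (e.con 1) (e.con 2) l ↔ AlphaRelaxedFair c α P := by
  obtain ⟨-, -, hα, -⟩ := num_den h0 h1
  have hden : (0 : ℚ) < α.den := by exact_mod_cast α.den_pos
  have c1 : e.con 1 = α.num.toNat := by rw [h.con]; rfl
  have c2 : e.con 2 = α.den := by rw [h.con]; rfl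
  have s1 : ∀ x : Fin n, e.inst.sz l (l x) = #(P.part x) := by
    intro x; rw [Inst.sz, hl.wsum h]; simp
  have s2 : ∀ x : Fin n, e.inst.heavy l (l x) = #{v ∈ P.part x | c v = 0} := by
    intro x
    rw [Inst.heavy, hl.wsum h, card_filter]
    simp only [h.wt_eq_iff hE]
  have s3 : ∀ x : Fin n, e.inst.light l (l x) = #{v ∈ P.part x | c v = 1} := by
    intro x
    have : ∀ v, c v = 1 ↔ ¬ c v = 0 := by intro v; generalize c v = x; revert x; decide
    rw [Inst.light, hl.wsum h, card_filter]
    simp only [h.wt_eq_iff hE, this, ite_not]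
  have key : ∀ s t : ℕ, α.num.toNat * s ≤ α.den * (t + t) ↔ α * s ≤ 2 * t := by
    intro s t
    rw [← Nat.cast_le (α := ℚ)]
    push_cast
    rw [← hα, ← mul_le_mul_iff_right₀ hden (b := α * s)]
    constructor <;> intro h <;> linarith
  have hpart : ∀ x : Fin n, (α.num.toNat * e.inst.sz l (l x) ≤
      α.den * (e.inst.heavy l (l x) + e.inst.heavy l (l x)) ∧ α.num.toNat * e.inst.sz l (l x) ≤
      α.den * (e.inst.light l (l x) + e.inst.light l (l x))) ↔
      AlphaRelaxedFairSet c α (P.part x) := by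
    intro x
    rw [s1, s2, s3, key, key, alphaRelaxedFairSet_iff hc h0 ⟨x, P.mem_part (mem_univ x)⟩,
      Fin.forall_fin_two]
  unfold Inst.Fair
  rw [c1, c2, h.n_eq]
  constructor
  · intro hf S hS
    obtain ⟨x, rfl⟩ := (mem_parts_iff P S).1 hS
    exact (hpart x).1 (hf _ (hl.1 x x.2))
  · intro hf i hi
    by_cases hx : ∃ x : Fin n, l x = i
    · obtain ⟨x, rfl⟩ := hx
      exact (hpart x).2 (hf _ ((mem_parts_iff P _).2 ⟨x, rfl⟩))
    · push Not at hx
      have : e.inst.sz l i = 0 := by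
        unfold Inst.sz Inst.wsum
        refine sum_eq_zero fun x hx' => if_neg ?_
        rw [h.n_eq] at hx'
        exact hx ⟨x, mem_range.1 hx'⟩
      simp [this]

-- The identity holds for each ordered pair separately. The second sum depends on F only, so
-- minimizing `val` is minimizing the cost.
open Classical in
theorem Labels.val_eq {e : Env} (h : e.IsInput F c α) {l : ℕ → ℕ}
    {P : Finpartition (univ : Finset (Fin n))} (hl : Labels l P) :
    e.inst.val l = 2 * ccCost F P +
      ∑ u : Fin n, ∑ v : Fin n, ((if F.Adj u v then 1 else 2) + if u = v then 1 else 0) := by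
  rw [two_mul_ccCost, Inst.val, Inst.same, Inst.miss, h.n_eq]
  simp only [sum_range, ← sum_add_distrib]
  refine sum_congr rfl fun u _ => sum_congr rfl fun v _ => ?_
  have h1 := hl.2 u v
  have h2 := h.adj_iff u v
  have h3 := hl.1 u u.2
  have h4 : u = v → ¬ F.Adj u v := by rintro rfl; exact F.irrefl
  have h5 : u = v → P.part u = P.part v := by rintro rfl; rfl
  simp only [Inst.Kept, h.n_eq, Bad, h1, h2, h3]
  by_cases a1 : F.Adj u v <;> by_cases a2 : P.part u = P.part v <;> by_cases a3 : u = v <;>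
    simp_all

theorem Labels.small {e : Env} (h : e.IsInput F c α) {l : ℕ → ℕ}
    {P : Finpartition (univ : Finset (Fin n))} (hl : Labels l P)
    (hP : ∀ S ∈ P.parts, #S < 2 * splitSize α.num.toNat α.den) : e.inst.Small l := by
  intro x hx
  have e6 : e.inst.E = capSize n α.num.toNat α.den := by
    simp only [Env.inst, h.con]
    rfl
  rw [h.n_eq] at hx ⊢
  have hs := hl.wsum h (fun _ => 1) ⟨x, hx⟩
  rw [Inst.wsum, h.n_eq, ← card_filter, sum_const, smul_eq_mul, mul_one] at hs
  rw [hs, e6]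
  have h1 := hP _ ((mem_parts_iff P _).2 ⟨⟨x, hx⟩, rfl⟩)
  have h2 := card_le_univ (P.part ⟨x, hx⟩)
  rw [Fintype.card_fin] at h2
  unfold capSize
  omega

/-- Every nonempty set of vertices of a forest contains a vertex with at most one neighbor in the
set. -/
theorem Env.IsInput.exists_leaf {e : Env} (h : e.IsInput F c α) (hF : F.IsAcyclic) :
    ∀ R ⊆ range e.inst.n, R.Nonempty → ∃ x ∈ R, #{y ∈ R | e.inst.adj x y ≠ 0} ≤ 1 := by
  classical
  intro R hR hne
  rw [h.n_eq] at hR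
  obtain ⟨R', rfl⟩ : ∃ R' : Finset (Fin n), R = R'.map Fin.valEmbedding := by
    refine ⟨univ.filter fun x => (x : ℕ) ∈ R, ?_⟩
    ext x
    simp only [mem_map, mem_filter, mem_univ, true_and, Fin.valEmbedding_apply]
    exact ⟨fun hx => ⟨⟨x, mem_range.1 (hR hx)⟩, hx, rfl⟩, by rintro ⟨a, ha, rfl⟩; exact ha⟩
  have hne' : R'.Nonempty := by simpa using hne
  have hf := hF.sum_adj_le hne'
  -- Otherwise the degrees inside the set would sum to at least twice its size, too much for a
  -- forest.
  obtain ⟨u, hu, hle⟩ : ∃ u ∈ R', #{v ∈ R' | F.Adj u v} ≤ 1 := by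
    by_contra! hall
    have := card_nsmul_le_sum R' (fun u => #{v ∈ R' | F.Adj u v}) 2 hall
    rw [smul_eq_mul] at this
    omega
  refine ⟨u, mem_map_of_mem _ hu, ?_⟩
  rw [filter_map, card_map]
  convert hle using 3
  exact h.adj_iff _ _

/-- The partition into a single cluster is fair, so there are fair partitions to minimize over. -/
theorem exists_isMinCost (hc : ColorsOneToOne c) (h0 : 0 < α) (h1 : α < 1) :
    ∃ P, IsMinCostAlphaRelaxedFair F c α P := by
  obtain ⟨P₀, hP₀⟩ := exists_partition (⊤ : Setoid (Fin n))
  have hfair : AlphaRelaxedFair c α P₀ := by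
    intro S hS
    have hne := P₀.nonempty_of_mem_parts hS
    obtain ⟨x, rfl⟩ := (mem_parts_iff P₀ S).1 hS
    have : P₀.part x = univ := by
      ext y
      rw [mem_part_iff, hP₀]
      simp
    rw [this] at hne ⊢
    rw [alphaRelaxedFairSet_iff hc h0 hne]
    have hs := card_colors c univ
    unfold ColorsOneToOne at hc
    have hsq : ((#{v | c v = 0} : ℕ) : ℚ) + (#{v | c v = 1} : ℕ) = #(univ : Finset (Fin n)) := by
      exact_mod_cast hs
    have hcq : ((#{v | c v = 0} : ℕ) : ℚ) = (#{v | c v = 1} : ℕ) := by exact_mod_cast hc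
    have hle := mul_le_of_le_one_left (Nat.cast_nonneg (α := ℚ) #(univ : Finset (Fin n))) h1.le
    rw [Fin.forall_fin_two]
    constructor <;> linarith
  obtain ⟨P, hP, hmin⟩ := WellFounded.has_min (measure (ccCost F)).wf
    {P | AlphaRelaxedFair c α P} ⟨P₀, hfair⟩
  exact ⟨P, hP, fun Q hQ => not_lt.1 (hmin Q hQ)⟩

end Correctness

end RAM

theorem mainTheorem9 :
    (∃ (prog : RAM.Program) (C : ℝ),
      ∀ (n : ℕ) (F : SimpleGraph (Fin n)) (c : Fin n → Fin 2) (α : ℚ),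
        0 < n → F.IsAcyclic → ColorsOneToOne c → 0 < α → α < 1 →
        ∃ (s : RAM.State) (t : ℕ) (P : Finpartition (univ : Finset (Fin n))),
          RAM.Exec prog (RAM.input F c α) s t ∧
          RAM.Outputs s P ∧
          IsMinCostAlphaRelaxedFair F c α P ∧
          (t : ℝ) ≤ C *
            ((n : ℝ) ^ (2 * (clusterBound α : ℝ) ^ 2 + 6 * (clusterBound α : ℝ) + 4) *
              ((clusterBound α : ℝ) + 1) ^ (4 * (clusterBound α : ℝ)))) ∧
    (∀ (n : ℕ) (F : SimpleGraph (Fin n)) (c : Fin n → Fin 2) (α : ℚ),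
        F.IsAcyclic → ColorsOneToOne c → 0 < α → α < 1 →
        ∀ P : Finpartition (univ : Finset (Fin n)), IsMinCostAlphaRelaxedFair F c α P →
          ∀ S ∈ P.parts, (#S : ℚ) < clusterBound α) := by
  refine ⟨⟨RAM.program, 20000, fun n F c α hn hF hc h0 h1 => ?_⟩,
    fun n F c α hF hc h0 h1 P hP S hS => card_lt_clusterBound hF hc h0 h1 hP hS⟩
  obtain ⟨hp, hpq, hα, -⟩ := num_den h0 h1
  -- Equally many vertices of both colors make n even. The time bound relies on this, as powers of n
  -- are useless for n = 1.
  have hn2 : 2 ≤ n := by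
    have hs := card_colors c univ
    unfold ColorsOneToOne at hc
    rw [card_fin] at hs
    omega
  have hden : (0 : ℚ) < α.den := by exact_mod_cast α.den_pos
  obtain ⟨h5, a, ha⟩ := exists_splitSize hp hpq
  -- `splitSize` is an admissible value of 2a/α, so optimal clusters have fewer than twice that many
  -- vertices, and the optimal partition is among those with which the output is compared.
  have hM : 2 * (a : ℚ) / α = RAM.splitSize α.num.toNat α.den := by
    have : (RAM.splitSize α.num.toNat α.den : ℚ) * α.num.toNat = 2 * a * α.den := by
      exact_mod_cast ha
    rw [← hα] at this
    rw [div_eq_iff h0.ne']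
    apply mul_right_cancel₀ hden.ne'
    linarith
  -- The cap is the minimum of n + 1 ≥ 3 and twice a number that is at least 5, so the two weights
  -- differ.
  have hE : RAM.capSize n α.num.toNat α.den ≠ 1 := by unfold RAM.capSize; omega
  obtain ⟨Q, hQ⟩ := RAM.exists_isMinCost (F := F) hc h0 h1
  obtain ⟨l, hl⟩ := RAM.exists_labels Q
  obtain ⟨s, t, hexec, ht, e, e1, e2, e3, e4, e5, e6⟩ := RAM.runs_program (s := RAM.input F c α)
    (n := n) hpq (fun r => rfl) fun a ha => RAM.input_zero ha
  have he : e.IsInput F c α := ⟨e1, e2⟩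
  have hok : e.Ok := by
    constructor <;> simp only [e1, RAM.constVal]
    exacts [hn, fun t ht => e5 t ht.le]
  obtain ⟨w1, w2, w3⟩ := RAM.run_main hok e3 e4 (by
      rw [he.n_eq]
      intro x hx y hy h
      exact (he.adj_iff ⟨y, hy⟩ ⟨x, hx⟩).2 ((he.adj_iff ⟨x, hx⟩ ⟨y, hy⟩).1 h).symm)
    (he.exists_leaf hF) (by rw [e1]; exact hE)
    (hl.small he fun S hS => hQ.card_lt hF hc h0 h1 hM h5 hS)
    ((hl.fair_iff he hE hc h0 h1).2 hQ.1) (by unfold Inst.Full; rw [he.n_eq]; exact hl.1)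
  obtain ⟨P, hP⟩ := exists_partition (Setoid.ker fun x : Fin n => (RAM.mainCmd.run e).arr 0 x)
  rw [Inst.Full, he.n_eq] at w1
  have hl' : RAM.Labels ((RAM.mainCmd.run e).arr 0) P :=
    ⟨w1, fun u v => by rw [hP, Setoid.ker_def]⟩
  refine ⟨s, t, P, hexec, fun u v => ?_, ⟨(hl'.fair_iff he hE hc h0 h1).1 w2, fun R hR => ?_⟩, ?_⟩
  · rw [e6 u u.2, e6 v v.2]
    exact hl'.2 u v
  -- The additive constants agree, so the output costs at most as much as the optimal partition `Q`.
  · rw [hl'.val_eq he, hl.val_eq he] at w3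
    have := hQ.2 R hR
    omega
  · refine le_trans ?_ (mul_le_mul_of_nonneg_left (time_le hn2 h0 h1) (by norm_num))
    exact_mod_cast ht
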